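/- \textbf{Theorem (Differentiability and compactness properties of $\mathcal J_u$ and $D_u\mathcal J_u$).} Let $\Theta$ be a metric space with a Borel probability measure $\mu$, let $T>0$, $1<q<\infty$, $p_0>4$, $p_1\in(2,p_0/2]$ and $p_1'=p_1/(p_1-1)$. Let $\nu$ be a finite positive Radon measure on $[0,T]$, and let $F=(F_1,\dots,F_k)$ with $F_i:\mathbb R^n\times\Theta\to\mathbb R^n$, $x_0:\Theta\to\mathbb R^n$ and $a:[0,T]\times\mathbb R^n\times\Theta\to\mathbb R$ satisfy the following. (1) Each $F_i$ is Borel measurable on $\mathbb R^n\times\Theta$, and there are $L,C>0$ such that for $\mu$-a.e. $\theta$, all $i$ and all $x,y$: $|F_i(x,\theta)-F_i(y,\theta)|\le L|x-y|$ and $|F_i(0,\theta)|\le C$. (2) For $\mu$-a.e. $\theta$ the maps $F_i(\cdot,\theta)$ are $C^1$; the gradients $\nabla_xF_i$ are Borel measurable on $\mathbb R^n\times\Theta$; and there is $L'>0$ such that $|\nabla_xF_i(x,\theta)-\nabla_xF_i(y,\theta)|\le L'|x-y|$ for $\mu$-a.e. $\theta$, all $i$ and all $x,y$. (3) $x_0\in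 L^{p_0}_\mu(\Theta,\mathbb R^n)$. (4) There is $c_a\in\mathbb R$ with $a(t,x,\theta)\ge c_a$ for $\mu$-a.e. $\theta$ and all $(t,x)$. For $\mu$-a.e. $\theta$, $a(t,\cdot,\theta)$ is differentiable for every $t$, and $a(\cdot,\cdot,\theta)$ and $D_xa(\cdot,\cdot,\theta)$ are continuous on $[0,T]\times\mathbb R^n$. For every $(t,x)$, $a(t,x,\cdot)$ is measurable and $D_xa(t,x,\cdot)$ is $\mu$-measurable. The functions $\sup_{t}|a(t,0,\cdot)|$ and $\sup_t|D_xa(t,0,\cdot)|$ belong to $L^1_\mu$ and $L^{p_1'}_\mu$ respectively. There are constants $C^{\mathrm{Lip}},C^{\mathrm{Lip}}_{\mathrm{der}}>0$ and non-negative $g\in L^{p_1'}_\mu$, $h\in L^{p_1/(p_1-2)}_\mu$ such that for $\mu$-a.e. $\theta$ and all $t,x,y$ $$|a(t,x,\theta)-a(t,y,\theta)|\le\big(C^{\mathrm{Lip}}|x|^{p_1-1}+C^{\mathrm{Lip}}|y|^{p_1-1}+2g(\theta)\big)|x-y|,$$ $$|D_xa(t,x,\theta)-D_xa(t,y,\theta)|\le\big(C^{\mathrm{Lip}}_{\mathrm{der}}|x|^{p_1-2}+C^{\mathrm{Lip}}_{\mathrm{der}}|y|^{p_1-2}+2h(\theta)\big)|x-y|.$$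 Write $L^q=L^q([0,T],\mathbb R^k)$. Then there is a $\mu$-null set outside of which, for all $u,v\in L^q$, there are a unique absolutely continuous solution $x_u^\theta$ on $[0,T]$ of $\dot x=\sum_iu_i(t)F_i(x,\theta)$, $x(0)=x_0(\theta)$, and a unique absolutely continuous solution $y_{u,v}^\theta$ of $$\dot y=\Big(\sum_iu_i(t)\nabla_xF_i(x_u^\theta(t),\theta)\Big)y+\sum_iv_i(t)F_i(x_u^\theta(t),\theta),\qquad y(0)=0,$$ and $t\mapsto a(t,x_u^\theta(t),\theta)$ and $t\mapsto D_xa(t,x_u^\theta(t),\theta)\,y_{u,v}^\theta(t)$ are $\nu$-integrable. Moreover: (i) $X^u_t(\theta)=x_u^\theta(t)$ defines a Fréchet differentiable map $L^q\ni u\mapsto X^u\in C^0([0,T],L^{p_1}_\mu(\Theta,\mathbb R^n))$ with $(D_uX^u[v])_t(\theta)=y_{u,v}^\theta(t)$ for every $u,v,t$ and $\mu$-a.e. $\theta$. The Nemytskij operator $A(Z)_t(\theta)=a(t,Z_t(\theta),\theta)$ is a well-defined, Fréchet differentiable map from $C^0([0,T],L^{p_1}_\mu(\Theta,\mathbb R^n))$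 to $C^0([0,T],L^1_\mu(\Theta))$, with $(A'(Z)[\zeta])_t=D_xA(Z)_t[\zeta_t]$, where $D_xA$ maps $C^0([0,T],L^{p_1}_\mu(\Theta,\mathbb R^n))$ to $C^0\big([0,T],\mathcal L(L^{p_1}_\mu(\Theta,\mathbb R^n),L^1_\mu(\Theta))\big)$ and $D_xA(Z)_t[\xi](\theta)=D_xa(t,Z_t(\theta),\theta)\,\xi(\theta)$. (ii) The map $u\mapsto\mathcal J_u:=\int_{[0,T]}A(X^u)_t\,d\nu(t)\in L^1_\mu(\Theta)$ (Bochner integral) satisfies $\mathcal J_u(\theta)=\int_{[0,T]}a(t,x_u^\theta(t),\theta)\,d\nu(t)$ for $\mu$-a.e. $\theta$. It is continuously Fréchet differentiable on $L^q$, and for all $u,v\in L^q$ $$D_u\mathcal J_u[v]=\int_{[0,T]}\big(A'(X^u)[D_uX^u[v]]\big)_t\,d\nu(t),\qquad D_u\mathcal J_u[v](\theta)=\int_{[0,T]}D_xa(t,x_u^\theta(t),\theta)\,y_{u,v}^\theta(t)\,d\nu(t)\ \text{ for }\mu\text{-a.e. }\theta.$$ (iii) If $u_m\rightharpoonup u_\infty$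 weakly in $L^q$, then $D_u\mathcal J_{u_m}\to D_u\mathcal J_{u_\infty}$ in operator norm, i.e. $$\lim_{m\to\infty}\ \sup_{\|v\|_{L^q}\le1}\big\|D_u\mathcal J_{u_m}[v]-D_u\mathcal J_{u_\infty}[v]\big\|_{L^1_\mu}=0.$$ -/

import Mathlib

open Set Filter Topology MeasureTheory
open scoped ENNReal

noncomputable section

namespace EnsembleControl

/-- The space of controls `L^q([0,T], ℝ^k)`. -/
abbrev Control (k : ℕ) (q : ℝ≥0∞) (T : ℝ) : Type :=
  Lp (EuclideanSpace ℝ (Fin k)) q (volume.restrict (Icc (0 : ℝ) T))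

variable {Θ : Type*} {n k : ℕ}

/-- The controlled velocity `F(x,θ) w = ∑ i, w_i F_i(x,θ)`. -/
def velocity (F : Fin k → EuclideanSpace ℝ (Fin n) → Θ → EuclideanSpace ℝ (Fin n))
    (θ : Θ) (w : EuclideanSpace ℝ (Fin k)) (x : EuclideanSpace ℝ (Fin n)) :
    EuclideanSpace ℝ (Fin n) :=
  ∑ i, w i • F i x θ

/-- The right-hand side of the linearized system at the state `x`:
`(∑ i, w_i ∇ₓF_i(x,θ)) y + ∑ i, v_i F_i(x,θ)`. -/
def linVelocity (F : Fin k → EuclideanSpace ℝ (Fin n) → Θ → EuclideanSpace ℝ (Fin n))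
    (θ : Θ) (w v : EuclideanSpace ℝ (Fin k)) (x y : EuclideanSpace ℝ (Fin n)) :
    EuclideanSpace ℝ (Fin n) :=
  (∑ i, w i • fderiv ℝ (fun z => F i z θ) x y) + ∑ i, v i • F i x θ

/-- `z` solves, in the sense of Carathéodory, `ż(t) = g(t, z(t))` for a.e. `t ∈ [0,T]`, `z(0) = z₀`:
`z` is continuous on `[0,T]`, the right-hand side is integrable along `z`, and `z` is the primitive
of the right-hand side starting from `z₀` (equivalently, `z` is absolutely continuous and satisfies
the differential equation almost everywhere). -/
def IsCaratheodorySolution {E : Type*} [NormedAddCommGroup E] [NormedSpace ℝ E]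
    (T : ℝ) (g : ℝ → E → E) (z₀ : E) (z : ℝ → E) : Prop :=
  ContinuousOn z (Icc 0 T) ∧
    IntegrableOn (fun s => g s (z s)) (Icc 0 T) ∧
      ∀ t ∈ Icc (0 : ℝ) T, z t = z₀ + ∫ s in (0 : ℝ)..t, g s (z s)

/-- `x` is a trajectory on `[0,T]` of the system with parameter `θ` driven by the control `u`. -/
def IsTrajectory (F : Fin k → EuclideanSpace ℝ (Fin n) → Θ → EuclideanSpace ℝ (Fin n))
    (x₀ : Θ → EuclideanSpace ℝ (Fin n)) (T : ℝ) (u : ℝ → EuclideanSpace ℝ (Fin k)) (θ : Θ)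
    (x : ℝ → EuclideanSpace ℝ (Fin n)) : Prop :=
  IsCaratheodorySolution T (fun s z => velocity F θ (u s) z) (x₀ θ) x

open Classical in
/-- The trajectory `x_u^θ` (by convention `0` if there is none). -/
def trajectory (F : Fin k → EuclideanSpace ℝ (Fin n) → Θ → EuclideanSpace ℝ (Fin n))
    (x₀ : Θ → EuclideanSpace ℝ (Fin n)) (T : ℝ) (u : ℝ → EuclideanSpace ℝ (Fin k)) (θ : Θ) :
    ℝ → EuclideanSpace ℝ (Fin n) :=
  if h : ∃ x, IsTrajectory F x₀ T u θ x then h.choose else 0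

/-- `y` solves on `[0,T]` the system linearized along `x_u^θ`, in the direction `v`, with
`y(0) = 0`. -/
def IsLinTrajectory (F : Fin k → EuclideanSpace ℝ (Fin n) → Θ → EuclideanSpace ℝ (Fin n))
    (x₀ : Θ → EuclideanSpace ℝ (Fin n)) (T : ℝ) (u v : ℝ → EuclideanSpace ℝ (Fin k)) (θ : Θ)
    (y : ℝ → EuclideanSpace ℝ (Fin n)) : Prop :=
  IsCaratheodorySolution T
    (fun s z => linVelocity F θ (u s) (v s) (trajectory F x₀ T u θ s) z) 0 y

open Classical in
/-- The linearized trajectory `y_{u,v}^θ` (by convention `0` if there is none). -/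
def linTrajectory (F : Fin k → EuclideanSpace ℝ (Fin n) → Θ → EuclideanSpace ℝ (Fin n))
    (x₀ : Θ → EuclideanSpace ℝ (Fin n)) (T : ℝ) (u v : ℝ → EuclideanSpace ℝ (Fin k)) (θ : Θ) :
    ℝ → EuclideanSpace ℝ (Fin n) :=
  if h : ∃ y, IsLinTrajectory F x₀ T u v θ y then h.choose else 0

/-- The partial derivative `D_x a(t,x,θ)`. -/
def Dx {T : ℝ} (a : Icc (0 : ℝ) T → EuclideanSpace ℝ (Fin n) → Θ → ℝ)
    (t : Icc (0 : ℝ) T) (x : EuclideanSpace ℝ (Fin n)) (θ : Θ) :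
    EuclideanSpace ℝ (Fin n) →L[ℝ] ℝ :=
  fderiv ℝ (fun z => a t z θ) x

/-- The vector fields are jointly Borel measurable, uniformly globally Lipschitz in the state, and
uniformly bounded at the origin. -/
structure FieldsLipschitz [MeasurableSpace Θ] (μ : Measure Θ)
    (F : Fin k → EuclideanSpace ℝ (Fin n) → Θ → EuclideanSpace ℝ (Fin n)) : Prop where
  measurable : ∀ i, Measurable (fun p : EuclideanSpace ℝ (Fin n) × Θ => F i p.1 p.2)
  lipschitz : ∃ L > 0, ∀ᵐ θ ∂μ, ∀ i x₁ x₂, ‖F i x₁ θ - F i x₂ θ‖ ≤ L * ‖x₁ - x₂‖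
  bounded : ∃ C > 0, ∀ᵐ θ ∂μ, ∀ i, ‖F i 0 θ‖ ≤ C

/-- The vector fields are `C¹` in the state, with jointly Borel measurable and uniformly Lipschitz
gradients. -/
structure FieldsC1 [MeasurableSpace Θ] (μ : Measure Θ)
    (F : Fin k → EuclideanSpace ℝ (Fin n) → Θ → EuclideanSpace ℝ (Fin n)) : Prop where
  contDiff : ∀ᵐ θ ∂μ, ∀ i, ContDiff ℝ 1 (fun x => F i x θ)
  measurable : ∀ i, Measurable
    (fun p : EuclideanSpace ℝ (Fin n) × Θ => fderiv ℝ (fun z => F i z p.2) p.1)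
  lipschitz : ∃ L' > 0, ∀ᵐ θ ∂μ, ∀ i x₁ x₂,
    ‖fderiv ℝ (fun z => F i z θ) x₁ - fderiv ℝ (fun z => F i z θ) x₂‖ ≤ L' * ‖x₁ - x₂‖

/-- Admissible integrands `a(t,x,θ)` with growth exponent `p₁`. -/
structure AdmissibleIntegrand [MeasurableSpace Θ] (μ : Measure Θ) (T p₁ : ℝ)
    (a : Icc (0 : ℝ) T → EuclideanSpace ℝ (Fin n) → Θ → ℝ) : Prop where
  bddBelow : ∃ c : ℝ, ∀ᵐ θ ∂μ, ∀ t x, c ≤ a t x θ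
  continuous : ∀ᵐ θ ∂μ, Continuous (fun p : Icc (0 : ℝ) T × EuclideanSpace ℝ (Fin n) => a p.1 p.2 θ)
  measurable : ∀ t x, Measurable (fun θ => a t x θ)
  differentiable : ∀ᵐ θ ∂μ, ∀ t, Differentiable ℝ (fun x => a t x θ)
  continuous_Dx : ∀ᵐ θ ∂μ,
    Continuous (fun p : Icc (0 : ℝ) T × EuclideanSpace ℝ (Fin n) => Dx a p.1 p.2 θ)
  aemeasurable_Dx : ∀ t x, AEMeasurable (fun θ => Dx a t x θ) μ
  lipschitz : ∃ C > 0, ∃ g : Θ → ℝ, 0 ≤ᵐ[μ] g ∧ MemLp g (ENNReal.ofReal (p₁ / (p₁ - 1))) μ ∧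
    ∀ᵐ θ ∂μ, ∀ t x y, |a t x θ - a t y θ| ≤
      ((C * ‖x‖ ^ (p₁ - 1) + g θ) + (C * ‖y‖ ^ (p₁ - 1) + g θ)) * ‖x - y‖
  integrable_zero : MemLp (fun θ => ⨆ t, |a t 0 θ|) 1 μ
  lipschitz_Dx : ∃ C > 0, ∃ g : Θ → ℝ, 0 ≤ᵐ[μ] g ∧ MemLp g (ENNReal.ofReal (p₁ / (p₁ - 2))) μ ∧
    ∀ᵐ θ ∂μ, ∀ t x y, ‖Dx a t x θ - Dx a t y θ‖ ≤
      ((C * ‖x‖ ^ (p₁ - 2) + g θ) + (C * ‖y‖ ^ (p₁ - 2) + g θ)) * ‖x - y‖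
  integrable_Dx_zero :
    MemLp (fun θ => ⨆ t, ‖Dx a t 0 θ‖) (ENNReal.ofReal (p₁ / (p₁ - 1))) μ

end EnsembleControl

end

/-!
Everything rests on the ODE for a single parameter `θ`. For almost every `θ` the system has the
form `ẋ = f(x) u` with `f` bounded at the origin, Lipschitz, and with Lipschitz derivative
(`IsRegularField`), the constant `K` being the same for all `θ`. Grönwall's inequality with an
integrable coefficient then gives, on bounded sets of controls and uniformly in time, linear
bounds for trajectories and linearized trajectories in terms of `1 + |x₀(θ)|`, and
`|x_{u+v} - x_u - y_{u,v}| ≤ C (1 + |x₀(θ)|)² ‖v‖²`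
(`IsRegularField.norm_state_sub_state_sub_lin_le`). Since `x₀ ∈ L^{p₀}` and `2 p₁ ≤ p₀`, the
function `(1 + |x₀|)²` belongs to `L^{p₁}`; hence it dominates the remainder in `L^{p₁}`, and the
input-to-state map is differentiable (`IsRegularEnsemble.hasFDerivAt_inputState`). Trajectories
are measurable in `θ` as limits of Picard iterates, linearized ones as limits of difference
quotients.

The integrand `a` and its derivative are Carathéodory kernels that are locally Lipschitz with a
constant of growth `|x|^σ`, where `σ = p₁ - 1` and `σ = p₁ - 2` (`IsNemytskijKernel`). By Hölder's
inequality they define Nemytskij operators that are Lipschitz on bounded sets, from `L^{p₁}` to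
`L¹` and to `L^{p₁'}` respectively. The mean value inequality bounds the remainder of the
linearization of the former pointwise by `(C |w|^{p₁-2} + g) |ζ|²`, with `w = |Z| + |ζ|`, and
Hölder's inequality, applied twice, makes it quadratic in `L¹`
(`IsNemytskijKernel.hasFDerivAt_operator`). The cost is then differentiable by the chain rule, and
its pointwise description follows from `integral_curve_ae_eq`: a Bochner integral in `L¹` of a
continuous curve is computed parameter by parameter.

For the weak-to-norm continuity of the derivative, let `u_m ⇀ u` in `L^q`. Because `q > 1`, the
primitives `∫₀ᵗ A (u_m - u)` with `A` continuous are equi-Hölder, so their pointwise convergence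
to zero is uniform (`eventually_norm_integral_sub_le_of_weak`). With `A = f(x_u)` and Grönwall
this gives `x_{u_m} → x_u` uniformly in time. In the equation for `y_{u_m,v} - y_{u,v}` the only
term that is not visibly small is `∫₀ᵗ Df(x_u)(y_{u,v}) (u_m - u)`; integrating by parts moves the
primitive of `Df(x_u)(·)(u_m - u)` onto the derivative of `y_{u,v}`, which is bounded in `L¹`
uniformly for `v` in the unit ball (`norm_integral_clm_apply_primitive_le`). Dominated
convergence, tested at times and directions where the norms are nearly attained, lifts both facts
to the ensemble (`IsRegularEnsemble.tendsto_inputState_of_weak`,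
`IsRegularEnsemble.tendsto_inputStateDeriv_of_weak`), and continuity of the Nemytskij operator of
`D_x a` concludes. Norm continuity of the derivative is the special case of strongly convergent
controls.
-/

namespace EnsembleControl

/-! ### A Grönwall inequality with integrable coefficients -/

section

theorem _root_.LipschitzOnWith.comp_absolutelyContinuousOnInterval {X Y : Type*}
    [PseudoMetricSpace X] [PseudoMetricSpace Y] {K : NNReal} {g : X → Y} {f : ℝ → X} {a b : ℝ}
    (hg : LipschitzOnWith K g (f '' uIcc a b)) (hf : AbsolutelyContinuousOnInterval f a b) :
    AbsolutelyContinuousOnInterval (g ∘ f) a b := by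
  rw [absolutelyContinuousOnInterval_iff] at hf ⊢
  intro ε hε
  obtain ⟨δ, hδ, h⟩ := hf (ε / (K + 1)) (by positivity)
  refine ⟨δ, hδ, fun I hI hIδ => ?_⟩
  have h1 := h I hI hIδ
  calc ∑ i ∈ Finset.range I.1, dist ((g ∘ f) (I.2 i).1) ((g ∘ f) (I.2 i).2)
      ≤ ∑ i ∈ Finset.range I.1, K * dist (f (I.2 i).1) (f (I.2 i).2) := by
        refine Finset.sum_le_sum fun i hi => ?_
        have := hI.1 i hi
        exact hg.dist_le_mul _ (mem_image_of_mem f this.1) _ (mem_image_of_mem f this.2)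
    _ = K * ∑ i ∈ Finset.range I.1, dist (f (I.2 i).1) (f (I.2 i).2) := by
        rw [Finset.mul_sum]
    _ ≤ (K + 1) * ∑ i ∈ Finset.range I.1, dist (f (I.2 i).1) (f (I.2 i).2) := by
        gcongr
        simp
    _ < ε := by
        rw [lt_div_iff₀ (by positivity)] at h1
        linarith

theorem intervalIntegrable_of_integrableOn_Icc {E : Type*} [NormedAddCommGroup E]
    {T : ℝ} {f : ℝ → E} (hf : IntegrableOn f (Icc 0 T)) {s t : ℝ}
    (hs : s ∈ Icc 0 T) (ht : t ∈ Icc 0 T) : IntervalIntegrable f volume s t := by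
  refine IntegrableOn.intervalIntegrable (hf.mono_set ?_)
  exact uIcc_subset_Icc hs ht

/-- The fundamental theorem of calculus for the exponential of the primitive of an integrable
function. -/
theorem integral_mul_exp_primitive {T : ℝ} {β : ℝ → ℝ} (hβ : IntegrableOn β (Icc 0 T)) {t : ℝ}
    (ht : t ∈ Icc 0 T) :
    ∫ s in (0 : ℝ)..t, β s * Real.exp (∫ r in (0 : ℝ)..s, β r) =
      Real.exp (∫ r in (0 : ℝ)..t, β r) - 1 := by
  have h0 : (0 : ℝ) ∈ Icc 0 T := ⟨le_rfl, ht.1.trans ht.2⟩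
  have hi : IntervalIntegrable β volume 0 t := intervalIntegrable_of_integrableOn_Icc hβ h0 ht
  have hac : AbsolutelyContinuousOnInterval (fun s => ∫ r in (0 : ℝ)..s, β r) 0 t :=
    hi.absolutelyContinuousOnInterval_intervalIntegral (by simp)
  obtain ⟨C, hC⟩ := hac.exists_bound
  have hlip : ∃ K, LipschitzOnWith K Real.exp (Icc (-C) C) :=
    (Real.contDiff_exp.contDiffOn (n := 1)).exists_lipschitzOnWith (by decide) (convex_Icc _ _)
      isCompact_Icc
  obtain ⟨K, hK⟩ := hlip
  have hac' : AbsolutelyContinuousOnInterval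
      (Real.exp ∘ fun s => ∫ r in (0 : ℝ)..s, β r) 0 t := by
    refine LipschitzOnWith.comp_absolutelyContinuousOnInterval (hK.mono ?_) hac
    rintro _ ⟨s, hs, rfl⟩
    exact abs_le.1 (hC s hs)
  have := hac'.integral_deriv_eq_sub
  simp only [Function.comp_apply, intervalIntegral.integral_same, Real.exp_zero] at this
  rw [← this]
  apply intervalIntegral.integral_congr_ae
  filter_upwards [hi.ae_hasDerivAt_integral] with s hs hst
  have h := (hs (uIoc_subset_uIcc hst) 0 (by simp)).exp.deriv
  have h' : deriv (Real.exp ∘ fun s => ∫ r in (0 : ℝ)..s, β r) s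
      = Real.exp (∫ r in (0 : ℝ)..s, β r) * β s := h
  rw [h', mul_comm]

/-- The weight `exp (2 ∫₀ᵗ β)`. -/
noncomputable def weight (β : ℝ → ℝ) (t : ℝ) : ℝ := Real.exp (∫ s in (0 : ℝ)..t, 2 * β s)

theorem continuousOn_weight {T : ℝ} (hT : 0 ≤ T) {β : ℝ → ℝ} (hβ : IntegrableOn β (Icc 0 T)) :
    ContinuousOn (weight β) (Icc 0 T) := by
  refine Real.continuous_exp.comp_continuousOn ?_
  have h := intervalIntegral.continuousOn_primitive_interval (a := 0) (b := T)
    (f := fun s => 2 * β s) (μ := volume) (by rw [uIcc_of_le hT]; exact hβ.const_mul 2)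
  rwa [uIcc_of_le hT] at h

theorem weight_pos (β : ℝ → ℝ) (t : ℝ) : 0 < weight β t := Real.exp_pos _

theorem one_le_weight {T : ℝ} {β : ℝ → ℝ} (hβ0 : ∀ s ∈ Icc 0 T, 0 ≤ β s) {t : ℝ}
    (ht : t ∈ Icc 0 T) : 1 ≤ weight β t := by
  refine Real.one_le_exp (intervalIntegral.integral_nonneg ht.1 fun s hs => ?_)
  have := hβ0 s ⟨hs.1, hs.2.trans ht.2⟩
  positivity

theorem weight_le {T b : ℝ} {β : ℝ → ℝ} (hβ : IntegrableOn β (Icc 0 T))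
    (hβ0 : ∀ s ∈ Icc 0 T, 0 ≤ β s) (hb : ∫ s in (0 : ℝ)..T, β s ≤ b) {t : ℝ}
    (ht : t ∈ Icc 0 T) : weight β t ≤ Real.exp (2 * b) := by
  have hT : 0 ≤ T := ht.1.trans ht.2
  refine Real.exp_le_exp.2 ?_
  rw [intervalIntegral.integral_const_mul]
  refine mul_le_mul_of_nonneg_left (le_trans ?_ hb) zero_le_two
  refine intervalIntegral.integral_mono_interval le_rfl ht.1 ht.2 ?_
    (intervalIntegrable_of_integrableOn_Icc hβ ⟨le_rfl, hT⟩ ⟨hT, le_rfl⟩)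
  filter_upwards [ae_restrict_mem measurableSet_Ioc] with s hs
  exact hβ0 s ⟨hs.1.le, hs.2⟩

theorem integrableOn_mul_weight {T : ℝ} (hT : 0 ≤ T) {β : ℝ → ℝ}
    (hβ : IntegrableOn β (Icc 0 T)) : IntegrableOn (fun s => β s * weight β s) (Icc 0 T) :=
  hβ.mul_continuousOn (continuousOn_weight hT hβ) isCompact_Icc

theorem integral_mul_weight {T : ℝ} {β : ℝ → ℝ} (hβ : IntegrableOn β (Icc 0 T)) {t : ℝ}
    (ht : t ∈ Icc 0 T) :
    ∫ s in (0 : ℝ)..t, β s * weight β s = (weight β t - 1) / 2 := by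
  have h := integral_mul_exp_primitive (hβ.const_mul 2) ht
  simp only [weight]
  rw [← h, eq_div_iff two_ne_zero, ← intervalIntegral.integral_mul_const]
  congr 1
  ext s
  ring

/-- The integral operator with kernel `β` contracts the supremum norm weighted by `1 / weight β` by
a factor `1 / 2`. -/
theorem integral_mul_le_weight {T M : ℝ} {β φ : ℝ → ℝ} (hβ : IntegrableOn β (Icc 0 T))
    (hβ0 : ∀ s ∈ Icc 0 T, 0 ≤ β s) (hφ : ∀ s ∈ Icc 0 T, φ s ≤ M * weight β s)
    (hφ0 : ∀ s ∈ Icc 0 T, 0 ≤ φ s) {t : ℝ} (ht : t ∈ Icc 0 T) :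
    ∫ s in (0 : ℝ)..t, β s * φ s ≤ M * (weight β t - 1) / 2 := by
  have hT : 0 ≤ T := ht.1.trans ht.2
  have h0 : (0 : ℝ) ∈ Icc 0 T := ⟨le_rfl, hT⟩
  have hsub : ∀ s ∈ Ioc 0 t, s ∈ Icc 0 T := fun s hs => ⟨hs.1.le, hs.2.trans ht.2⟩
  rw [mul_div_assoc, ← integral_mul_weight hβ ht, ← intervalIntegral.integral_const_mul,
    intervalIntegral.integral_of_le ht.1, intervalIntegral.integral_of_le ht.1]
  refine integral_mono_of_nonneg ?_ ?_ ?_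
  · filter_upwards [ae_restrict_mem measurableSet_Ioc] with s hs
    exact mul_nonneg (hβ0 s (hsub s hs)) (hφ0 s (hsub s hs))
  · exact ((integrableOn_mul_weight hT hβ).mono_set (fun s hs => hsub s hs)).const_mul M
  · filter_upwards [ae_restrict_mem measurableSet_Ioc] with s hs
    have h1 := mul_le_mul_of_nonneg_left (hφ s (hsub s hs)) (hβ0 s (hsub s hs))
    calc β s * φ s ≤ β s * (M * weight β s) := h1
      _ = M * (β s * weight β s) := by ring

/-- Grönwall's inequality for an integrable coefficient `β`. -/
theorem gronwall_of_integrable {T α b : ℝ} {β φ : ℝ → ℝ} (hβ : IntegrableOn β (Icc 0 T))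
    (hβ0 : ∀ s ∈ Icc 0 T, 0 ≤ β s) (hb : ∫ s in (0 : ℝ)..T, β s ≤ b)
    (hφc : ContinuousOn φ (Icc 0 T)) (hφ0 : ∀ s ∈ Icc 0 T, 0 ≤ φ s)
    (h : ∀ t ∈ Icc 0 T, φ t ≤ α + ∫ s in (0 : ℝ)..t, β s * φ s) {t : ℝ} (ht : t ∈ Icc 0 T) :
    φ t ≤ 2 * α * Real.exp (2 * b) := by
  have hT : 0 ≤ T := ht.1.trans ht.2
  have h0 : (0 : ℝ) ∈ Icc 0 T := ⟨le_rfl, hT⟩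
  -- compare with the maximum of `φ / weight β`
  obtain ⟨t₀, ht₀, hmax⟩ := isCompact_Icc.exists_isMaxOn ⟨0, h0⟩
    (hφc.div (continuousOn_weight hT hβ) fun s _ => (weight_pos β s).ne')
  set M := φ t₀ / weight β t₀ with hM_def
  have hM0 : 0 ≤ M := div_nonneg (hφ0 _ ht₀) (weight_pos β t₀).le
  have hle : ∀ s ∈ Icc 0 T, φ s ≤ M * weight β s := fun s hs => by
    have h1 : φ s / weight β s ≤ M := hmax hs
    exact (div_le_iff₀ (weight_pos β s)).1 h1
  have h1 := h t₀ ht₀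
  have h2 := integral_mul_le_weight hβ hβ0 hle hφ0 ht₀
  have h3 : φ t₀ = M * weight β t₀ := by rw [hM_def, div_mul_cancel₀ _ (weight_pos β t₀).ne']
  have hα : 0 ≤ α := by
    have := h 0 h0
    simp only [intervalIntegral.integral_same, add_zero] at this
    exact (hφ0 0 h0).trans this
  have h4 : M ≤ 2 * α := by
    have := one_le_weight hβ0 ht₀
    nlinarith
  calc φ t ≤ M * weight β t := hle t ht
    _ ≤ 2 * α * Real.exp (2 * b) :=
      mul_le_mul h4 (weight_le hβ hβ0 hb ht) (weight_pos β t).le (by positivity)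

theorem integral_le_integral_right {T t : ℝ} {γ : ℝ → ℝ} (hγ : IntegrableOn γ (Icc 0 T))
    (hγ0 : ∀ s ∈ Icc 0 T, 0 ≤ γ s) (ht : t ∈ Icc 0 T) :
    ∫ s in (0 : ℝ)..t, γ s ≤ ∫ s in (0 : ℝ)..T, γ s := by
  have hT : 0 ≤ T := ht.1.trans ht.2
  refine intervalIntegral.integral_mono_interval le_rfl ht.1 ht.2 ?_
    (intervalIntegrable_of_integrableOn_Icc hγ ⟨le_rfl, hT⟩ ⟨hT, le_rfl⟩)
  filter_upwards [ae_restrict_mem measurableSet_Ioc] with s hs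
  exact hγ0 s ⟨hs.1.le, hs.2⟩

/-- Grönwall's inequality for a function that is, up to an error `α`, the primitive of a function
of at most linear growth. -/
theorem norm_le_of_norm_sub_integral_le {E : Type*} [NormedAddCommGroup E] [NormedSpace ℝ E]
    {T α b c : ℝ} {β γ : ℝ → ℝ} {z h : ℝ → E}
    (hβ : IntegrableOn β (Icc 0 T)) (hβ0 : ∀ s ∈ Icc 0 T, 0 ≤ β s)
    (hb : ∫ s in (0 : ℝ)..T, β s ≤ b)
    (hγ : IntegrableOn γ (Icc 0 T)) (hγ0 : ∀ s ∈ Icc 0 T, 0 ≤ γ s)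
    (hc : ∫ s in (0 : ℝ)..T, γ s ≤ c)
    (hz : ContinuousOn z (Icc 0 T)) (hh : ∀ s ∈ Icc 0 T, ‖h s‖ ≤ β s * ‖z s‖ + γ s)
    (hzh : ∀ t ∈ Icc 0 T, ‖z t - ∫ s in (0 : ℝ)..t, h s‖ ≤ α) {t : ℝ} (ht : t ∈ Icc 0 T) :
    ‖z t‖ ≤ 2 * (α + c) * Real.exp (2 * b) := by
  refine gronwall_of_integrable (φ := fun s => ‖z s‖) hβ hβ0 hb hz.norm
    (fun s _ => norm_nonneg _) (fun t ht => ?_) ht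
  have hT : 0 ≤ T := ht.1.trans ht.2
  have h0 : (0 : ℝ) ∈ Icc 0 T := ⟨le_rfl, hT⟩
  have hβz : IntegrableOn (fun s => β s * ‖z s‖) (Icc 0 T) :=
    hβ.mul_continuousOn hz.norm isCompact_Icc
  have h1 : ‖∫ s in (0 : ℝ)..t, h s‖ ≤ ∫ s in (0 : ℝ)..t, (β s * ‖z s‖ + γ s) := by
    refine intervalIntegral.norm_integral_le_of_norm_le ht.1 ?_
      (intervalIntegrable_of_integrableOn_Icc (hβz.add hγ) h0 ht)
    exact Eventually.of_forall fun s hs => hh s ⟨hs.1.le, hs.2.trans ht.2⟩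
  rw [intervalIntegral.integral_add (intervalIntegrable_of_integrableOn_Icc hβz h0 ht)
    (intervalIntegrable_of_integrableOn_Icc hγ h0 ht)] at h1
  have h2 := integral_le_integral_right hγ hγ0 ht
  have h3 := hzh t ht
  have h4 : ‖z t‖ ≤ ‖z t - ∫ s in (0 : ℝ)..t, h s‖ + ‖∫ s in (0 : ℝ)..t, h s‖ := by
    simpa using norm_add_le (z t - ∫ s in (0 : ℝ)..t, h s) (∫ s in (0 : ℝ)..t, h s)
  linarith

/-! ### Carathéodory solutions of Lipschitz equations -/

variable {E : Type*} [NormedAddCommGroup E] [NormedSpace ℝ E]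

/-- A right-hand side `g` that is Lipschitz in the state, with a time-dependent integrable constant
`β`, and is integrable along every continuous curve. -/
structure IsLipschitzRHS (T : ℝ) (g : ℝ → E → E) (β : ℝ → ℝ) : Prop where
  integrableOn_const : IntegrableOn β (Icc 0 T)
  nonneg : ∀ s ∈ Icc 0 T, 0 ≤ β s
  integrableOn : ∀ z, ContinuousOn z (Icc 0 T) → IntegrableOn (fun s => g s (z s)) (Icc 0 T)
  norm_sub_le : ∀ s ∈ Icc 0 T, ∀ x y, ‖g s x - g s y‖ ≤ β s * ‖x - y‖

theorem continuousOn_primitive_Icc {T : ℝ} {f : ℝ → E} (hf : IntegrableOn f (Icc 0 T)) :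
    ContinuousOn (fun t => ∫ s in (0 : ℝ)..t, f s) (Icc 0 T) := by
  rcases le_or_gt 0 T with hT | hT
  · have h := intervalIntegral.continuousOn_primitive_interval (a := 0) (b := T)
      (f := f) (μ := volume) (by rwa [uIcc_of_le hT])
    rwa [uIcc_of_le hT] at h
  · simp [Icc_eq_empty hT.not_ge]

/-- The Picard operator on continuous curves. -/
noncomputable def picard {T : ℝ} (hT : 0 ≤ T) {g : ℝ → E → E} {β : ℝ → ℝ}
    (hg : IsLipschitzRHS T g β) (z₀ : E) (z : C(Icc (0 : ℝ) T, E)) : C(Icc (0 : ℝ) T, E) where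
  toFun t := z₀ + ∫ s in (0 : ℝ)..t, g s (IccExtend hT z s)
  continuous_toFun := by
    have h : ContinuousOn (fun t => z₀ + ∫ s in (0 : ℝ)..t, g s (IccExtend hT z s)) (Icc 0 T) :=
      continuousOn_const.add
        (continuousOn_primitive_Icc (hg.integrableOn _ z.continuous.Icc_extend'.continuousOn))
    exact continuousOn_iff_continuous_domRestrict.1 h

theorem norm_picard_sub_le {T M : ℝ} (hT : 0 ≤ T) {g : ℝ → E → E} {β : ℝ → ℝ}
    (hg : IsLipschitzRHS T g β) (z₀ : E) {z w : C(Icc (0 : ℝ) T, E)}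
    (h : ∀ t, ‖z t - w t‖ ≤ M * weight β t) (t : Icc (0 : ℝ) T) :
    ‖picard hT hg z₀ z t - picard hT hg z₀ w t‖ ≤ M / 2 * weight β t := by
  have h0 : (0 : ℝ) ∈ Icc 0 T := ⟨le_rfl, hT⟩
  have hz := hg.integrableOn _ (z.continuous.Icc_extend' (h := hT)).continuousOn
  have hw := hg.integrableOn _ (w.continuous.Icc_extend' (h := hT)).continuousOn
  have hc : ContinuousOn (fun s => ‖IccExtend hT z s - IccExtend hT w s‖) (Icc 0 T) :=
    (z.continuous.Icc_extend'.sub w.continuous.Icc_extend').norm.continuousOn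
  have hpic : ∀ z : C(Icc (0 : ℝ) T, E), picard hT hg z₀ z t =
      z₀ + ∫ s in (0 : ℝ)..t, g s (IccExtend hT z s) := fun _ => rfl
  rw [hpic, hpic, add_sub_add_left_eq_sub,
    ← intervalIntegral.integral_sub (intervalIntegrable_of_integrableOn_Icc hz h0 t.2)
    (intervalIntegrable_of_integrableOn_Icc hw h0 t.2)]
  have h1 : ‖∫ s in (0 : ℝ)..t, (g s (IccExtend hT z s) - g s (IccExtend hT w s))‖ ≤
      ∫ s in (0 : ℝ)..t, β s * ‖IccExtend hT z s - IccExtend hT w s‖ := by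
    refine intervalIntegral.norm_integral_le_of_norm_le t.2.1 ?_
      (intervalIntegrable_of_integrableOn_Icc
        (hg.integrableOn_const.mul_continuousOn hc isCompact_Icc) h0 t.2)
    exact Eventually.of_forall fun s hs => hg.norm_sub_le s ⟨hs.1.le, hs.2.trans t.2.2⟩ _ _
  have h2 := integral_mul_le_weight (φ := fun s => ‖IccExtend hT z s - IccExtend hT w s‖)
    hg.integrableOn_const hg.nonneg
    (fun s hs => by simpa [IccExtend_of_mem hT _ hs] using h ⟨s, hs⟩)
    (fun s _ => norm_nonneg _) t.2
  have hM : 0 ≤ M := nonneg_of_mul_nonneg_left ((norm_nonneg _).trans (h t)) (weight_pos β t)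
  linarith

/-- Global existence for Carathéodory equations with Lipschitz right-hand side: an iterate of the
Picard operator is a contraction. -/
theorem IsLipschitzRHS.exists_solution [CompleteSpace E] {T : ℝ} (hT : 0 ≤ T) {g : ℝ → E → E}
    {β : ℝ → ℝ} (hg : IsLipschitzRHS T g β) (z₀ : E) : ∃ z, IsCaratheodorySolution T g z₀ z := by
  have h0 : (0 : ℝ) ∈ Icc 0 T := ⟨le_rfl, hT⟩
  have : Nonempty (Icc (0 : ℝ) T) := ⟨⟨0, h0⟩⟩
  set Λ := Real.exp (2 * ∫ s in (0 : ℝ)..T, β s) with hΛ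
  have hit : ∀ (m : ℕ) (z w : C(Icc (0 : ℝ) T, E)) (t : Icc (0 : ℝ) T),
      ‖(picard hT hg z₀)^[m] z t - (picard hT hg z₀)^[m] w t‖ ≤
        (dist z w * (1 / 2) ^ m) * weight β t := by
    intro m z w
    induction m with
    | zero =>
      intro t
      have h1 := one_le_weight hg.nonneg t.2
      have h2 : ‖z t - w t‖ ≤ dist z w := by
        rw [← dist_eq_norm]
        exact ContinuousMap.dist_apply_le_dist t
      simp only [Function.iterate_zero, id_eq, pow_zero, mul_one]
      nlinarith [dist_nonneg (x := z) (y := w)]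
    | succ m ih =>
      intro t
      rw [Function.iterate_succ_apply', Function.iterate_succ_apply']
      have := norm_picard_sub_le hT hg z₀ ih t
      refine this.trans (le_of_eq ?_)
      ring
  obtain ⟨m, hm⟩ := exists_pow_lt_of_lt_one (show (0 : ℝ) < 1 / (2 * Λ) by positivity)
    (show (1 / 2 : ℝ) < 1 by norm_num)
  have hcontr : ContractingWith (1 / 2) (picard hT hg z₀)^[m] := by
    refine ⟨by norm_num, LipschitzWith.of_dist_le_mul fun z w => ?_⟩
    rw [ContinuousMap.dist_le (by positivity)]
    intro t
    rw [dist_eq_norm]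
    refine (hit m z w t).trans ?_
    have h1 := weight_le hg.integrableOn_const hg.nonneg le_rfl t.2
    calc dist z w * (1 / 2) ^ m * weight β t ≤ dist z w * (1 / (2 * Λ)) * Λ := by
          have := (weight_pos β t).le
          gcongr
      _ = dist z w * (1 / 2) := by
          have : Λ ≠ 0 := (Real.exp_pos _).ne'
          field_simp
      _ = ((1 / 2 : NNReal) : ℝ) * dist z w := by push_cast; ring
  set z := hcontr.fixedPoint with hz
  have hfix : picard hT hg z₀ z = z := hcontr.isFixedPt_fixedPoint_iterate
  refine ⟨IccExtend hT z, z.continuous.Icc_extend'.continuousOn,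
    hg.integrableOn _ z.continuous.Icc_extend'.continuousOn, fun t ht => ?_⟩
  rw [IccExtend_of_mem hT _ ht]
  conv_lhs => rw [← hfix]
  rfl

theorem IsLipschitzRHS.eqOn_of_solution {T : ℝ} {g : ℝ → E → E} {β : ℝ → ℝ}
    (hg : IsLipschitzRHS T g β) {z₀ : E} {z w : ℝ → E} (hz : IsCaratheodorySolution T g z₀ z)
    (hw : IsCaratheodorySolution T g z₀ w) : EqOn z w (Icc 0 T) := by
  intro t ht
  have h0 : (0 : ℝ) ∈ Icc 0 T := ⟨le_rfl, ht.1.trans ht.2⟩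
  have := norm_le_of_norm_sub_integral_le (α := 0) (c := 0) (γ := 0) (z := fun s => z s - w s)
    (h := fun s => g s (z s) - g s (w s)) hg.integrableOn_const hg.nonneg le_rfl
    integrableOn_zero (fun _ _ => le_rfl) (by simp) (hz.1.sub hw.1)
    (fun s hs => by simpa using hg.norm_sub_le s hs _ _) (fun s hs => ?_) ht
  · simpa [sub_eq_zero] using this
  · rw [hz.2.2 s hs, hw.2.2 s hs, intervalIntegral.integral_sub
      (intervalIntegrable_of_integrableOn_Icc hz.2.1 h0 hs)
      (intervalIntegrable_of_integrableOn_Icc hw.2.1 h0 hs)]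
    simp

end

/-! ### Integrals of operator-valued curves -/

section

section Operator

variable {V V' : Type*} [NormedAddCommGroup V] [NormedSpace ℝ V] [NormedAddCommGroup V']
  [NormedSpace ℝ V']

theorem integrableOn_clm_apply {T : ℝ} {A : ℝ → V →L[ℝ] V'} {u : ℝ → V}
    (hA : ContinuousOn A (Icc 0 T)) (hu : IntegrableOn u (Icc 0 T)) :
    IntegrableOn (fun s => A s (u s)) (Icc 0 T) := by
  obtain ⟨C, hC⟩ := isCompact_Icc.exists_bound_of_continuousOn hA
  refine (ContinuousLinearMap.id ℝ (V →L[ℝ] V')).integrable_of_bilin_of_bdd_left C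
    (hA.aestronglyMeasurable measurableSet_Icc) ?_ hu
  filter_upwards [ae_restrict_mem measurableSet_Icc] with s hs using hC s hs

/-- Integration by parts in integrated form (Fubini on a triangle): with `M = ∫₀ p` and
`y = ∫₀ h`, the integral `∫₀ᵗ p y` equals `∫₀ᵗ (M t - M r) (h r) dr`, hence it is small as soon as
`M` is uniformly small. -/
theorem norm_integral_clm_apply_primitive_le [CompleteSpace V'] [CompleteSpace V]
    {T ε c : ℝ} {p : ℝ → V →L[ℝ] V'} {h : ℝ → V} (hp : IntegrableOn p (Icc 0 T))
    (hh : IntegrableOn h (Icc 0 T)) (hc : ∫ s in (0 : ℝ)..T, ‖h s‖ ≤ c)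
    (hε : ∀ t ∈ Icc 0 T, ‖∫ s in (0 : ℝ)..t, p s‖ ≤ ε) {t : ℝ} (ht : t ∈ Icc 0 T) :
    ‖∫ s in (0 : ℝ)..t, p s (∫ r in (0 : ℝ)..s, h r)‖ ≤ 2 * ε * c := by
  have hT : 0 ≤ T := ht.1.trans ht.2
  have h0 : (0 : ℝ) ∈ Icc 0 T := ⟨le_rfl, hT⟩
  have hsub : Ioc 0 t ⊆ Icc 0 T := fun s hs => ⟨hs.1.le, hs.2.trans ht.2⟩
  have hε0 : 0 ≤ ε := (norm_nonneg _).trans (hε 0 h0)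
  have hpt : IntegrableOn p (Ioc 0 t) := hp.mono_set hsub
  have hht : IntegrableOn h (Ioc 0 t) := hh.mono_set hsub
  set m := volume.restrict (Ioc (0 : ℝ) t) with hm
  have hset : MeasurableSet {z : ℝ × ℝ | z.2 ≤ z.1} :=
    measurableSet_le measurable_snd measurable_fst
  have hprod : Integrable (fun z : ℝ × ℝ => p z.1 (h z.2)) (m.prod m) :=
    Integrable.op_fst_snd (op := fun A x => A x)
      (by fun_prop) ⟨1, fun A x => by simpa using A.le_opNorm x⟩ hpt hht
  have hprod' : Integrable
      (fun z : ℝ × ℝ => {z : ℝ × ℝ | z.2 ≤ z.1}.indicator (fun z => p z.1 (h z.2)) z)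
      (m.prod m) := hprod.indicator hset
  have e1 : ∫ s in (0 : ℝ)..t, p s (∫ r in (0 : ℝ)..s, h r) =
      ∫ s, ∫ r, {z : ℝ × ℝ | z.2 ≤ z.1}.indicator (fun z => p z.1 (h z.2)) (s, r) ∂m ∂m := by
    rw [intervalIntegral.integral_of_le ht.1]
    refine setIntegral_congr_fun measurableSet_Ioc fun s hs => ?_
    have hs' : IntegrableOn h (Ioc 0 s) := hht.mono_set (Ioc_subset_Ioc_right hs.2)
    rw [intervalIntegral.integral_of_le hs.1.le, ← ContinuousLinearMap.integral_comp_comm _ hs']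
    have : (fun r => {z : ℝ × ℝ | z.2 ≤ z.1}.indicator (fun z => p z.1 (h z.2)) (s, r)) =
        (Iic s).indicator (fun r => p s (h r)) := by
      ext r
      simp [indicator]
    rw [this, integral_indicator measurableSet_Iic, hm, Measure.restrict_restrict measurableSet_Iic]
    congr 2
    ext r
    simp only [mem_Ioc, mem_inter_iff, mem_Iic]
    constructor
    · exact fun hr => ⟨hr.2, hr.1, hr.2.trans hs.2⟩
    · exact fun hr => ⟨hr.2.1, hr.1⟩
  rw [e1, integral_integral_swap hprod']
  have e2 : ∀ r ∈ Ioc 0 t,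
      ‖∫ s, {z : ℝ × ℝ | z.2 ≤ z.1}.indicator (fun z => p z.1 (h z.2)) (s, r) ∂m‖ ≤
        2 * ε * ‖h r‖ := by
    intro r hr
    have hrT : r ∈ Icc 0 T := hsub hr
    have : (fun s => {z : ℝ × ℝ | z.2 ≤ z.1}.indicator (fun z => p z.1 (h z.2)) (s, r)) =
        (Ici r).indicator (fun s => p s (h r)) := by
      ext s
      simp [indicator]
    rw [this, integral_indicator measurableSet_Ici, hm, Measure.restrict_restrict measurableSet_Ici]
    have hI : Ici r ∩ Ioc 0 t = Icc r t := by
      ext s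
      simp only [mem_inter_iff, mem_Ici, mem_Ioc, mem_Icc]
      constructor
      · exact fun hs => ⟨hs.1, hs.2.2⟩
      · exact fun hs => ⟨hs.1, hr.1.trans_le hs.1, hs.2⟩
    rw [hI, integral_Icc_eq_integral_Ioc, ← ContinuousLinearMap.integral_apply
      (hpt.mono_set (Ioc_subset_Ioc_left hr.1.le)), ← intervalIntegral.integral_of_le hr.2,
      ← intervalIntegral.integral_interval_sub_left
      (intervalIntegrable_of_integrableOn_Icc hp h0 ht)
      (intervalIntegrable_of_integrableOn_Icc hp h0 hrT)]
    refine (ContinuousLinearMap.le_opNorm _ _).trans ?_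
    refine mul_le_mul_of_nonneg_right ?_ (norm_nonneg _)
    refine (norm_sub_le _ _).trans ?_
    linarith [hε t ht, hε r hrT]
  calc ‖∫ r, ∫ s, {z : ℝ × ℝ | z.2 ≤ z.1}.indicator (fun z => p z.1 (h z.2)) (s, r) ∂m ∂m‖
      ≤ ∫ r, 2 * ε * ‖h r‖ ∂m := by
        refine norm_integral_le_of_norm_le (hht.norm.const_mul _) ?_
        filter_upwards [ae_restrict_mem measurableSet_Ioc] with r hr using e2 r hr
    _ = 2 * ε * ∫ s in (0 : ℝ)..t, ‖h s‖ := by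
        rw [integral_const_mul, intervalIntegral.integral_of_le ht.1]
    _ ≤ 2 * ε * c := by
        refine mul_le_mul_of_nonneg_left (le_trans ?_ hc) (by positivity)
        exact integral_le_integral_right hh.norm (fun _ _ => norm_nonneg _) ht

end Operator

/-! ### Trajectories of a regular control-linear field -/

variable {E W : Type*} [NormedAddCommGroup E] [NormedSpace ℝ E] [NormedAddCommGroup W]
  [NormedSpace ℝ W]

/-- A control-linear field `x ↦ (w ↦ f x w)` that is bounded at the origin, Lipschitz, and
differentiable with Lipschitz derivative, all with the same constant `K`. -/
structure IsRegularField (f : E → W →L[ℝ] E) (K : ℝ) : Prop where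
  nonneg : 0 ≤ K
  norm_zero_le : ‖f 0‖ ≤ K
  norm_sub_le : ∀ x y, ‖f x - f y‖ ≤ K * ‖x - y‖
  differentiable : Differentiable ℝ f
  norm_fderiv_sub_le : ∀ x y, ‖fderiv ℝ f x - fderiv ℝ f y‖ ≤ K * ‖x - y‖

/-- `x` solves `ẋ = f(x) u`, `x(0) = x₀`. -/
abbrev IsStateSolution (f : E → W →L[ℝ] E) (T : ℝ) (u : ℝ → W) (x₀ : E) (x : ℝ → E) : Prop :=
  IsCaratheodorySolution T (fun s z => f z (u s)) x₀ x

/-- `y` solves the equation `ẏ = (Df(x) y) u + f(x) v`, `y(0) = 0`, linearized along `x`. -/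
abbrev IsLinSolution (f : E → W →L[ℝ] E) (T : ℝ) (u v : ℝ → W) (x y : ℝ → E) : Prop :=
  IsCaratheodorySolution T (fun s z => fderiv ℝ f (x s) z (u s) + f (x s) (v s)) 0 y

/-- The Grönwall factor for controls of `L¹` norm at most `R`. -/
noncomputable def growth (K R : ℝ) : ℝ := 2 * Real.exp (2 * (K * R))

theorem growth_pos (K R : ℝ) : 0 < growth K R := by
  unfold growth
  positivity

namespace IsRegularField

variable {f : E → W →L[ℝ] E} {K T R : ℝ} {u v : ℝ → W} {x₀ : E} {x y : ℝ → E}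

theorem norm_le (hf : IsRegularField f K) (x : E) : ‖f x‖ ≤ K * (1 + ‖x‖) := by
  have h := hf.norm_sub_le x 0
  have h' : ‖f x‖ ≤ ‖f x - f 0‖ + ‖f 0‖ := by simpa using norm_add_le (f x - f 0) (f 0)
  have := hf.norm_zero_le
  rw [sub_zero] at h
  linarith

theorem continuous (hf : IsRegularField f K) : Continuous f := hf.differentiable.continuous

theorem norm_fderiv_le (hf : IsRegularField f K) (x : E) : ‖fderiv ℝ f x‖ ≤ K := by
  have : LipschitzWith ⟨K, hf.nonneg⟩ f := LipschitzWith.of_dist_le_mul fun x y => by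
    rw [dist_eq_norm, dist_eq_norm]
    exact hf.norm_sub_le x y
  exact norm_fderiv_le_of_lipschitz ℝ this

theorem continuous_fderiv (hf : IsRegularField f K) : Continuous (fderiv ℝ f) := by
  have : LipschitzWith ⟨K, hf.nonneg⟩ (fderiv ℝ f) := LipschitzWith.of_dist_le_mul fun x y => by
    rw [dist_eq_norm, dist_eq_norm]
    exact hf.norm_fderiv_sub_le x y
  exact this.continuous

theorem norm_taylor_le (hf : IsRegularField f K) (x z : E) :
    ‖f z - f x - fderiv ℝ f x (z - x)‖ ≤ K * ‖z - x‖ ^ 2 := by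
  have h := (convex_segment x z).norm_image_sub_le_of_norm_hasFDerivWithin_le' (f := f)
    (f' := fderiv ℝ f) (φ := fderiv ℝ f x) (C := K * ‖z - x‖)
    (fun w _ => (hf.differentiable w).hasFDerivAt.hasFDerivWithinAt) (fun w hw => ?_)
    (left_mem_segment ℝ x z) (right_mem_segment ℝ x z)
  · rw [pow_two, ← mul_assoc]
    exact h
  · refine (hf.norm_fderiv_sub_le w x).trans (mul_le_mul_of_nonneg_left ?_ hf.nonneg)
    have := norm_sub_le_of_mem_segment hw
    exact this

theorem isLipschitzRHS_state (hf : IsRegularField f K) (hu : IntegrableOn u (Icc 0 T)) :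
    IsLipschitzRHS T (fun s z => f z (u s)) (fun s => K * ‖u s‖) where
  integrableOn_const := hu.norm.const_mul K
  nonneg _ _ := mul_nonneg hf.nonneg (norm_nonneg _)
  integrableOn _ hz := integrableOn_clm_apply (hf.continuous.comp_continuousOn hz) hu
  norm_sub_le s _ a b := by
    rw [← sub_apply]
    refine (ContinuousLinearMap.le_opNorm _ _).trans ?_
    have := mul_le_mul_of_nonneg_right (hf.norm_sub_le a b) (norm_nonneg (u s))
    linarith

theorem isLipschitzRHS_lin (hf : IsRegularField f K) (hu : IntegrableOn u (Icc 0 T))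
    (hv : IntegrableOn v (Icc 0 T)) (hx : ContinuousOn x (Icc 0 T)) :
    IsLipschitzRHS T (fun s z => fderiv ℝ f (x s) z (u s) + f (x s) (v s))
      (fun s => K * ‖u s‖) where
  integrableOn_const := hu.norm.const_mul K
  nonneg _ _ := mul_nonneg hf.nonneg (norm_nonneg _)
  integrableOn _ hz :=
    (integrableOn_clm_apply ((hf.continuous_fderiv.comp_continuousOn hx).clm_apply hz) hu).add
      (integrableOn_clm_apply (hf.continuous.comp_continuousOn hx) hv)
  norm_sub_le s _ a b := by
    rw [add_sub_add_right_eq_sub, ← sub_apply, ← map_sub]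
    refine (ContinuousLinearMap.le_opNorm _ _).trans ?_
    have := mul_le_mul_of_nonneg_right ((fderiv ℝ f (x s)).le_of_opNorm_le
      (hf.norm_fderiv_le (x s)) (a - b)) (norm_nonneg (u s))
    linarith

theorem norm_state_le (hf : IsRegularField f K) (hu : IntegrableOn u (Icc 0 T))
    (hR : ∫ s in (0 : ℝ)..T, ‖u s‖ ≤ R) (hx : IsStateSolution f T u x₀ x) {t : ℝ}
    (ht : t ∈ Icc 0 T) : 1 + ‖x t‖ ≤ (1 + ‖x₀‖) * growth K R := by
  have hT : 0 ≤ T := ht.1.trans ht.2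
  have h0 : (0 : ℝ) ∈ Icc 0 T := ⟨le_rfl, hT⟩
  have hc : ContinuousOn (fun s => 1 + ‖x s‖) (Icc 0 T) := continuousOn_const.add hx.1.norm
  have hKu : IntegrableOn (fun s => K * ‖u s‖) (Icc 0 T) := hu.norm.const_mul K
  have := gronwall_of_integrable (φ := fun s => 1 + ‖x s‖) (α := 1 + ‖x₀‖) (b := K * R)
    hKu (fun s _ => mul_nonneg hf.nonneg (norm_nonneg _)) ?_ hc
    (fun s _ => by positivity) (fun t ht => ?_) ht
  · unfold growth
    linarith
  · rw [intervalIntegral.integral_const_mul]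
    exact mul_le_mul_of_nonneg_left hR hf.nonneg
  · have h1 : ‖∫ s in (0 : ℝ)..t, f (x s) (u s)‖ ≤
        ∫ s in (0 : ℝ)..t, K * ‖u s‖ * (1 + ‖x s‖) := by
      refine intervalIntegral.norm_integral_le_of_norm_le ht.1 ?_
        (intervalIntegrable_of_integrableOn_Icc (hKu.mul_continuousOn hc isCompact_Icc) h0 ht)
      refine Eventually.of_forall fun s _ => ((f (x s)).le_opNorm _).trans ?_
      have := mul_le_mul_of_nonneg_right (hf.norm_le (x s)) (norm_nonneg (u s))
      linarith
    have h2 : ‖x t‖ ≤ ‖x₀‖ + ‖∫ s in (0 : ℝ)..t, f (x s) (u s)‖ := by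
      conv_lhs => rw [hx.2.2 t ht]
      exact norm_add_le _ _
    linarith

/-- Every control of `L¹` norm at most `R` enters the Grönwall estimates through the factor
`growth K R`. -/
theorem norm_le_growth (hf : IsRegularField f K) (hu : IntegrableOn u (Icc 0 T))
    (hR : ∫ s in (0 : ℝ)..T, ‖u s‖ ≤ R) {γ : ℝ → ℝ} {α c : ℝ} {z h : ℝ → E}
    (hγ : IntegrableOn γ (Icc 0 T)) (hγ0 : ∀ s ∈ Icc 0 T, 0 ≤ γ s)
    (hc : ∫ s in (0 : ℝ)..T, γ s ≤ c)
    (hz : ContinuousOn z (Icc 0 T)) (hh : ∀ s ∈ Icc 0 T, ‖h s‖ ≤ K * ‖u s‖ * ‖z s‖ + γ s)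
    (hzh : ∀ t ∈ Icc 0 T, ‖z t - ∫ s in (0 : ℝ)..t, h s‖ ≤ α) {t : ℝ} (ht : t ∈ Icc 0 T) :
    ‖z t‖ ≤ (α + c) * growth K R := by
  have := norm_le_of_norm_sub_integral_le (b := K * R) (hu.norm.const_mul K)
    (fun s _ => mul_nonneg hf.nonneg (norm_nonneg _)) ?_ hγ hγ0 hc hz hh hzh ht
  · unfold growth
    linarith
  · rw [intervalIntegral.integral_const_mul]
    exact mul_le_mul_of_nonneg_left hR hf.nonneg

variable {V : ℝ}

theorem norm_lin_le (hf : IsRegularField f K) (hu : IntegrableOn u (Icc 0 T))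
    (hv : IntegrableOn v (Icc 0 T)) (hR : ∫ s in (0 : ℝ)..T, ‖u s‖ ≤ R)
    (hV : ∫ s in (0 : ℝ)..T, ‖v s‖ ≤ V) (hx : IsStateSolution f T u x₀ x)
    (hy : IsLinSolution f T u v x y) {t : ℝ} (ht : t ∈ Icc 0 T) :
    ‖y t‖ ≤ K * ((1 + ‖x₀‖) * growth K R) * V * growth K R := by
  have hG := growth_pos K R
  have hK := hf.nonneg
  have := hf.norm_le_growth hu hR (α := 0) (c := K * ((1 + ‖x₀‖) * growth K R) * V)
    (γ := fun s => K * ((1 + ‖x₀‖) * growth K R) * ‖v s‖)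
    (h := fun s => fderiv ℝ f (x s) (y s) (u s) + f (x s) (v s))
    (hv.norm.const_mul _) (fun s _ => by positivity) ?_ hy.1 (fun s hs => ?_)
    (fun t ht => by rw [hy.2.2 t ht]; simp) ht
  · simpa using this
  · rw [intervalIntegral.integral_const_mul]
    exact mul_le_mul_of_nonneg_left hV (by positivity)
  · refine (norm_add_le _ _).trans (add_le_add ?_ ?_)
    · refine ((fderiv ℝ f (x s) (y s)).le_opNorm _).trans ?_
      have := mul_le_mul_of_nonneg_right ((fderiv ℝ f (x s)).le_of_opNorm_le
        (hf.norm_fderiv_le (x s)) (y s)) (norm_nonneg (u s))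
      linarith
    · refine ((f (x s)).le_opNorm _).trans (mul_le_mul_of_nonneg_right ?_ (norm_nonneg _))
      exact (hf.norm_le _).trans (mul_le_mul_of_nonneg_left (hf.norm_state_le hu hR hx hs) hK)

variable {u' : ℝ → W} {x' y' : ℝ → E}

/-- If `∫₀ f(x)(u' - u)` is uniformly small, then the trajectories of `u` and `u'` are close. -/
theorem norm_state_sub_state_le (hf : IsRegularField f K) {ε : ℝ}
    (hu' : IntegrableOn u' (Icc 0 T)) (hR : ∫ s in (0 : ℝ)..T, ‖u' s‖ ≤ R)
    (hx : IsStateSolution f T u x₀ x) (hx' : IsStateSolution f T u' x₀ x')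
    (hε : ∀ t ∈ Icc 0 T, ‖∫ s in (0 : ℝ)..t, f (x s) (u' s - u s)‖ ≤ ε) {t : ℝ}
    (ht : t ∈ Icc 0 T) : ‖x' t - x t‖ ≤ ε * growth K R := by
  have h0 : (0 : ℝ) ∈ Icc 0 T := ⟨le_rfl, ht.1.trans ht.2⟩
  have := hf.norm_le_growth hu' hR (α := ε) (c := 0) (γ := 0) (z := fun s => x' s - x s)
    (h := fun s => (f (x' s) - f (x s)) (u' s)) integrableOn_zero (fun _ _ => le_rfl) (by simp)
    (hx'.1.sub hx.1) (fun s hs => ?_) (fun t ht => ?_) ht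
  · simpa using this
  · refine ((f (x' s) - f (x s)).le_opNorm _).trans ?_
    have := mul_le_mul_of_nonneg_right (hf.norm_sub_le (x' s) (x s)) (norm_nonneg (u' s))
    simp only [Pi.zero_apply, add_zero]
    linarith
  · refine le_trans (le_of_eq ?_) (hε t ht)
    have hi1 := intervalIntegrable_of_integrableOn_Icc (integrableOn_clm_apply
      ((hf.continuous.comp_continuousOn hx'.1).sub (hf.continuous.comp_continuousOn hx.1)) hu')
      h0 ht
    have hi2 := intervalIntegrable_of_integrableOn_Icc hx.2.1 h0 ht
    have hi3 := intervalIntegrable_of_integrableOn_Icc hx'.2.1 h0 ht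
    rw [hx.2.2 t ht, hx'.2.2 t ht, add_sub_add_left_eq_sub,
      ← intervalIntegral.integral_sub hi3 hi2]
    refine congrArg norm ((intervalIntegral.integral_sub (hi3.sub hi2) hi1).symm.trans ?_)
    refine intervalIntegral.integral_congr fun s _ => ?_
    simp

theorem norm_state_sub_state_le_mul (hf : IsRegularField f K) (hu : IntegrableOn u (Icc 0 T))
    (hu' : IntegrableOn u' (Icc 0 T)) (hR : ∫ s in (0 : ℝ)..T, ‖u s‖ ≤ R)
    (hR' : ∫ s in (0 : ℝ)..T, ‖u' s‖ ≤ R) (hV : ∫ s in (0 : ℝ)..T, ‖u' s - u s‖ ≤ V)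
    (hx : IsStateSolution f T u x₀ x) (hx' : IsStateSolution f T u' x₀ x') {t : ℝ}
    (ht : t ∈ Icc 0 T) :
    ‖x' t - x t‖ ≤ K * ((1 + ‖x₀‖) * growth K R) * V * growth K R := by
  have h0 : (0 : ℝ) ∈ Icc 0 T := ⟨le_rfl, ht.1.trans ht.2⟩
  have hG := growth_pos K R
  have hK := hf.nonneg
  refine hf.norm_state_sub_state_le hu' hR' hx hx' (fun t ht => ?_) ht
  have h1 : ‖∫ s in (0 : ℝ)..t, f (x s) (u' s - u s)‖ ≤
      ∫ s in (0 : ℝ)..t, K * ((1 + ‖x₀‖) * growth K R) * ‖u' s - u s‖ := by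
    refine intervalIntegral.norm_integral_le_of_norm_le ht.1 ?_
      (intervalIntegrable_of_integrableOn_Icc ((hu'.sub hu).norm.const_mul _) h0 ht)
    refine Eventually.of_forall fun s hs => ?_
    have hs' : s ∈ Icc 0 T := ⟨hs.1.le, hs.2.trans ht.2⟩
    refine ((f (x s)).le_opNorm _).trans (mul_le_mul_of_nonneg_right ?_ (norm_nonneg _))
    exact (hf.norm_le _).trans (mul_le_mul_of_nonneg_left (hf.norm_state_le hu hR hx hs') hK)
  refine h1.trans ?_
  rw [intervalIntegral.integral_const_mul]
  refine mul_le_mul_of_nonneg_left (le_trans ?_ hV) (by positivity)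
  exact integral_le_integral_right (hu'.sub hu).norm (fun _ _ => norm_nonneg _) ht

/-- The remainder of the linearization of the input-to-state map is quadratic. -/
theorem norm_state_sub_state_sub_lin_le (hf : IsRegularField f K) (hu : IntegrableOn u (Icc 0 T))
    (hu' : IntegrableOn u' (Icc 0 T)) (hR : ∫ s in (0 : ℝ)..T, ‖u s‖ ≤ R)
    (hR' : ∫ s in (0 : ℝ)..T, ‖u' s‖ ≤ R) (hV : ∫ s in (0 : ℝ)..T, ‖u' s - u s‖ ≤ V)
    (hx : IsStateSolution f T u x₀ x) (hx' : IsStateSolution f T u' x₀ x')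
    (hy : IsLinSolution f T u (fun s => u' s - u s) x y) {t : ℝ} (ht : t ∈ Icc 0 T) :
    ‖x' t - x t - y t‖ ≤
      (K ^ 3 * growth K R ^ 4 * R + K ^ 2 * growth K R ^ 2) * growth K R
        * (1 + ‖x₀‖) ^ 2 * V ^ 2 := by
  have hT : 0 ≤ T := ht.1.trans ht.2
  have h0 : (0 : ℝ) ∈ Icc 0 T := ⟨le_rfl, hT⟩
  have hG := growth_pos K R
  have hK := hf.nonneg
  have hV0 : 0 ≤ V :=
    (intervalIntegral.integral_nonneg hT fun _ _ => norm_nonneg _).trans hV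
  set δ := K * ((1 + ‖x₀‖) * growth K R) * V * growth K R with hδ
  have hδ0 : 0 ≤ δ := by positivity
  have hd : ∀ s ∈ Icc 0 T, ‖x' s - x s‖ ≤ δ := fun s hs =>
    hf.norm_state_sub_state_le_mul hu hu' hR hR' hV hx hx' hs
  have hv : IntegrableOn (fun s => u' s - u s) (Icc 0 T) := hu'.sub hu
  have hi1 := intervalIntegrable_of_integrableOn_Icc (hu.norm.const_mul (K * δ ^ 2)) h0 ⟨hT, le_rfl⟩
  have hi2 := intervalIntegrable_of_integrableOn_Icc (hv.norm.const_mul (K * δ)) h0 ⟨hT, le_rfl⟩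
  have hγ : IntegrableOn (fun s => K * δ ^ 2 * ‖u s‖ + K * δ * ‖u' s - u s‖) (Icc 0 T) :=
    (hu.norm.const_mul _).add (hv.norm.const_mul _)
  have key := hf.norm_le_growth hu hR (α := 0) (c := K * δ ^ 2 * R + K * δ * V)
    (γ := fun s => K * δ ^ 2 * ‖u s‖ + K * δ * ‖u' s - u s‖)
    (z := fun s => x' s - x s - y s)
    (h := fun s => f (x' s) (u' s) - f (x s) (u s) -
      (fderiv ℝ f (x s) (y s) (u s) + f (x s) (u' s - u s)))
    hγ (fun s _ => by positivity) ?_ ((hx'.1.sub hx.1).sub hy.1) (fun s hs => ?_)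
    (fun t ht => ?_) ht
  · refine key.trans ?_
    rw [zero_add, hδ]
    have h1 : 1 + ‖x₀‖ ≤ (1 + ‖x₀‖) ^ 2 := by nlinarith [norm_nonneg x₀]
    calc (K * (K * ((1 + ‖x₀‖) * growth K R) * V * growth K R) ^ 2 * R +
          K * (K * ((1 + ‖x₀‖) * growth K R) * V * growth K R) * V) * growth K R
        = K ^ 3 * growth K R ^ 4 * R * growth K R * (1 + ‖x₀‖) ^ 2 * V ^ 2 +
          K ^ 2 * growth K R ^ 2 * growth K R * V ^ 2 * (1 + ‖x₀‖) := by ring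
      _ ≤ K ^ 3 * growth K R ^ 4 * R * growth K R * (1 + ‖x₀‖) ^ 2 * V ^ 2 +
          K ^ 2 * growth K R ^ 2 * growth K R * V ^ 2 * (1 + ‖x₀‖) ^ 2 := by gcongr
      _ = _ := by ring
  · rw [intervalIntegral.integral_add hi1 hi2, intervalIntegral.integral_const_mul,
      intervalIntegral.integral_const_mul]
    gcongr
  · have e : f (x' s) (u' s) - f (x s) (u s) -
        (fderiv ℝ f (x s) (y s) (u s) + f (x s) (u' s - u s)) =
        fderiv ℝ f (x s) (x' s - x s - y s) (u s) +
        ((f (x' s) - f (x s) - fderiv ℝ f (x s) (x' s - x s)) (u s) +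
          (f (x' s) - f (x s)) (u' s - u s)) := by
      simp only [map_sub, sub_apply]
      abel
    rw [e]
    refine (norm_add_le _ _).trans (add_le_add ?_ ((norm_add_le _ _).trans (add_le_add ?_ ?_)))
    · refine ((fderiv ℝ f (x s) _).le_opNorm _).trans ?_
      have := mul_le_mul_of_nonneg_right ((fderiv ℝ f (x s)).le_of_opNorm_le
        (hf.norm_fderiv_le (x s)) (x' s - x s - y s)) (norm_nonneg (u s))
      linarith
    · refine (ContinuousLinearMap.le_opNorm _ _).trans
        (mul_le_mul_of_nonneg_right ?_ (norm_nonneg _))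
      refine (hf.norm_taylor_le _ _).trans ?_
      have := hd s hs
      gcongr
    · refine (ContinuousLinearMap.le_opNorm _ _).trans
        (mul_le_mul_of_nonneg_right ?_ (norm_nonneg _))
      refine (hf.norm_sub_le _ _).trans ?_
      have := hd s hs
      gcongr
  · have hi1 := intervalIntegrable_of_integrableOn_Icc hx.2.1 h0 ht
    have hi2 := intervalIntegrable_of_integrableOn_Icc hx'.2.1 h0 ht
    have hi3 := intervalIntegrable_of_integrableOn_Icc hy.2.1 h0 ht
    rw [intervalIntegral.integral_sub (hi2.sub hi1) hi3, intervalIntegral.integral_sub hi2 hi1,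
      hx.2.2 t ht, hx'.2.2 t ht, hy.2.2 t ht]
    simp

/-- Two linearized trajectories with the same direction are close as soon as the underlying
trajectories and the primitives of `Df(x)(u' - u)` are. -/
theorem norm_lin_sub_lin_le [CompleteSpace E] (hf : IsRegularField f K) {ε η : ℝ}
    (hu : IntegrableOn u (Icc 0 T))
    (hu' : IntegrableOn u' (Icc 0 T)) (hv : IntegrableOn v (Icc 0 T))
    (hR : ∫ s in (0 : ℝ)..T, ‖u s‖ ≤ R)
    (hR' : ∫ s in (0 : ℝ)..T, ‖u' s‖ ≤ R) (hV : ∫ s in (0 : ℝ)..T, ‖v s‖ ≤ V)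
    (hx : IsStateSolution f T u x₀ x) (hx' : IsStateSolution f T u' x₀ x')
    (hy : IsLinSolution f T u v x y) (hy' : IsLinSolution f T u' v x' y')
    (hη : ∀ t ∈ Icc 0 T, ‖x' t - x t‖ ≤ η)
    (hε : ∀ t ∈ Icc 0 T, ‖∫ s in (0 : ℝ)..t, (fderiv ℝ f (x s)).flip (u' s - u s)‖ ≤ ε) {t : ℝ}
    (ht : t ∈ Icc 0 T) :
    ‖y' t - y t‖ ≤ (2 * ε * (K * ((1 + ‖x₀‖) * growth K R) * V * (K * R * growth K R + 1)) +
      K * η * V * (K * ((1 + ‖x₀‖) * growth K R) * R * growth K R + 1)) * growth K R := by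
  have hT : 0 ≤ T := ht.1.trans ht.2
  have h0 : (0 : ℝ) ∈ Icc 0 T := ⟨le_rfl, hT⟩
  have hG := growth_pos K R
  have hK := hf.nonneg
  have hV0 : 0 ≤ V :=
    (intervalIntegral.integral_nonneg hT fun _ _ => norm_nonneg _).trans hV
  have hη0 : 0 ≤ η := (norm_nonneg _).trans (hη 0 h0)
  set m := K * ((1 + ‖x₀‖) * growth K R) with hm
  have hm0 : 0 ≤ m := by positivity
  have hyb : ∀ s ∈ Icc 0 T, ‖y s‖ ≤ m * V * growth K R := fun s hs =>
    hf.norm_lin_le hu hv hR hV hx hy hs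
  have hDc : ContinuousOn (fun s => fderiv ℝ f (x s)) (Icc 0 T) :=
    hf.continuous_fderiv.comp_continuousOn hx.1
  have hDc' : ContinuousOn (fun s => fderiv ℝ f (x' s)) (Icc 0 T) :=
    hf.continuous_fderiv.comp_continuousOn hx'.1
  have hfc : ContinuousOn (fun s => f (x s)) (Icc 0 T) := hf.continuous.comp_continuousOn hx.1
  have hfc' : ContinuousOn (fun s => f (x' s)) (Icc 0 T) := hf.continuous.comp_continuousOn hx'.1
  have hi1 := intervalIntegrable_of_integrableOn_Icc
    (hu'.norm.const_mul (K * η * (m * V * growth K R))) h0 ⟨hT, le_rfl⟩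
  have hi2 := intervalIntegrable_of_integrableOn_Icc (hv.norm.const_mul (K * η)) h0 ⟨hT, le_rfl⟩
  have key := hf.norm_le_growth hu' hR'
    (α := 2 * ε * (m * V * (K * R * growth K R + 1)))
    (c := K * η * (m * V * growth K R) * R + K * η * V)
    (γ := fun s => K * η * (m * V * growth K R) * ‖u' s‖ + K * η * ‖v s‖)
    (z := fun s => y' s - y s)
    (h := fun s => fderiv ℝ f (x' s) (y' s - y s) (u' s) +
      ((fderiv ℝ f (x' s) - fderiv ℝ f (x s)) (y s) (u' s) + (f (x' s) - f (x s)) (v s)))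
    ((hu'.norm.const_mul _).add (hv.norm.const_mul _)) (fun s _ => by positivity) ?_
    (hy'.1.sub hy.1) (fun s hs => ?_) (fun t ht => ?_) ht
  · refine key.trans (le_of_eq ?_)
    ring
  · rw [intervalIntegral.integral_add hi1 hi2, intervalIntegral.integral_const_mul,
      intervalIntegral.integral_const_mul]
    gcongr
  · refine (norm_add_le _ _).trans (add_le_add ?_ ((norm_add_le _ _).trans (add_le_add ?_ ?_)))
    · refine ((fderiv ℝ f (x' s) _).le_opNorm _).trans ?_
      have := mul_le_mul_of_nonneg_right ((fderiv ℝ f (x' s)).le_of_opNorm_le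
        (hf.norm_fderiv_le (x' s)) (y' s - y s)) (norm_nonneg (u' s))
      linarith
    · refine (ContinuousLinearMap.le_opNorm _ _).trans
        (mul_le_mul_of_nonneg_right ?_ (norm_nonneg _))
      refine (ContinuousLinearMap.le_opNorm _ _).trans ?_
      have h1 := hη s hs
      have h2 := hyb s hs
      calc ‖fderiv ℝ f (x' s) - fderiv ℝ f (x s)‖ * ‖y s‖
          ≤ (K * ‖x' s - x s‖) * ‖y s‖ := by gcongr; exact hf.norm_fderiv_sub_le _ _
        _ ≤ (K * η) * (m * V * growth K R) := by gcongr
    · refine (ContinuousLinearMap.le_opNorm _ _).trans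
        (mul_le_mul_of_nonneg_right ?_ (norm_nonneg _))
      refine (hf.norm_sub_le _ _).trans ?_
      have := hη s hs
      gcongr
  · -- the part of the increment that does not involve `y' - y` is `∫ Df(x)(y)(u' - u)`
    have hp : IntegrableOn (fun s => (fderiv ℝ f (x s)).flip (u' s - u s)) (Icc 0 T) :=
      integrableOn_clm_apply (A := fun s => (fderiv ℝ f (x s)).flip)
        ((ContinuousLinearMap.flipₗᵢ ℝ E W E).continuous.comp_continuousOn hDc) (hu'.sub hu)
    have hbound : ∫ s in (0 : ℝ)..T, ‖fderiv ℝ f (x s) (y s) (u s) + f (x s) (v s)‖ ≤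
        m * V * (K * R * growth K R + 1) := by
      calc ∫ s in (0 : ℝ)..T, ‖fderiv ℝ f (x s) (y s) (u s) + f (x s) (v s)‖
          ≤ ∫ s in (0 : ℝ)..T, (K * (m * V * growth K R) * ‖u s‖ + m * ‖v s‖) := by
            refine intervalIntegral.integral_mono_on hT
              (intervalIntegrable_of_integrableOn_Icc hy.2.1.norm h0 ⟨hT, le_rfl⟩)
              (intervalIntegrable_of_integrableOn_Icc
                ((hu.norm.const_mul _).add (hv.norm.const_mul _)) h0 ⟨hT, le_rfl⟩) fun s hs => ?_
            refine (norm_add_le _ _).trans (add_le_add ?_ ?_)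
            · refine ((fderiv ℝ f (x s) (y s)).le_opNorm _).trans
                (mul_le_mul_of_nonneg_right ?_ (norm_nonneg _))
              refine ((fderiv ℝ f (x s)).le_of_opNorm_le (hf.norm_fderiv_le (x s)) (y s)).trans ?_
              exact mul_le_mul_of_nonneg_left (hyb s hs) hK
            · refine ((f (x s)).le_opNorm _).trans (mul_le_mul_of_nonneg_right ?_ (norm_nonneg _))
              exact (hf.norm_le _).trans
                (mul_le_mul_of_nonneg_left (hf.norm_state_le hu hR hx hs) hK)
        _ = K * (m * V * growth K R) * (∫ s in (0 : ℝ)..T, ‖u s‖) +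
            m * ∫ s in (0 : ℝ)..T, ‖v s‖ := by
            rw [intervalIntegral.integral_add
              (intervalIntegrable_of_integrableOn_Icc (hu.norm.const_mul _) h0 ⟨hT, le_rfl⟩)
              (intervalIntegrable_of_integrableOn_Icc (hv.norm.const_mul _) h0 ⟨hT, le_rfl⟩),
              intervalIntegral.integral_const_mul, intervalIntegral.integral_const_mul]
        _ ≤ K * (m * V * growth K R) * R + m * V := by gcongr
        _ = m * V * (K * R * growth K R + 1) := by ring
    have := norm_integral_clm_apply_primitive_le hp hy.2.1 hbound hε ht
    refine le_trans (le_of_eq ?_) this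
    have hiy := intervalIntegrable_of_integrableOn_Icc hy.2.1 h0 ht
    have hiy' := intervalIntegrable_of_integrableOn_Icc hy'.2.1 h0 ht
    have hih := intervalIntegrable_of_integrableOn_Icc
      ((integrableOn_clm_apply (hDc'.clm_apply (hy'.1.sub hy.1)) hu').add
        ((integrableOn_clm_apply ((hDc'.sub hDc).clm_apply hy.1) hu').add
          (integrableOn_clm_apply (hfc'.sub hfc) hv))) h0 ht
    rw [hy.2.2 t ht, hy'.2.2 t ht, add_sub_add_left_eq_sub,
      ← intervalIntegral.integral_sub hiy' hiy]
    refine congrArg norm ((intervalIntegral.integral_sub (hiy'.sub hiy) hih).symm.trans ?_)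
    refine intervalIntegral.integral_congr fun s hs => ?_
    rw [uIcc_of_le ht.1] at hs
    have hys := hy.2.2 s ⟨hs.1, hs.2.trans ht.2⟩
    rw [zero_add] at hys
    simp only [← hys, ContinuousLinearMap.flip_apply, map_sub, sub_apply, Pi.sub_apply,
      Pi.add_apply]
    abel

end IsRegularField

end

/-! ### Weak convergence of controls -/

section

section Weak

variable {H : Type*} [NormedAddCommGroup H] [NormedSpace ℝ H] {u : ℕ → H} {uInf : H}

theorem tendsto_dual_of_tendsto_weak
    (h : Tendsto (fun m => toWeakSpace ℝ H (u m)) atTop (𝓝 (toWeakSpace ℝ H uInf)))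
    (φ : H →L[ℝ] ℝ) : Tendsto (fun m => φ (u m)) atTop (𝓝 (φ uInf)) :=
  ((WeakBilin.eval_continuous (topDualPairing ℝ H).flip φ).tendsto _).comp h

/-- Weakly convergent sequences are bounded, by the uniform boundedness principle in the dual. -/
theorem exists_norm_le_of_tendsto_weak
    (h : Tendsto (fun m => toWeakSpace ℝ H (u m)) atTop (𝓝 (toWeakSpace ℝ H uInf))) :
    ∃ R, ∀ m, ‖u m‖ ≤ R := by
  obtain ⟨C, hC⟩ := banach_steinhaus
    (g := fun m => NormedSpace.inclusionInDoubleDual ℝ H (u m)) fun φ => by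
      obtain ⟨C, hC⟩ := (tendsto_dual_of_tendsto_weak h φ).norm.bddAbove_range
      exact ⟨C, fun m => by simpa using hC (mem_range_self m)⟩
  refine ⟨C, fun m => ?_⟩
  rw [← (NormedSpace.inclusionInDoubleDualLi ℝ (E := H)).norm_map (u m)]
  exact hC m

theorem tendsto_clm_of_tendsto_weak {G : Type*} [NormedAddCommGroup G] [NormedSpace ℝ G]
    [FiniteDimensional ℝ G]
    (h : Tendsto (fun m => toWeakSpace ℝ H (u m)) atTop (𝓝 (toWeakSpace ℝ H uInf)))
    (φ : H →L[ℝ] G) : Tendsto (fun m => φ (u m)) atTop (𝓝 (φ uInf)) := by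
  let e := (Module.finBasis ℝ G).equivFunL
  have h1 : Tendsto (fun m => e (φ (u m))) atTop (𝓝 (e (φ uInf))) := by
    rw [tendsto_pi_nhds]
    intro i
    exact tendsto_dual_of_tendsto_weak h
      ((ContinuousLinearMap.proj (R := ℝ) (φ := fun _ => ℝ) i).comp ((e : G →L[ℝ] _).comp φ))
  simpa [Function.comp_def] using (e.symm.continuous.tendsto _).comp h1

end Weak

/-- The exponent `1 - 1/q` of Hölder's inequality on an interval. -/
noncomputable def holderExponent (q : ℝ≥0∞) : ℝ := 1 - 1 / q.toReal

theorem holderExponent_pos {q : ℝ≥0∞} (hq : 1 < q) (hq_top : q < ∞) : 0 < holderExponent q := by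
  have : 1 < q.toReal := by
    rw [← ENNReal.toReal_one]
    exact (ENNReal.toReal_lt_toReal ENNReal.one_ne_top hq_top.ne).2 hq
  unfold holderExponent
  have h := (div_lt_one (by linarith)).2 this
  linarith

section Control

variable {W : Type*} [NormedAddCommGroup W] {T : ℝ} {q : ℝ≥0∞} [Fact (1 ≤ q)]

theorem integrableOn_control (u : Lp W q (volume.restrict (Icc (0 : ℝ) T))) :
    IntegrableOn u (Icc 0 T) :=
  (Lp.memLp u).integrable (Fact.out : 1 ≤ q)

/-- Hölder's inequality for controls on a subinterval. -/
theorem abs_integral_norm_control_le (u : Lp W q (volume.restrict (Icc (0 : ℝ) T))) {s t : ℝ}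
    (hs : s ∈ Icc 0 T) (ht : t ∈ Icc 0 T) :
    |∫ r in s..t, ‖u r‖| ≤ ‖u‖ * |t - s| ^ holderExponent q := by
  wlog hst : s ≤ t generalizing s t
  · rw [intervalIntegral.integral_symm, abs_neg, abs_sub_comm]
    exact this ht hs (le_of_not_ge hst)
  have hsub : Ioc s t ⊆ Icc 0 T := fun r hr => ⟨hs.1.trans hr.1.le, hr.2.trans ht.2⟩
  have hle : volume.restrict (Ioc s t) ≤ volume.restrict (Icc (0 : ℝ) T) :=
    Measure.restrict_mono hsub le_rfl
  have hint : IntegrableOn u (Ioc s t) := (integrableOn_control u).mono_set hsub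
  rw [intervalIntegral.integral_of_le hst,
    abs_of_nonneg (integral_nonneg fun _ => norm_nonneg _),
    integral_norm_eq_lintegral_enorm hint.aestronglyMeasurable, ← eLpNorm_one_eq_lintegral_enorm]
  have h1 := eLpNorm_le_eLpNorm_mul_rpow_measure_univ (Fact.out : 1 ≤ q) hint.aestronglyMeasurable
  have h2 : eLpNorm u q (volume.restrict (Ioc s t)) ≤
      eLpNorm u q (volume.restrict (Icc (0 : ℝ) T)) := eLpNorm_mono_measure u hle
  have h3 : (volume.restrict (Ioc s t)) univ = ENNReal.ofReal (t - s) := by simp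
  rw [h3, ENNReal.toReal_one, div_one] at h1
  have he : 0 ≤ holderExponent q := by
    unfold holderExponent
    by_cases hq : q = ∞
    · simp [hq]
    · have : 1 ≤ q.toReal := by
        rw [← ENNReal.toReal_one]
        exact (ENNReal.toReal_le_toReal ENNReal.one_ne_top hq).2 Fact.out
      have h := (div_le_one (by linarith)).2 this
      linarith
  calc (eLpNorm u 1 (volume.restrict (Ioc s t))).toReal
      ≤ (eLpNorm u q (volume.restrict (Icc (0 : ℝ) T)) *
          ENNReal.ofReal (t - s) ^ holderExponent q).toReal := by
        refine ENNReal.toReal_mono (ENNReal.mul_ne_top (Lp.eLpNorm_ne_top u)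
          (ENNReal.rpow_ne_top_of_nonneg he ENNReal.ofReal_ne_top)) (h1.trans ?_)
        exact mul_le_mul' h2 le_rfl
    _ = ‖u‖ * |t - s| ^ holderExponent q := by
        rw [ENNReal.toReal_mul, Lp.norm_def, ← ENNReal.toReal_rpow,
          ENNReal.toReal_ofReal (sub_nonneg.2 hst), abs_of_nonneg (sub_nonneg.2 hst)]

theorem integral_norm_control_le (hT : 0 ≤ T) (u : Lp W q (volume.restrict (Icc (0 : ℝ) T))) :
    ∫ r in (0 : ℝ)..T, ‖u r‖ ≤ T ^ holderExponent q * ‖u‖ := by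
  have h := abs_integral_norm_control_le u ⟨le_rfl, hT⟩ ⟨hT, le_rfl⟩
  rw [sub_zero, abs_of_nonneg hT, mul_comm] at h
  exact (le_abs_self _).trans h

theorem ae_interval_of_ae_Icc {P : ℝ → Prop} (h : ∀ᵐ s ∂volume.restrict (Icc (0 : ℝ) T), P s)
    {s t : ℝ} (hs : s ∈ Icc 0 T) (ht : t ∈ Icc 0 T) : ∀ᵐ r, r ∈ uIoc s t → P r := by
  filter_upwards [(ae_restrict_iff' measurableSet_Icc).1 h] with r hr hrst
  exact hr (uIcc_subset_Icc hs ht (uIoc_subset_uIcc hrst))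

variable [NormedSpace ℝ W] {G : Type*} [NormedAddCommGroup G] [NormedSpace ℝ G]
  {A : ℝ → W →L[ℝ] G} {C : ℝ}

theorem norm_integral_clm_control_le (hC : ∀ s ∈ Icc 0 T, ‖A s‖ ≤ C)
    (w : Lp W q (volume.restrict (Icc (0 : ℝ) T))) {s t : ℝ}
    (hs : s ∈ Icc 0 T) (ht : t ∈ Icc 0 T) :
    ‖∫ r in s..t, A r (w r)‖ ≤ C * (‖w‖ * |t - s| ^ holderExponent q) := by
  have hC0 : 0 ≤ C := (norm_nonneg _).trans (hC s hs)
  have h : ‖∫ r in s..t, A r (w r)‖ ≤ |∫ r in s..t, C * ‖w r‖| := by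
    refine intervalIntegral.norm_integral_le_abs_of_norm_le ?_
      (intervalIntegrable_of_integrableOn_Icc ((integrableOn_control w).norm.const_mul C) hs ht)
    filter_upwards [ae_restrict_mem measurableSet_uIoc] with r hr
    exact (A r).le_of_opNorm_le (hC r (uIcc_subset_Icc hs ht (uIoc_subset_uIcc hr))) _
  refine h.trans ?_
  rw [intervalIntegral.integral_const_mul, abs_mul, abs_of_nonneg hC0]
  exact mul_le_mul_of_nonneg_left (abs_integral_norm_control_le w hs ht) hC0

/-- The functional `w ↦ ∫₀ᵗ A w` on controls. -/
noncomputable def primitiveCLM (hA : ContinuousOn A (Icc 0 T)) (hC : ∀ s ∈ Icc 0 T, ‖A s‖ ≤ C)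
    (t : Icc (0 : ℝ) T) : Lp W q (volume.restrict (Icc (0 : ℝ) T)) →L[ℝ] G :=
  LinearMap.mkContinuous
    { toFun := fun w => ∫ r in (0 : ℝ)..t, A r (w r)
      map_add' := fun w w' => by
        have h0 : (0 : ℝ) ∈ Icc 0 T := ⟨le_rfl, t.2.1.trans t.2.2⟩
        rw [← intervalIntegral.integral_add
          (intervalIntegrable_of_integrableOn_Icc
            (integrableOn_clm_apply hA (integrableOn_control w)) h0 t.2)
          (intervalIntegrable_of_integrableOn_Icc
            (integrableOn_clm_apply hA (integrableOn_control w')) h0 t.2)]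
        refine intervalIntegral.integral_congr_ae ?_
        filter_upwards [ae_interval_of_ae_Icc (Lp.coeFn_add w w') h0 t.2] with r hr hr'
        rw [hr hr', Pi.add_apply, map_add]
      map_smul' := fun c w => by
        have h0 : (0 : ℝ) ∈ Icc 0 T := ⟨le_rfl, t.2.1.trans t.2.2⟩
        rw [RingHom.id_apply, ← intervalIntegral.integral_smul]
        refine intervalIntegral.integral_congr_ae ?_
        filter_upwards [ae_interval_of_ae_Icc (Lp.coeFn_smul c w) h0 t.2] with r hr hr'
        rw [hr hr', Pi.smul_apply, map_smul] }
    (C * |(t : ℝ) - 0| ^ holderExponent q) fun w => by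
      have h0 : (0 : ℝ) ∈ Icc 0 T := ⟨le_rfl, t.2.1.trans t.2.2⟩
      refine (norm_integral_clm_control_le hC w h0 t.2).trans (le_of_eq ?_)
      ring

/-- Along a weakly convergent sequence of controls the primitives `∫₀ᵗ A (u_m - u)` tend to zero
uniformly in `t`: they do so pointwise, and are equi-Hölder because `q > 1`. -/
theorem eventually_norm_integral_sub_le_of_weak [FiniteDimensional ℝ G] (hq : 1 < q)
    (hq_top : q < ∞) {u : ℕ → Lp W q (volume.restrict (Icc (0 : ℝ) T))}
    {uInf : Lp W q (volume.restrict (Icc (0 : ℝ) T))}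
    (h : Tendsto (fun m => toWeakSpace ℝ _ (u m)) atTop (𝓝 (toWeakSpace ℝ _ uInf)))
    (hA : ContinuousOn A (Icc 0 T)) {ε : ℝ} (hε : 0 < ε) :
    ∀ᶠ m in atTop, ∀ t ∈ Icc 0 T, ‖∫ s in (0 : ℝ)..t, A s (u m s - uInf s)‖ ≤ ε := by
  obtain ⟨C, hC⟩ := isCompact_Icc.exists_bound_of_continuousOn hA
  obtain ⟨R, hR⟩ := exists_norm_le_of_tendsto_weak h
  set Φ : ℕ → Icc (0 : ℝ) T → G := fun m t => primitiveCLM hA hC t (u m - uInf) with hΦ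
  have he := holderExponent_pos hq hq_top
  have hequi : Equicontinuous Φ := by
    refine Metric.equicontinuous_of_continuity_modulus
      (fun d => C * ((R + ‖uInf‖) * |d| ^ holderExponent q)) ?_ _ fun x y m => ?_
    · have : Tendsto (fun d : ℝ => C * ((R + ‖uInf‖) * |d| ^ holderExponent q)) (𝓝 0)
          (𝓝 (C * ((R + ‖uInf‖) * |0| ^ holderExponent q))) := by
        refine Continuous.tendsto ?_ _
        exact continuous_const.mul (continuous_const.mul
          (continuous_abs.rpow_const fun _ => Or.inr he.le))
      simpa [Real.zero_rpow he.ne'] using this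
    · have h0 : (0 : ℝ) ∈ Icc 0 T := ⟨le_rfl, x.2.1.trans x.2.2⟩
      have hC0 : 0 ≤ C := (norm_nonneg _).trans (hC 0 h0)
      have hw := integrableOn_clm_apply hA (integrableOn_control (u m - uInf))
      rw [dist_comm, dist_eq_norm]
      have e : Φ m y - Φ m x = ∫ r in (x : ℝ)..y, A r ((u m - uInf : Lp W q _) r) :=
        intervalIntegral.integral_interval_sub_left
          (intervalIntegrable_of_integrableOn_Icc hw h0 y.2)
          (intervalIntegrable_of_integrableOn_Icc hw h0 x.2)
      rw [e]
      refine (norm_integral_clm_control_le hC _ x.2 y.2).trans ?_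
      have h1 : ‖u m - uInf‖ ≤ R + ‖uInf‖ := (norm_sub_le _ _).trans (by gcongr; exact hR m)
      have h2 : |(y : ℝ) - x| = |dist x y| := by
        rw [abs_of_nonneg dist_nonneg, Subtype.dist_eq, Real.dist_eq, abs_sub_comm]
      rw [h2]
      gcongr
  have hpt : Tendsto Φ atTop (𝓝 0) := by
    rw [tendsto_pi_nhds]
    intro t
    have := tendsto_clm_of_tendsto_weak h (primitiveCLM hA hC t)
    simpa [hΦ] using this.sub_const (primitiveCLM hA hC t uInf)
  have hunif := UniformFun.tendsto_iff_tendstoUniformly.1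
    ((hequi.tendsto_uniformFun_iff_pi atTop 0).2 hpt)
  filter_upwards [Metric.tendstoUniformly_iff.1 hunif ε hε] with m hm t ht
  have h0 : (0 : ℝ) ∈ Icc 0 T := ⟨le_rfl, ht.1.trans ht.2⟩
  have h1 : dist (0 : G) (Φ m ⟨t, ht⟩) < ε := hm ⟨t, ht⟩
  rw [dist_zero_left] at h1
  refine le_trans (le_of_eq ?_) h1.le
  refine congrArg norm (intervalIntegral.integral_congr_ae ?_)
  filter_upwards [ae_interval_of_ae_Icc (Lp.coeFn_sub (u m) uInf) h0 ht] with r hr hr'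
  rw [hr hr', Pi.sub_apply]

end Control

end

/-! ### Convergence and measurability lemmas -/

section

section Measure

variable {Θ : Type*} [MeasurableSpace Θ] {μ : Measure Θ}
  {E G : Type*} [NormedAddCommGroup E] [NormedAddCommGroup G]

theorem tendsto_eLpNorm_zero_of_dominated {ι : Type*} {l : Filter ι} [l.IsCountablyGenerated]
    {p : ℝ≥0∞} (hp : p ≠ 0) (hp_top : p ≠ ∞) {F : ι → Θ → G} {b : Θ → ℝ}
    (hF : ∀ i, AEStronglyMeasurable (F i) μ) (hb : MemLp b p μ)
    (hbound : ∀ i, ∀ᵐ θ ∂μ, ‖F i θ‖ ≤ b θ)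
    (hlim : ∀ᵐ θ ∂μ, Tendsto (fun i => F i θ) l (𝓝 0)) :
    Tendsto (fun i => eLpNorm (F i) p μ) l (𝓝 0) := by
  have hpos : 0 < p.toReal := ENNReal.toReal_pos hp hp_top
  have h : Tendsto (fun i => ∫⁻ θ, ‖F i θ‖ₑ ^ p.toReal ∂μ) l (𝓝 (∫⁻ _, 0 ∂μ)) := by
    refine tendsto_lintegral_filter_of_dominated_convergence' (fun θ => ‖b θ‖ₑ ^ p.toReal)
      (Eventually.of_forall fun i => (hF i).enorm.pow_const _) (Eventually.of_forall fun i => ?_)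
      (lintegral_rpow_enorm_lt_top_of_eLpNorm_lt_top hp hp_top hb.2).ne ?_
    · filter_upwards [hbound i] with θ hθ
      refine ENNReal.rpow_le_rpow ?_ hpos.le
      rw [enorm_le_iff_norm_le]
      exact hθ.trans (le_abs_self _)
    · filter_upwards [hlim] with θ hθ
      have h1 : Tendsto (fun i => ‖F i θ‖ₑ) l (𝓝 0) := by
        simpa using hθ.enorm
      have h2 := (ENNReal.continuous_rpow_const (y := p.toReal)).tendsto 0 |>.comp h1
      simpa [ENNReal.zero_rpow_of_pos hpos, Function.comp_def] using h2
  simp only [lintegral_zero] at h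
  have h2 := (ENNReal.continuous_rpow_const (y := 1 / p.toReal)).tendsto 0 |>.comp h
  rw [ENNReal.zero_rpow_of_pos (by positivity)] at h2
  simpa [eLpNorm_eq_lintegral_rpow_enorm_toReal hp hp_top, Function.comp_def] using h2

/-- A Carathéodory function composed with a measurable map is measurable. The function is only
required to be almost everywhere measurable for each value of the state. -/
theorem aestronglyMeasurable_caratheodory {φ : E → Θ → G} {Z : Θ → E}
    (hφ : ∀ x, AEStronglyMeasurable (φ x) μ) (hc : ∀ᵐ θ ∂μ, Continuous fun x => φ x θ)
    (hZ : AEStronglyMeasurable Z μ) : AEStronglyMeasurable (fun θ => φ (Z θ) θ) μ := by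
  have hsm := hZ.stronglyMeasurable_mk
  have hstep : ∀ j, AEStronglyMeasurable (fun θ => φ (hsm.approx j θ) θ) μ := by
    intro j
    have e : (fun θ => φ (hsm.approx j θ) θ) =
        fun θ => ∑ c ∈ (hsm.approx j).range, ((hsm.approx j) ⁻¹' {c}).indicator (φ c) θ := by
      ext θ
      rw [Finset.sum_eq_single (hsm.approx j θ)]
      · simp
      · intro c _ hc
        exact indicator_of_notMem (fun h => hc h.symm) _
      · intro h
        exact absurd (SimpleFunc.mem_range_self _ θ) h
    rw [e]
    exact Finset.aestronglyMeasurable_fun_sum _ fun c _ =>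
      (hφ c).indicator (SimpleFunc.measurableSet_fiber _ _)
  refine aestronglyMeasurable_of_tendsto_ae atTop hstep ?_
  filter_upwards [hc, hZ.ae_eq_mk] with θ hθ hθ'
  rw [hθ']
  exact (hθ.tendsto _).comp (hsm.tendsto_approx θ)

theorem integral_comp_simpleFunc {I V : Type*} [MeasurableSpace I] [NormedAddCommGroup V]
    [NormedSpace ℝ V] [CompleteSpace V] (ν : Measure I) [IsFiniteMeasure ν] (π : SimpleFunc I I)
    (h : I → V) : ∫ t, h (π t) ∂ν = ∑ b ∈ π.range, ν.real (π ⁻¹' {b}) • h b := by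
  have e : (fun t => h (π t)) = fun t => ∑ b ∈ π.range, (π ⁻¹' {b}).indicator (fun _ => h b) t := by
    ext t
    rw [Finset.sum_eq_single (π t)]
    · simp
    · intro c _ hc
      exact indicator_of_notMem (fun h => hc h.symm) _
    · intro h
      exact absurd (SimpleFunc.mem_range_self _ t) h
  rw [e, integral_finsetSum]
  · exact Finset.sum_congr rfl fun b _ => integral_indicator_const _ (π.measurableSet_fiber b)
  · exact fun b _ => (integrable_const _).indicator (π.measurableSet_fiber b)

/-- The Bochner integral of a continuous `L¹`-valued curve is computed pointwise, provided the
curve is represented by a function that is continuous in time. Both sides are limits of the sums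
obtained by approximating the identity of the time interval by simple functions. -/
theorem integral_curve_ae_eq {I : Type*} [TopologicalSpace I] [CompactSpace I]
    [TopologicalSpace.PseudoMetrizableSpace I] [MeasurableSpace I] [BorelSpace I] (ν : Measure I)
    [IsFiniteMeasure ν] (Φ : C(I, Lp ℝ 1 μ)) {φ : I → Θ → ℝ} (hΦ : ∀ t, Φ t =ᵐ[μ] φ t)
    (hφ : ∀ᵐ θ ∂μ, Continuous fun t => φ t θ) :
    (∫ t, Φ t ∂ν : Lp ℝ 1 μ) =ᵐ[μ] fun θ => ∫ t, φ t θ ∂ν := by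
  rcases isEmpty_or_nonempty I with hI | hI
  · have : ν = 0 := Measure.eq_zero_of_isEmpty ν
    simp only [this, integral_zero_measure]
    exact Lp.coeFn_zero _ _ _
  let _ := TopologicalSpace.pseudoMetrizableSpacePseudoMetric I
  have : SecondCountableTopology I := inferInstance
  let π : ℕ → SimpleFunc I I := fun j =>
    SimpleFunc.approxOn id measurable_id univ (Classical.arbitrary I)
      (mem_univ _) j
  have hπ : ∀ t, Tendsto (fun j => π j t) atTop (𝓝 t) := fun t =>
    SimpleFunc.tendsto_approxOn measurable_id (mem_univ _) (by simp)
  have h1 : Tendsto (fun j => ∫ t, Φ (π j t) ∂ν) atTop (𝓝 (∫ t, Φ t ∂ν)) := by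
    refine tendsto_integral_of_dominated_convergence (fun _ => ‖Φ‖) (fun j => ?_)
      (integrable_const _) (fun j => Eventually.of_forall fun t => Φ.norm_coe_le_norm _)
      (Eventually.of_forall fun t => (Φ.continuous.tendsto _).comp (hπ t))
    exact ((π j).map Φ).stronglyMeasurable.aestronglyMeasurable
  have h2 : ∀ j, (∫ t, Φ (π j t) ∂ν : Lp ℝ 1 μ) =ᵐ[μ] fun θ => ∫ t, φ (π j t) θ ∂ν := by
    intro j
    have e : ∀ θ, ∫ t, φ (π j t) θ ∂ν = ∑ b ∈ (π j).range, ν.real (π j ⁻¹' {b}) • φ b θ :=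
      fun θ => integral_comp_simpleFunc ν (π j) fun b => φ b θ
    simp only [e]
    rw [integral_comp_simpleFunc ν (π j) Φ]
    have hall : ∀ᵐ θ ∂μ, ∀ b ∈ (π j).range, (Φ b θ = φ b θ ∧
        (ν.real (π j ⁻¹' {b}) • Φ b : Lp ℝ 1 μ) θ = ν.real (π j ⁻¹' {b}) • Φ b θ) := by
      refine (eventually_all_finset _).2 fun b _ => ?_
      filter_upwards [hΦ b, Lp.coeFn_smul (ν.real (π j ⁻¹' {b})) (Φ b)] with θ h h'
      exact ⟨h, h'⟩
    have hsum := Lp.coeFn_finsetSum (π j).range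
      fun b => (ν.real (π j ⁻¹' {b}) • Φ b : Lp ℝ 1 μ)
    filter_upwards [hall, hsum] with θ hθ hs
    rw [hs, Finset.sum_apply]
    refine Finset.sum_congr rfl fun b hb => ?_
    rw [(hθ b hb).2, (hθ b hb).1]
  obtain ⟨ns, hns, hlim⟩ := (tendstoInMeasure_of_tendsto_Lp h1).exists_seq_tendsto_ae
  filter_upwards [hlim, hφ, ae_all_iff.2 h2] with θ hθ hc h2θ
  have h3 : Tendsto (fun j => ∫ t, φ (π j t) θ ∂ν) atTop (𝓝 (∫ t, φ t θ ∂ν)) := by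
    obtain ⟨C, hC⟩ := (isCompact_range hc).isBounded.exists_norm_le
    refine tendsto_integral_of_dominated_convergence (fun _ => C) (fun j => ?_)
      (integrable_const _) (fun j => Eventually.of_forall fun t => hC _ (mem_range_self _))
      (Eventually.of_forall fun t => (hc.tendsto _).comp (hπ t))
    exact ((π j).map fun t => φ t θ).stronglyMeasurable.aestronglyMeasurable
  refine tendsto_nhds_unique hθ ?_
  simp only [h2θ]
  exact h3.comp hns.tendsto_atTop

end Measure

end

/-! ### Nemytskij operators with polynomial growth -/

section

section Nemytskij

variable {Θ : Type*} [MeasurableSpace Θ] {μ : Measure Θ}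
  {E G : Type*} [NormedAddCommGroup E] [NormedAddCommGroup G]
  {P S τ : ℝ≥0∞} {σ C : ℝ}

/-- Hölder's inequality for products of the form `(C |w|^σ + |g|) |ψ|`, with `w`, `ψ` in `L^P` and
`g` in `L^{P/σ}`. -/
theorem eLpNorm_growth_le [ENNReal.HolderTriple S P τ] (hS : 1 ≤ S) (hSP : S * ENNReal.ofReal σ = P)
    (hσ : 0 < σ) (hC : 0 ≤ C) {M N γ : ℝ} (hM : 0 ≤ M) (hγ : 0 ≤ γ) {w g ψ : Θ → ℝ} {f : Θ → G}
    (hw : AEStronglyMeasurable w μ) (hg : AEStronglyMeasurable g μ)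
    (hψ : AEStronglyMeasurable ψ μ) (hwM : eLpNorm w P μ ≤ ENNReal.ofReal M)
    (hgγ : eLpNorm g S μ ≤ ENNReal.ofReal γ) (hψN : eLpNorm ψ P μ ≤ ENNReal.ofReal N)
    (hf : ∀ᵐ θ ∂μ, ‖f θ‖ ≤ (C * |w θ| ^ σ + |g θ|) * |ψ θ|) :
    eLpNorm f τ μ ≤ ENNReal.ofReal ((C * M ^ σ + γ) * N) := by
  have hwσ : AEStronglyMeasurable (fun θ => ‖w θ‖ ^ σ) μ :=
    (Real.continuous_rpow_const hσ.le).comp_aestronglyMeasurable hw.norm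
  have hsum : AEStronglyMeasurable (fun θ => C * ‖w θ‖ ^ σ + ‖g θ‖) μ :=
    (hwσ.const_mul C).add hg.norm
  have h1 : eLpNorm f τ μ ≤ eLpNorm ((fun θ => C * ‖w θ‖ ^ σ + ‖g θ‖) • ψ) τ μ := by
    refine eLpNorm_mono_ae ?_
    filter_upwards [hf] with θ hθ
    refine hθ.trans (le_of_eq ?_)
    have : 0 ≤ C * ‖w θ‖ ^ σ + ‖g θ‖ := by positivity
    rw [Pi.smul_apply', smul_eq_mul, norm_mul, Real.norm_of_nonneg this]
    rfl
  have h2 := eLpNorm_smul_le_mul_eLpNorm (p := S) (q := P) (r := τ) hψ hsum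
  have h3 : eLpNorm (fun θ => C * ‖w θ‖ ^ σ + ‖g θ‖) S μ ≤ ENNReal.ofReal (C * M ^ σ + γ) := by
    refine (eLpNorm_add_le (hwσ.const_mul C) hg.norm hS).trans ?_
    rw [ENNReal.ofReal_add (by positivity) hγ]
    refine add_le_add ?_ (by rwa [eLpNorm_norm])
    have e : (fun θ => C * ‖w θ‖ ^ σ) = C • fun θ => ‖w θ‖ ^ σ := rfl
    rw [e, eLpNorm_const_smul, eLpNorm_norm_rpow w hσ, hSP, ENNReal.ofReal_mul hC,
      ← ENNReal.ofReal_rpow_of_nonneg hM hσ.le, Real.enorm_of_nonneg hC]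
    gcongr
  refine (h1.trans h2).trans ?_
  rw [ENNReal.ofReal_mul (by positivity)]
  exact mul_le_mul' h3 hψN

/-- A Carathéodory kernel `φ(t, x, θ)`, locally Lipschitz in the state with a constant of growth
`σ`, whose Nemytskij operator acts from `L^P` to `L^τ`. The exponents satisfy
`1/τ = σ/P + 1/P`, where `S = P/σ` is the exponent of the coefficient `g`. -/
structure IsNemytskijKernel (μ : Measure Θ) (T : ℝ) (P S τ : ℝ≥0∞) (σ C : ℝ) (g : Θ → ℝ)
    (φ : Icc (0 : ℝ) T → E → Θ → G) : Prop where
  one_le : 1 ≤ S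
  mul_eq : S * ENNReal.ofReal σ = P
  exponent_pos : 0 < σ
  nonneg : 0 ≤ C
  ne_top : τ ≠ ∞
  memLp : MemLp g S μ
  continuous : ∀ᵐ θ ∂μ, Continuous fun p : Icc (0 : ℝ) T × E => φ p.1 p.2 θ
  aestronglyMeasurable : ∀ t x, AEStronglyMeasurable (φ t x) μ
  norm_sub_le : ∀ᵐ θ ∂μ, ∀ t x y, ‖φ t x θ - φ t y θ‖ ≤
    ((C * ‖x‖ ^ σ + g θ) + (C * ‖y‖ ^ σ + g θ)) * ‖x - y‖
  memLp_zero : MemLp (fun θ => ⨆ t, ‖φ t 0 θ‖) τ μ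

namespace IsNemytskijKernel

variable {T : ℝ} {g : Θ → ℝ} {φ : Icc (0 : ℝ) T → E → Θ → G}

theorem aestronglyMeasurable_comp (hφ : IsNemytskijKernel μ T P S τ σ C g φ)
    (t : Icc (0 : ℝ) T) {Z : Θ → E} (hZ : AEStronglyMeasurable Z μ) :
    AEStronglyMeasurable (fun θ => φ t (Z θ) θ) μ := by
  refine aestronglyMeasurable_caratheodory (hφ.aestronglyMeasurable t) ?_ hZ
  filter_upwards [hφ.continuous] with θ hθ
  exact hθ.comp (by fun_prop : Continuous fun x : E => (t, x))

theorem growth_mono (hφ : IsNemytskijKernel μ T P S τ σ C g φ) {x y : E} {r : ℝ} (θ : Θ)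
    (hx : ‖x‖ ≤ r) (hy : ‖y‖ ≤ r) :
    (C * ‖x‖ ^ σ + g θ) + (C * ‖y‖ ^ σ + g θ) ≤ 2 * (C * |r| ^ σ + |g θ|) := by
  have hσ := hφ.exponent_pos
  have hC := hφ.nonneg
  have hr : 0 ≤ r := (norm_nonneg x).trans hx
  have h1 : C * ‖x‖ ^ σ ≤ C * |r| ^ σ := by
    rw [abs_of_nonneg hr]
    gcongr
  have h2 : C * ‖y‖ ^ σ ≤ C * |r| ^ σ := by
    rw [abs_of_nonneg hr]
    gcongr
  linarith [le_abs_self (g θ)]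

variable [ENNReal.HolderTriple S P τ]

theorem eLpNorm_sub_le (hφ : IsNemytskijKernel μ T P S τ σ C g φ) (hP : 1 ≤ P)
    (t : Icc (0 : ℝ) T) {Z Z' : Θ → E} {r r' N : ℝ}
    (hr : 0 ≤ r) (hr' : 0 ≤ r') (hZ : AEStronglyMeasurable Z μ) (hZ' : AEStronglyMeasurable Z' μ)
    (hZr : eLpNorm Z P μ ≤ ENNReal.ofReal r) (hZr' : eLpNorm Z' P μ ≤ ENNReal.ofReal r')
    (hN : eLpNorm (Z - Z') P μ ≤ ENNReal.ofReal N) :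
    eLpNorm (fun θ => φ t (Z θ) θ - φ t (Z' θ) θ) τ μ ≤
      ENNReal.ofReal (2 * (C * (r + r') ^ σ + (eLpNorm g S μ).toReal) * N) := by
  have hw : eLpNorm (fun θ => ‖Z θ‖ + ‖Z' θ‖) P μ ≤ ENNReal.ofReal (r + r') := by
    refine (MeasureTheory.eLpNorm_add_le hZ.norm hZ'.norm hP).trans ?_
    rw [ENNReal.ofReal_add hr hr', eLpNorm_norm, eLpNorm_norm]
    exact add_le_add hZr hZr'
  have h2 : eLpNorm (fun θ => 2 * ‖Z θ - Z' θ‖) P μ ≤ ENNReal.ofReal (2 * N) := by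
    have e : (fun θ => 2 * ‖Z θ - Z' θ‖) = (2 : ℝ) • fun θ => ‖(Z - Z') θ‖ := rfl
    rw [e, eLpNorm_const_smul, eLpNorm_norm, ENNReal.ofReal_mul zero_le_two,
      Real.enorm_of_nonneg zero_le_two]
    gcongr
  have := eLpNorm_growth_le (τ := τ) (f := fun θ => φ t (Z θ) θ - φ t (Z' θ) θ) hφ.one_le hφ.mul_eq
    hφ.exponent_pos hφ.nonneg (add_nonneg hr hr') ENNReal.toReal_nonneg (hZ.norm.add hZ'.norm)
    hφ.memLp.1 ((hZ.sub hZ').norm.const_mul 2) hw (ENNReal.ofReal_toReal hφ.memLp.2.ne).ge h2 ?_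
  · refine this.trans (le_of_eq ?_)
    congr 1
    ring
  · filter_upwards [hφ.norm_sub_le] with θ hθ
    refine (hθ t _ _).trans ?_
    have h := mul_le_mul_of_nonneg_right (hφ.growth_mono θ
      (show ‖Z θ‖ ≤ ‖Z θ‖ + ‖Z' θ‖ by simp) (show ‖Z' θ‖ ≤ ‖Z θ‖ + ‖Z' θ‖ by simp))
      (norm_nonneg (Z θ - Z' θ))
    refine h.trans (le_of_eq ?_)
    simp only [Pi.add_apply, Pi.sub_apply]
    rw [abs_of_nonneg (show 0 ≤ 2 * ‖Z θ - Z' θ‖ by positivity)]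
    ring

theorem memLp_abs_growth (hφ : IsNemytskijKernel μ T P S τ σ C g φ) {Z : Θ → E}
    (hZ : MemLp Z P μ) : MemLp (fun θ => (2 * (C * |‖Z θ‖| ^ σ + |g θ|)) * ‖Z θ‖) τ μ := by
  have hσ := hφ.exponent_pos
  have hm : AEStronglyMeasurable (fun θ => (2 * (C * |‖Z θ‖| ^ σ + |g θ|)) * ‖Z θ‖) μ := by
    refine AEStronglyMeasurable.mul (AEStronglyMeasurable.const_mul (.add (.const_mul ?_ C) ?_) 2)
      hZ.1.norm
    · exact (Real.continuous_rpow_const hσ.le).comp_aestronglyMeasurable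
        (continuous_abs.comp_aestronglyMeasurable hZ.1.norm)
    · exact continuous_abs.comp_aestronglyMeasurable hφ.memLp.1
  have hZ1 := (ENNReal.ofReal_toReal hZ.2.ne).ge
  refine ⟨hm, (eLpNorm_growth_le (N := (2 : ℝ) * (eLpNorm Z P μ).toReal) hφ.one_le hφ.mul_eq
    hφ.exponent_pos hφ.nonneg ENNReal.toReal_nonneg ENNReal.toReal_nonneg
    hZ.1.norm hφ.memLp.1 (hZ.1.norm.const_mul 2) (by rwa [eLpNorm_norm])
    (ENNReal.ofReal_toReal hφ.memLp.2.ne).ge ?_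
    (Eventually.of_forall fun θ => ?_)).trans_lt ENNReal.ofReal_lt_top⟩
  · have e : (fun θ => 2 * ‖Z θ‖) = (2 : ℝ) • fun θ => ‖Z θ‖ := rfl
    rw [e, eLpNorm_const_smul, eLpNorm_norm, ENNReal.ofReal_mul zero_le_two,
      Real.enorm_of_nonneg zero_le_two]
    gcongr
  · have := hφ.nonneg
    rw [Real.norm_of_nonneg (by positivity), abs_of_nonneg (show 0 ≤ 2 * ‖Z θ‖ by positivity)]
    exact le_of_eq (by ring)

/-- A majorant of the values of the Nemytskij operator that is uniform in time. -/
theorem exists_memLp_bound (hφ : IsNemytskijKernel μ T P S τ σ C g φ) {Z : Θ → E}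
    (hZ : MemLp Z P μ) : ∃ b : Θ → ℝ, MemLp b τ μ ∧ ∀ᵐ θ ∂μ, ∀ t, ‖φ t (Z θ) θ‖ ≤ b θ := by
  refine ⟨_, hφ.memLp_zero.add (hφ.memLp_abs_growth hZ), ?_⟩
  filter_upwards [hφ.norm_sub_le, hφ.continuous] with θ hθ hc t
  have hbdd : BddAbove (range fun t => ‖φ t 0 θ‖) :=
    (isCompact_range (by fun_prop : Continuous fun t => ‖φ t 0 θ‖)).bddAbove
  have h1 : ‖φ t 0 θ‖ ≤ ⨆ t, ‖φ t 0 θ‖ := le_ciSup hbdd t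
  have h2 := hθ t (Z θ) 0
  rw [sub_zero] at h2
  have h3 := mul_le_mul_of_nonneg_right (hφ.growth_mono θ (le_refl ‖Z θ‖)
    (show ‖(0 : E)‖ ≤ ‖Z θ‖ by simp)) (norm_nonneg (Z θ))
  have h4 : ‖φ t (Z θ) θ‖ ≤ ‖φ t (Z θ) θ - φ t 0 θ‖ + ‖φ t 0 θ‖ := by
    simpa using norm_add_le (φ t (Z θ) θ - φ t 0 θ) (φ t 0 θ)
  simp only [Pi.add_apply]
  linarith

theorem memLp_comp (hφ : IsNemytskijKernel μ T P S τ σ C g φ) (t : Icc (0 : ℝ) T)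
    {Z : Θ → E} (hZ : MemLp Z P μ) : MemLp (fun θ => φ t (Z θ) θ) τ μ := by
  obtain ⟨b, hb, hbound⟩ := hφ.exists_memLp_bound hZ
  refine hb.of_le (hφ.aestronglyMeasurable_comp t hZ.1) ?_
  filter_upwards [hbound] with θ hθ
  exact (hθ t).trans (le_abs_self _)

/-- The Nemytskij operator `L^P → L^τ` at a fixed time. -/
noncomputable def slice (hφ : IsNemytskijKernel μ T P S τ σ C g φ) (t : Icc (0 : ℝ) T)
    (Z : Lp E P μ) : Lp G τ μ :=
  (hφ.memLp_comp t (Lp.memLp Z)).toLp _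

theorem coeFn_slice (hφ : IsNemytskijKernel μ T P S τ σ C g φ) (t : Icc (0 : ℝ) T)
    (Z : Lp E P μ) : hφ.slice t Z =ᵐ[μ] fun θ => φ t (Z θ) θ :=
  MemLp.coeFn_toLp _

variable [hP : Fact (1 ≤ P)]

theorem norm_slice_sub_le (hφ : IsNemytskijKernel μ T P S τ σ C g φ) (t : Icc (0 : ℝ) T)
    {Z Z' : Lp E P μ} {r : ℝ} (hZ : ‖Z‖ ≤ r) (hZ' : ‖Z'‖ ≤ r) :
    ‖hφ.slice t Z - hφ.slice t Z'‖ ≤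
      2 * (C * (r + r) ^ σ + (eLpNorm g S μ).toReal) * ‖Z - Z'‖ := by
  have hr : 0 ≤ r := (norm_nonneg _).trans hZ
  have hbound : ∀ {Y : Lp E P μ}, ‖Y‖ ≤ r → eLpNorm Y P μ ≤ ENNReal.ofReal r := fun {Y} hY => by
    rw [← ENNReal.ofReal_toReal (Lp.eLpNorm_ne_top Y), ← Lp.norm_def]
    exact ENNReal.ofReal_le_ofReal hY
  have hC := hφ.nonneg
  have hN : eLpNorm (⇑Z - ⇑Z') P μ ≤ ENNReal.ofReal ‖Z - Z'‖ := by
    rw [Lp.norm_def, ENNReal.ofReal_toReal (Lp.eLpNorm_ne_top _)]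
    exact (eLpNorm_congr_ae (Lp.coeFn_sub Z Z')).ge
  have h := hφ.eLpNorm_sub_le hP.out t hr hr (Lp.aestronglyMeasurable Z)
    (Lp.aestronglyMeasurable Z') (hbound hZ) (hbound hZ') hN
  rw [slice, slice, ← MemLp.toLp_sub, Lp.norm_toLp]
  exact ENNReal.toReal_le_of_le_ofReal (by positivity) h

variable [hτ : Fact (1 ≤ τ)]

theorem continuous_slice_comp (hφ : IsNemytskijKernel μ T P S τ σ C g φ)
    (Z : C(Icc (0 : ℝ) T, Lp E P μ)) : Continuous fun t => hφ.slice t (Z t) := by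
  rw [continuous_iff_continuousAt]
  intro t
  have hZn : ∀ s, ‖Z s‖ ≤ ‖Z‖ := fun s => Z.norm_coe_le_norm s
  -- vary the state first, the explicit time second
  have h1 : Tendsto (fun s => hφ.slice s (Z s) - hφ.slice s (Z t)) (𝓝 t) (𝓝 0) := by
    refine squeeze_zero_norm (fun s => hφ.norm_slice_sub_le s (hZn s) (hZn t)) ?_
    have : Tendsto (fun s => ‖Z s - Z t‖) (𝓝 t) (𝓝 ‖Z t - Z t‖) :=
      ((Z.continuous.sub continuous_const).norm).tendsto t
    simpa using this.const_mul (2 * (C * (‖Z‖ + ‖Z‖) ^ σ + (eLpNorm g S μ).toReal))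
  have h2 : Tendsto (fun s => hφ.slice s (Z t)) (𝓝 t) (𝓝 (hφ.slice t (Z t))) := by
    obtain ⟨b, hb, hbound⟩ := hφ.exists_memLp_bound (Lp.memLp (Z t))
    unfold slice
    rw [Lp.tendsto_Lp_iff_tendsto_eLpNorm'']
    refine tendsto_eLpNorm_zero_of_dominated (b := fun θ => b θ + b θ)
      (zero_lt_one.trans_le hτ.out).ne' hφ.ne_top
      (fun s => (hφ.aestronglyMeasurable_comp s (Lp.aestronglyMeasurable _)).sub
        (hφ.aestronglyMeasurable_comp t (Lp.aestronglyMeasurable _))) (hb.add hb)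
      (fun s => ?_) ?_
    · filter_upwards [hbound] with θ hθ
      exact (_root_.norm_sub_le _ _).trans (add_le_add (hθ s) (hθ t))
    · filter_upwards [hφ.continuous] with θ hθ
      have hc : Continuous fun s => φ s (Z t θ) θ - φ t (Z t θ) θ :=
        (hθ.comp (by fun_prop : Continuous fun s => (s, Z t θ))).sub continuous_const
      simpa using hc.tendsto t
  simpa [ContinuousAt] using h1.add h2

/-- The Nemytskij operator on continuous curves. -/
noncomputable def operator (hφ : IsNemytskijKernel μ T P S τ σ C g φ)
    (Z : C(Icc (0 : ℝ) T, Lp E P μ)) : C(Icc (0 : ℝ) T, Lp G τ μ) :=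
  ⟨fun t => hφ.slice t (Z t), hφ.continuous_slice_comp Z⟩

theorem coeFn_operator (hφ : IsNemytskijKernel μ T P S τ σ C g φ)
    (Z : C(Icc (0 : ℝ) T, Lp E P μ)) (t : Icc (0 : ℝ) T) :
    hφ.operator Z t =ᵐ[μ] fun θ => φ t (Z t θ) θ :=
  hφ.coeFn_slice t (Z t)

theorem continuous_operator (hφ : IsNemytskijKernel μ T P S τ σ C g φ) :
    Continuous hφ.operator := by
  rw [continuous_iff_continuousAt]
  intro Z
  have hC := hφ.nonneg
  set r := ‖Z‖ + 1 with hr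
  set K := 2 * (C * (r + r) ^ σ + (eLpNorm g S μ).toReal) with hK
  have hK0 : 0 ≤ K := by positivity
  rw [ContinuousAt, tendsto_iff_norm_sub_tendsto_zero]
  refine squeeze_zero' (g := fun Y => K * ‖Y - Z‖) (Eventually.of_forall fun _ => norm_nonneg _)
    ?_ ?_
  · filter_upwards [Metric.ball_mem_nhds Z one_pos] with Y hY
    have hYr : ‖Y‖ ≤ r := by
      have h1 : ‖Y - Z‖ < 1 := by rwa [mem_ball_iff_norm] at hY
      have h2 : ‖Y‖ ≤ ‖Y - Z‖ + ‖Z‖ := by simpa using norm_add_le (Y - Z) Z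
      linarith
    rw [ContinuousMap.norm_le _ (by positivity)]
    intro t
    refine (hφ.norm_slice_sub_le t ((Y.norm_coe_le_norm t).trans hYr)
      ((Z.norm_coe_le_norm t).trans (by simp [hr]))).trans ?_
    exact mul_le_mul_of_nonneg_left ((Y - Z).norm_coe_le_norm t) hK0
  · have : Tendsto (fun Y => K * ‖Y - Z‖) (𝓝 Z) (𝓝 (K * ‖Z - Z‖)) :=
      (continuous_const.mul (continuous_id.sub continuous_const).norm).tendsto Z
    simpa using this

end IsNemytskijKernel

end Nemytskij

end

/-! ### Differentiability of Nemytskij operators -/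

section

theorem hasFDerivAt_of_norm_sub_le_sq {V W : Type*} [NormedAddCommGroup V] [NormedSpace ℝ V]
    [NormedAddCommGroup W] [NormedSpace ℝ W] {f : V → W} {L : V →L[ℝ] W} {x : V} {K : ℝ}
    (h : ∀ v, ‖v‖ ≤ 1 → ‖f (x + v) - f x - L v‖ ≤ K * ‖v‖ ^ 2) : HasFDerivAt f L x := by
  rw [hasFDerivAt_iff_isLittleO_nhds_zero]
  refine Asymptotics.IsBigO.trans_isLittleO (g := fun v : V => ‖v‖ ^ 2)
    (Asymptotics.IsBigO.of_bound K ?_) ?_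
  · filter_upwards [Metric.closedBall_mem_nhds (0 : V) one_pos] with v hv
    rw [norm_pow, norm_norm]
    exact h v (by simpa using hv)
  · exact (Asymptotics.isLittleO_norm_pow_id one_lt_two)

section Apply

variable {I V W : Type*} [TopologicalSpace I] [CompactSpace I] [NormedAddCommGroup V]
  [NormedSpace ℝ V] [NormedAddCommGroup W] [NormedSpace ℝ W]

/-- Pointwise application of a continuous curve of operators to a continuous curve of vectors. -/
noncomputable def applyCurve : C(I, V →L[ℝ] W) →L[ℝ] C(I, V) →L[ℝ] C(I, W) :=
  LinearMap.mkContinuous₂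
    (LinearMap.mk₂ ℝ (fun (D : C(I, V →L[ℝ] W)) (ζ : C(I, V)) =>
      (⟨fun t => D t (ζ t), D.continuous.clm_apply ζ.continuous⟩ : C(I, W)))
      (fun _ _ _ => by ext; simp) (fun _ _ _ => by ext; simp)
      (fun _ _ _ => by ext; simp) (fun _ _ _ => by ext; simp)) 1 fun D ζ => by
    rw [ContinuousMap.norm_le _ (by positivity), one_mul]
    intro t
    refine ((D t).le_opNorm _).trans ?_
    have h1 := D.norm_coe_le_norm t
    have h2 := ζ.norm_coe_le_norm t
    gcongr

theorem applyCurve_apply (D : C(I, V →L[ℝ] W)) (ζ : C(I, V)) (t : I) :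
    applyCurve D ζ t = D t (ζ t) := rfl

/-- Bochner integration of continuous curves against a finite measure. -/
noncomputable def integralCLM [MeasurableSpace I] [OpensMeasurableSpace I]
    [SecondCountableTopology I] [TopologicalSpace.PseudoMetrizableSpace I] [CompleteSpace W]
    (ν : Measure I) [IsFiniteMeasure ν] : C(I, W) →L[ℝ] W :=
  have hint : ∀ f : C(I, W), Integrable f ν := fun f =>
    (integrable_const ‖f‖).mono' f.continuous.aestronglyMeasurable
      (Eventually.of_forall fun t => f.norm_coe_le_norm t)
  LinearMap.mkContinuous
    { toFun := fun f => ∫ t, f t ∂ν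
      map_add' := fun f g => integral_add (hint f) (hint g)
      map_smul' := fun c f => integral_smul c f } (ν.real univ) fun f => by
    refine (norm_integral_le_of_norm_le_const (C := ‖f‖)
      (Eventually.of_forall fun t => f.norm_coe_le_norm t)).trans (le_of_eq ?_)
    rw [mul_comm]

theorem integralCLM_apply [MeasurableSpace I] [OpensMeasurableSpace I]
    [SecondCountableTopology I] [TopologicalSpace.PseudoMetrizableSpace I] [CompleteSpace W]
    (ν : Measure I) [IsFiniteMeasure ν] (f : C(I, W)) : integralCLM ν f = ∫ t, f t ∂ν := rfl

end Apply

namespace IsNemytskijKernel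

variable {Θ : Type*} [MeasurableSpace Θ] {μ : Measure Θ}
  {E : Type*} [NormedAddCommGroup E] [NormedSpace ℝ E]
  {P S₀ S τ : ℝ≥0∞} {σ₀ C₀ σ C T : ℝ} {g₀ g : Θ → ℝ} {φ : Icc (0 : ℝ) T → E → Θ → ℝ}
  [ENNReal.HolderTriple S₀ P 1] [ENNReal.HolderTriple S P τ] [ENNReal.HolderTriple τ P 1]
  [hP : Fact (1 ≤ P)] [hτ : Fact (1 ≤ τ)]

/-- Multiplication by a function of class `L^τ` with values in the dual, as an operator from `L^P`
to `L¹`. -/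
noncomputable def multiplication (μ : Measure Θ) (E : Type*) [NormedAddCommGroup E]
    [NormedSpace ℝ E] (τ P : ℝ≥0∞) [ENNReal.HolderTriple τ P 1] [Fact (1 ≤ P)] [Fact (1 ≤ τ)] :
    Lp (E →L[ℝ] ℝ) τ μ →L[ℝ] Lp E P μ →L[ℝ] Lp ℝ 1 μ :=
  (ContinuousLinearMap.id ℝ (E →L[ℝ] ℝ)).holderL μ τ P 1

theorem coeFn_multiplication (D : Lp (E →L[ℝ] ℝ) τ μ) (ζ : Lp E P μ) :
    multiplication μ E τ P D ζ =ᵐ[μ] fun θ => D θ (ζ θ) :=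
  ContinuousLinearMap.coeFn_holder _ D ζ

/-- The curve of multiplication operators attached to the derivative of `φ` along a curve `Z`. -/
noncomputable def derivOperator
    (hD : IsNemytskijKernel μ T P S τ σ C g
      fun t x θ => fderiv ℝ (fun z => φ t z θ) x)
    (Z : C(Icc (0 : ℝ) T, Lp E P μ)) : C(Icc (0 : ℝ) T, Lp E P μ →L[ℝ] Lp ℝ 1 μ) :=
  (multiplication μ E τ P).compLeftContinuous ℝ (Icc (0 : ℝ) T) (hD.operator Z)

theorem continuous_derivOperator
    (hD : IsNemytskijKernel μ T P S τ σ C g fun t x θ => fderiv ℝ (fun z => φ t z θ) x) :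
    Continuous hD.derivOperator :=
  ((multiplication μ E τ P).compLeftContinuous ℝ (Icc (0 : ℝ) T)).continuous.comp
    hD.continuous_operator

theorem coeFn_derivOperator
    (hD : IsNemytskijKernel μ T P S τ σ C g fun t x θ => fderiv ℝ (fun z => φ t z θ) x)
    (Z : C(Icc (0 : ℝ) T, Lp E P μ)) (t : Icc (0 : ℝ) T) (ζ : Lp E P μ) :
    hD.derivOperator Z t ζ =ᵐ[μ] fun θ => fderiv ℝ (fun z => φ t z θ) (Z t θ) (ζ θ) := by
  have h : hD.derivOperator Z t ζ = multiplication μ E τ P (hD.operator Z t) ζ := rfl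
  rw [h]
  filter_upwards [coeFn_multiplication (hD.operator Z t) ζ, hD.coeFn_operator Z t] with θ h1 h2
  rw [h1, h2]

/-- The remainder of the linearization of a Nemytskij operator at a fixed time is quadratic: the
mean value inequality bounds it pointwise by a product to which Hölder's inequality applies
twice. -/
theorem norm_slice_sub_sub_le (hφ : IsNemytskijKernel μ T P S₀ 1 σ₀ C₀ g₀ φ)
    (hdiff : ∀ᵐ θ ∂μ, ∀ t, Differentiable ℝ fun x => φ t x θ)
    (hD : IsNemytskijKernel μ T P S τ σ C g fun t x θ => fderiv ℝ (fun z => φ t z θ) x)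
    (t : Icc (0 : ℝ) T) (Z ζ : Lp E P μ) :
    ‖hφ.slice t (Z + ζ) - hφ.slice t Z - multiplication μ E τ P (hD.slice t Z) ζ‖ ≤
      2 * (C * (‖Z‖ + ‖ζ‖) ^ σ + (eLpNorm g S μ).toReal) * ‖ζ‖ ^ 2 := by
  have hC := hD.nonneg
  set R := hφ.slice t (Z + ζ) - hφ.slice t Z - multiplication μ E τ P (hD.slice t Z) ζ with hR
  have hRae : R =ᵐ[μ] fun θ => φ t (Z θ + ζ θ) θ - φ t (Z θ) θ -
      fderiv ℝ (fun z => φ t z θ) (Z θ) (ζ θ) := by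
    filter_upwards [Lp.coeFn_sub (hφ.slice t (Z + ζ) - hφ.slice t Z)
      (multiplication μ E τ P (hD.slice t Z) ζ), Lp.coeFn_sub (hφ.slice t (Z + ζ)) (hφ.slice t Z),
      hφ.coeFn_slice t (Z + ζ), hφ.coeFn_slice t Z, hD.coeFn_slice t Z,
      coeFn_multiplication (hD.slice t Z) ζ, Lp.coeFn_add Z ζ] with θ h1 h2 h3 h4 h5 h6 h7
    rw [hR, h1, Pi.sub_apply, h2, Pi.sub_apply, h3, h4, h6, h5, h7, Pi.add_apply]
  have hbound : ∀ Y : Lp E P μ, eLpNorm Y P μ = ENNReal.ofReal ‖Y‖ := fun Y => by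
    rw [Lp.norm_def, ENNReal.ofReal_toReal (Lp.eLpNorm_ne_top Y)]
  have hZm := (Lp.aestronglyMeasurable Z).norm
  have hζm := (Lp.aestronglyMeasurable ζ).norm
  set w : Θ → ℝ := fun θ => ‖Z θ‖ + ‖ζ θ‖ with hw
  set Ψ : Θ → ℝ := fun θ => (C * |w θ| ^ σ + |g θ|) * (2 * ‖ζ θ‖) with hΨ
  have hΨm : AEStronglyMeasurable Ψ μ := by
    refine AEStronglyMeasurable.mul (.add (.const_mul ?_ C) ?_) (hζm.const_mul 2)
    · exact (Real.continuous_rpow_const hD.exponent_pos.le).comp_aestronglyMeasurable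
        (continuous_abs.comp_aestronglyMeasurable (hZm.add hζm))
    · exact continuous_abs.comp_aestronglyMeasurable hD.memLp.1
  have hΨle : eLpNorm Ψ τ μ ≤
      ENNReal.ofReal ((C * (‖Z‖ + ‖ζ‖) ^ σ + (eLpNorm g S μ).toReal) * (2 * ‖ζ‖)) := by
    refine eLpNorm_growth_le (w := w) (g := g) (ψ := fun θ => 2 * ‖ζ θ‖) hD.one_le hD.mul_eq
      hD.exponent_pos hD.nonneg (by positivity) ENNReal.toReal_nonneg (hZm.add hζm) hD.memLp.1
      (hζm.const_mul 2) ?_ (ENNReal.ofReal_toReal hD.memLp.2.ne).ge ?_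
      (Eventually.of_forall fun θ => ?_)
    · refine (MeasureTheory.eLpNorm_add_le hZm hζm hP.out).trans (le_of_eq ?_)
      rw [eLpNorm_norm, eLpNorm_norm, hbound, hbound, ENNReal.ofReal_add] <;> positivity
    · have e : (fun θ => 2 * ‖ζ θ‖) = (2 : ℝ) • fun θ => ‖ζ θ‖ := rfl
      rw [e, eLpNorm_const_smul, eLpNorm_norm, ENNReal.ofReal_mul zero_le_two,
        Real.enorm_of_nonneg zero_le_two, hbound]
    · simp only [hΨ]
      rw [Real.norm_of_nonneg (by positivity), abs_of_nonneg (show 0 ≤ 2 * ‖ζ θ‖ by positivity)]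
  have hRle : eLpNorm R 1 μ ≤ eLpNorm (Ψ • fun θ => ‖ζ θ‖) 1 μ := by
    refine eLpNorm_mono_ae ?_
    filter_upwards [hRae, hdiff, hD.norm_sub_le] with θ hθ hd hlip
    have hmv := (convex_segment (Z θ) (Z θ + ζ θ)).norm_image_sub_le_of_norm_hasFDerivWithin_le'
      (f := fun z => φ t z θ) (f' := fderiv ℝ fun z => φ t z θ)
      (φ := fderiv ℝ (fun z => φ t z θ) (Z θ)) (C := Ψ θ)
      (fun z _ => (hd t z).hasFDerivAt.hasFDerivWithinAt) (fun z hz => ?_)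
      (left_mem_segment ℝ _ _) (right_mem_segment ℝ _ _)
    · rw [add_sub_cancel_left] at hmv
      rw [hθ, Pi.smul_apply', smul_eq_mul, norm_mul, norm_norm]
      exact hmv.trans (mul_le_mul_of_nonneg_right (Real.le_norm_self _) (norm_nonneg _))
    · have hzd : ‖z - Z θ‖ ≤ ‖ζ θ‖ := by
        simpa using norm_sub_le_of_mem_segment hz
      have hzn : ‖z‖ ≤ w θ := by
        have : ‖z‖ ≤ ‖Z θ‖ + ‖z - Z θ‖ := by simpa using norm_add_le (Z θ) (z - Z θ)
        simp only [hw]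
        linarith
      have h1 := hD.growth_mono θ hzn (show ‖Z θ‖ ≤ w θ by simp [hw])
      calc ‖fderiv ℝ (fun z => φ t z θ) z - fderiv ℝ (fun z => φ t z θ) (Z θ)‖
          ≤ 2 * (C * |w θ| ^ σ + |g θ|) * ‖z - Z θ‖ :=
            (hlip t z (Z θ)).trans (mul_le_mul_of_nonneg_right h1 (norm_nonneg _))
        _ ≤ 2 * (C * |w θ| ^ σ + |g θ|) * ‖ζ θ‖ := by gcongr
        _ = Ψ θ := by simp only [hΨ]; ring
  have hH := eLpNorm_smul_le_mul_eLpNorm (p := τ) (q := P) (r := 1) hζm hΨm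
  rw [Lp.norm_def]
  refine ENNReal.toReal_le_of_le_ofReal (by positivity) ((hRle.trans hH).trans ?_)
  rw [eLpNorm_norm, hbound]
  refine (mul_le_mul' hΨle le_rfl).trans (le_of_eq ?_)
  rw [← ENNReal.ofReal_mul (by positivity)]
  congr 1
  ring

theorem hasFDerivAt_operator (hφ : IsNemytskijKernel μ T P S₀ 1 σ₀ C₀ g₀ φ)
    (hdiff : ∀ᵐ θ ∂μ, ∀ t, Differentiable ℝ fun x => φ t x θ)
    (hD : IsNemytskijKernel μ T P S τ σ C g fun t x θ => fderiv ℝ (fun z => φ t z θ) x)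
    (Z : C(Icc (0 : ℝ) T, Lp E P μ)) :
    HasFDerivAt hφ.operator (applyCurve (hD.derivOperator Z)) Z := by
  have hC := hD.nonneg
  have hσ := hD.exponent_pos
  refine hasFDerivAt_of_norm_sub_le_sq
    (K := 2 * (C * (‖Z‖ + 1) ^ σ + (eLpNorm g S μ).toReal)) fun ζ hζ => ?_
  rw [ContinuousMap.norm_le _ (by positivity)]
  intro t
  have h1 := Z.norm_coe_le_norm t
  have h2 := ζ.norm_coe_le_norm t
  have e : (hφ.operator (Z + ζ) - hφ.operator Z - applyCurve (hD.derivOperator Z) ζ) t =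
      hφ.slice t (Z t + ζ t) - hφ.slice t (Z t) - multiplication μ E τ P (hD.slice t (Z t)) (ζ t) :=
    rfl
  rw [e]
  refine (hφ.norm_slice_sub_sub_le hdiff hD t (Z t) (ζ t)).trans ?_
  have h3 : ‖Z t‖ + ‖ζ t‖ ≤ ‖Z‖ + 1 := by linarith
  gcongr

end IsNemytskijKernel

end

/-! ### Linear dependence of linearized trajectories on the direction -/

section

section Solutions

variable {E W : Type*} [NormedAddCommGroup E] [NormedSpace ℝ E] [NormedAddCommGroup W]
  [NormedSpace ℝ W] {T : ℝ}

theorem IsCaratheodorySolution.congr_ae {g g' : ℝ → E → E} {z₀ : E} {z : ℝ → E}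
    (hz : IsCaratheodorySolution T g z₀ z)
    (h : ∀ᵐ s ∂volume.restrict (Icc (0 : ℝ) T), g s (z s) = g' s (z s)) :
    IsCaratheodorySolution T g' z₀ z := by
  refine ⟨hz.1, Integrable.congr hz.2.1 h, fun t ht => ?_⟩
  rw [hz.2.2 t ht]
  congr 1
  refine intervalIntegral.integral_congr_ae ?_
  exact ae_interval_of_ae_Icc h ⟨le_rfl, ht.1.trans ht.2⟩ ht

variable {f : E → W →L[ℝ] E} {u v v' : ℝ → W} {x y y' : ℝ → E}

theorem IsCaratheodorySolution.lin_congr (hy : IsLinSolution f T u v x y)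
    (h : v =ᵐ[volume.restrict (Icc (0 : ℝ) T)] v') : IsLinSolution f T u v' x y :=
  IsCaratheodorySolution.congr_ae hy (by filter_upwards [h] with s hs; rw [hs])

theorem IsCaratheodorySolution.lin_add (hy : IsLinSolution f T u v x y)
    (hy' : IsLinSolution f T u v' x y') :
    IsLinSolution f T u (fun s => v s + v' s) x (fun s => y s + y' s) := by
  have e : (fun s => fderiv ℝ f (x s) (y s + y' s) (u s) + f (x s) (v s + v' s)) =
      fun s => (fderiv ℝ f (x s) (y s) (u s) + f (x s) (v s)) +
        (fderiv ℝ f (x s) (y' s) (u s) + f (x s) (v' s)) := by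
    ext s
    simp only [map_add, add_apply]
    abel
  refine ⟨hy.1.add hy'.1, ?_, fun t ht => ?_⟩
  · simp only [e]
    exact hy.2.1.add hy'.2.1
  · have h0 : (0 : ℝ) ∈ Icc 0 T := ⟨le_rfl, ht.1.trans ht.2⟩
    have := intervalIntegral.integral_add (intervalIntegrable_of_integrableOn_Icc hy.2.1 h0 ht)
      (intervalIntegrable_of_integrableOn_Icc hy'.2.1 h0 ht)
    simp only [e]
    rw [this, hy.2.2 t ht, hy'.2.2 t ht]
    abel

theorem IsCaratheodorySolution.lin_smul (c : ℝ) (hy : IsLinSolution f T u v x y) :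
    IsLinSolution f T u (fun s => c • v s) x (fun s => c • y s) := by
  have e : (fun s => fderiv ℝ f (x s) (c • y s) (u s) + f (x s) (c • v s)) =
      fun s => c • (fderiv ℝ f (x s) (y s) (u s) + f (x s) (v s)) := by
    ext s
    simp only [map_smul, smul_apply, smul_add]
  refine ⟨hy.1.const_smul c, ?_, fun t ht => ?_⟩
  · simp only [e]
    exact hy.2.1.smul c
  · simp only [e]
    rw [intervalIntegral.integral_smul, hy.2.2 t ht]
    simp

end Solutions

/-! ### The ensemble of controlled systems -/

variable {Θ : Type*} {n k : ℕ}

/-- The field `x ↦ (w ↦ ∑ i, w_i F_i(x, θ))` with values in the operators on control vectors. -/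
noncomputable def controlField
    (F : Fin k → EuclideanSpace ℝ (Fin n) → Θ → EuclideanSpace ℝ (Fin n)) (θ : Θ)
    (x : EuclideanSpace ℝ (Fin n)) : EuclideanSpace ℝ (Fin k) →L[ℝ] EuclideanSpace ℝ (Fin n) :=
  ∑ i, ContinuousLinearMap.smulRightL ℝ (EuclideanSpace ℝ (Fin k)) (EuclideanSpace ℝ (Fin n))
    (EuclideanSpace.proj i) (F i x θ)

variable {F : Fin k → EuclideanSpace ℝ (Fin n) → Θ → EuclideanSpace ℝ (Fin n)} {θ : Θ} {K : ℝ}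

theorem velocity_eq (w : EuclideanSpace ℝ (Fin k)) (x : EuclideanSpace ℝ (Fin n)) :
    velocity F θ w x = controlField F θ x w := by
  simp [velocity, controlField, sum_apply]

theorem norm_sum_smulRightL_le {G : Type*} [NormedAddCommGroup G] [NormedSpace ℝ G] {M : ℝ}
    {z : Fin k → G} (hz : ∀ i, ‖z i‖ ≤ M) :
    ‖∑ i, ContinuousLinearMap.smulRightL ℝ (EuclideanSpace ℝ (Fin k)) G
      (EuclideanSpace.proj i) (z i)‖ ≤ k * M := by
  refine (norm_sum_le _ _).trans ?_
  have : ∀ i ∈ Finset.univ, ‖ContinuousLinearMap.smulRightL ℝ (EuclideanSpace ℝ (Fin k)) G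
      (EuclideanSpace.proj i) (z i)‖ ≤ M := fun i _ => by
    refine ContinuousLinearMap.opNorm_le_bound _ ((norm_nonneg _).trans (hz i)) fun w => ?_
    rw [ContinuousLinearMap.smulRightL_apply_apply, ContinuousLinearMap.smulRight_apply, norm_smul,
      mul_comm]
    exact mul_le_mul (hz i) (PiLp.norm_apply_le w i) (norm_nonneg _)
      ((norm_nonneg _).trans (hz i))
  exact (Finset.sum_le_sum this).trans (by simp)

/-- A parameter for which the fields are differentiable and the control field is regular. -/
structure IsRegularParameter
    (F : Fin k → EuclideanSpace ℝ (Fin n) → Θ → EuclideanSpace ℝ (Fin n)) (K : ℝ) (θ : Θ) :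
    Prop where
  differentiable : ∀ i, Differentiable ℝ fun x => F i x θ
  isRegularField : IsRegularField (controlField F θ) K

theorem hasFDerivAt_controlField (hd : ∀ i, Differentiable ℝ fun x => F i x θ)
    (x : EuclideanSpace ℝ (Fin n)) :
    HasFDerivAt (controlField F θ)
      (∑ i, (ContinuousLinearMap.smulRightL ℝ (EuclideanSpace ℝ (Fin k))
        (EuclideanSpace ℝ (Fin n)) (EuclideanSpace.proj i)).comp
          (fderiv ℝ (fun z => F i z θ) x)) x :=
  HasFDerivAt.fun_sum fun i _ =>
    (ContinuousLinearMap.hasFDerivAt _).comp x (hd i x).hasFDerivAt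

theorem linVelocity_eq (hd : ∀ i, Differentiable ℝ fun x => F i x θ)
    (w v : EuclideanSpace ℝ (Fin k)) (x y : EuclideanSpace ℝ (Fin n)) :
    linVelocity F θ w v x y = fderiv ℝ (controlField F θ) x y w + controlField F θ x v := by
  rw [(hasFDerivAt_controlField hd x).fderiv]
  simp [linVelocity, controlField, sum_apply]

/-- The hypotheses on the fields make almost every parameter regular, with a common constant. -/
theorem exists_isRegularParameter [MeasurableSpace Θ] {μ : Measure Θ} (hF : FieldsLipschitz μ F)
    (hF' : FieldsC1 μ F) : ∃ K, 0 ≤ K ∧ ∀ᵐ θ ∂μ, IsRegularParameter F K θ := by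
  obtain ⟨L, hL, hlip⟩ := hF.lipschitz
  obtain ⟨C, hC, hbdd⟩ := hF.bounded
  obtain ⟨L', hL', hlip'⟩ := hF'.lipschitz
  refine ⟨k * (L + C + L'), by positivity, ?_⟩
  filter_upwards [hlip, hbdd, hlip', hF'.contDiff] with θ h1 h2 h3 h4
  have hd : ∀ i, Differentiable ℝ fun x => F i x θ := fun i =>
    (h4 i).differentiable one_ne_zero
  have hk : (0 : ℝ) ≤ k := Nat.cast_nonneg k
  refine ⟨hd, ⟨by positivity, ?_, fun x y => ?_,
    fun x => (hasFDerivAt_controlField hd x).differentiableAt, fun x y => ?_⟩⟩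
  · refine (norm_sum_smulRightL_le h2).trans ?_
    gcongr
    linarith
  · unfold controlField
    simp only [← Finset.sum_sub_distrib, ← map_sub]
    refine (norm_sum_smulRightL_le fun i => h1 i x y).trans ?_
    rw [mul_assoc]
    gcongr
    linarith
  · rw [(hasFDerivAt_controlField hd x).fderiv, (hasFDerivAt_controlField hd y).fderiv,
      ← Finset.sum_sub_distrib]
    refine ContinuousLinearMap.opNorm_le_bound _ (by positivity) fun z => ?_
    simp only [← ContinuousLinearMap.comp_sub, sum_apply, ContinuousLinearMap.comp_apply]
    refine (norm_sum_smulRightL_le (M := L' * ‖x - y‖ * ‖z‖) fun i => ?_).trans ?_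
    · exact ContinuousLinearMap.le_of_opNorm_le _ (h3 i x y) z
    · have : L' * ‖x - y‖ * ‖z‖ ≤ (L + C + L') * ‖x - y‖ * ‖z‖ := by
        gcongr
        linarith
      calc (k : ℝ) * (L' * ‖x - y‖ * ‖z‖) ≤ k * ((L + C + L') * ‖x - y‖ * ‖z‖) := by gcongr
        _ = k * (L + C + L') * ‖x - y‖ * ‖z‖ := by ring

section Trajectories

variable {x₀ : Θ → EuclideanSpace ℝ (Fin n)} {T : ℝ} {u v : ℝ → EuclideanSpace ℝ (Fin k)}
  {x y : ℝ → EuclideanSpace ℝ (Fin n)}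

theorem isTrajectory_iff : IsTrajectory F x₀ T u θ x ↔
    IsStateSolution (controlField F θ) T u (x₀ θ) x := by
  simp only [IsTrajectory, velocity_eq]

theorem isLinTrajectory_iff (hθ : IsRegularParameter F K θ) :
    IsLinTrajectory F x₀ T u v θ y ↔
    IsLinSolution (controlField F θ) T u v (trajectory F x₀ T u θ) y := by
  simp only [IsLinTrajectory, linVelocity_eq hθ.differentiable]

namespace IsRegularParameter

theorem isStateSolution (hθ : IsRegularParameter F K θ) (hT : 0 ≤ T)
    (hu : IntegrableOn u (Icc 0 T)) :
    IsStateSolution (controlField F θ) T u (x₀ θ) (trajectory F x₀ T u θ) := by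
  have h : ∃ x, IsTrajectory F x₀ T u θ x := by
    simp only [isTrajectory_iff]
    exact (hθ.isRegularField.isLipschitzRHS_state hu).exists_solution hT _
  rw [← isTrajectory_iff, trajectory, dif_pos h]
  exact h.choose_spec

theorem eqOn_trajectory (hθ : IsRegularParameter F K θ) (hT : 0 ≤ T)
    (hu : IntegrableOn u (Icc 0 T)) (hx : IsStateSolution (controlField F θ) T u (x₀ θ) x) :
    EqOn x (trajectory F x₀ T u θ) (Icc 0 T) :=
  (hθ.isRegularField.isLipschitzRHS_state hu).eqOn_of_solution hx (hθ.isStateSolution hT hu)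

theorem isLinSolution (hθ : IsRegularParameter F K θ) (hT : 0 ≤ T)
    (hu : IntegrableOn u (Icc 0 T)) (hv : IntegrableOn v (Icc 0 T)) :
    IsLinSolution (controlField F θ) T u v (trajectory F x₀ T u θ)
      (linTrajectory F x₀ T u v θ) := by
  have h : ∃ y, IsLinTrajectory F x₀ T u v θ y := by
    simp only [isLinTrajectory_iff hθ]
    exact (hθ.isRegularField.isLipschitzRHS_lin hu hv
      (hθ.isStateSolution hT hu).1).exists_solution hT _
  rw [← isLinTrajectory_iff hθ, linTrajectory, dif_pos h]
  exact h.choose_spec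

theorem eqOn_linTrajectory (hθ : IsRegularParameter F K θ) (hT : 0 ≤ T)
    (hu : IntegrableOn u (Icc 0 T)) (hv : IntegrableOn v (Icc 0 T))
    (hy : IsLinSolution (controlField F θ) T u v (trajectory F x₀ T u θ) y) :
    EqOn y (linTrajectory F x₀ T u v θ) (Icc 0 T) :=
  (hθ.isRegularField.isLipschitzRHS_lin hu hv (hθ.isStateSolution hT hu).1).eqOn_of_solution hy
    (hθ.isLinSolution hT hu hv)

end IsRegularParameter

/-! ### Measurable dependence on the parameter -/

/-- Picard iterates of the whole ensemble, as functions of time and of the parameter. The integral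
over `[0, t]` is written as the integral over `(0, T]` of a truncated integrand, so that joint
measurability follows from that of integrals depending on a parameter. -/
noncomputable def picardIterate
    (F : Fin k → EuclideanSpace ℝ (Fin n) → Θ → EuclideanSpace ℝ (Fin n))
    (x₀ : Θ → EuclideanSpace ℝ (Fin n)) (T : ℝ) (u : ℝ → EuclideanSpace ℝ (Fin k)) :
    ℕ → ℝ × Θ → EuclideanSpace ℝ (Fin n)
  | 0 => fun p => x₀ p.2
  | m + 1 => fun p => x₀ p.2 + ∫ s in Ioc 0 T,
      {r | r ≤ p.1}.indicator (fun r => velocity F p.2 (u r) (picardIterate F x₀ T u m (r, p.2))) s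

theorem measurable_picardIterate [MeasurableSpace Θ]
    (hF : ∀ i, Measurable fun p : EuclideanSpace ℝ (Fin n) × Θ => F i p.1 p.2)
    (hx₀ : Measurable x₀) (hu : Measurable u) (m : ℕ) : Measurable (picardIterate F x₀ T u m) := by
  induction m with
  | zero => exact hx₀.comp measurable_snd
  | succ m ih =>
    refine (hx₀.comp measurable_snd).add (StronglyMeasurable.measurable ?_)
    refine StronglyMeasurable.integral_prod_right (f := fun (p : ℝ × Θ) s => {r | r ≤ p.1}.indicator
      (fun r => velocity F p.2 (u r) (picardIterate F x₀ T u m (r, p.2))) s) ?_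
    refine Measurable.stronglyMeasurable ?_
    have hset : MeasurableSet {z : (ℝ × Θ) × ℝ | z.2 ≤ z.1.1} :=
      measurableSet_le measurable_snd measurable_fst.fst
    have hv : Measurable fun z : (ℝ × Θ) × ℝ =>
        velocity F z.1.2 (u z.2) (picardIterate F x₀ T u m (z.2, z.1.2)) := by
      unfold velocity
      refine Finset.measurable_fun_sum _ fun i _ => ?_
      have h1 : Measurable fun z : (ℝ × Θ) × ℝ => u z.2 i :=
        (EuclideanSpace.proj (𝕜 := ℝ) i).continuous.measurable.comp (hu.comp measurable_snd)
      have h2 : Measurable fun z : (ℝ × Θ) × ℝ =>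
          F i (picardIterate F x₀ T u m (z.2, z.1.2)) z.1.2 :=
        (hF i).comp ((ih.comp (measurable_snd.prodMk measurable_fst.snd)).prodMk
          measurable_fst.snd)
      exact h1.smul h2
    have e : (Function.uncurry fun (p : ℝ × Θ) s => {r | r ≤ p.1}.indicator
        (fun r => velocity F p.2 (u r) (picardIterate F x₀ T u m (r, p.2))) s) =
        {z : (ℝ × Θ) × ℝ | z.2 ≤ z.1.1}.indicator fun z =>
          velocity F z.1.2 (u z.2) (picardIterate F x₀ T u m (z.2, z.1.2)) := by
      ext1 z
      simp [Function.uncurry, indicator]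
    rw [e]
    exact hv.indicator hset

theorem picardIterate_succ_apply {t : ℝ} (ht : t ∈ Icc 0 T) (m : ℕ) :
    picardIterate F x₀ T u (m + 1) (t, θ) = x₀ θ + ∫ s in (0 : ℝ)..t,
      controlField F θ (picardIterate F x₀ T u m (s, θ)) (u s) := by
  have hset : Iic t ∩ Ioc 0 T = Ioc 0 t := by
    ext r
    simp only [mem_inter_iff, mem_Iic, mem_Ioc]
    exact ⟨fun h => ⟨h.2.1, h.1⟩, fun h => ⟨h.2, h.1, h.2.trans ht.2⟩⟩
  have e : {r : ℝ | r ≤ t} = Iic t := rfl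
  simp only [picardIterate]
  rw [e, integral_indicator measurableSet_Iic,
    Measure.restrict_restrict measurableSet_Iic, hset, intervalIntegral.integral_of_le ht.1]
  simp only [velocity_eq]

/-- Picard iterates converge to the trajectory: the error, measured against `weight`, is halved at
each step. -/
theorem IsRegularParameter.tendsto_picardIterate [MeasurableSpace Θ]
    (hθ : IsRegularParameter F K θ)
    (hF : ∀ i, Measurable fun p : EuclideanSpace ℝ (Fin n) × Θ => F i p.1 p.2)
    (hx₀ : Measurable x₀) (hu : Measurable u) (hui : IntegrableOn u (Icc 0 T))
    (hx : IsStateSolution (controlField F θ) T u (x₀ θ) x) {t : ℝ} (ht : t ∈ Icc 0 T) :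
    Tendsto (fun m => picardIterate F x₀ T u m (t, θ)) atTop (𝓝 (x t)) := by
  have hT : 0 ≤ T := ht.1.trans ht.2
  have h0 : (0 : ℝ) ∈ Icc 0 T := ⟨le_rfl, hT⟩
  have hrhs := hθ.isRegularField.isLipschitzRHS_state hui
  obtain ⟨D, hD⟩ := isCompact_Icc.exists_bound_of_continuousOn
    (hx.1.sub (continuousOn_const (c := x₀ θ)))
  have hD0 : 0 ≤ D := (norm_nonneg _).trans (hD 0 h0)
  set β : ℝ → ℝ := fun s => K * ‖u s‖ with hβ
  have hest : ∀ m : ℕ, ∀ t ∈ Icc 0 T,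
      ‖picardIterate F x₀ T u m (t, θ) - x t‖ ≤ D * (1 / 2) ^ m * weight β t := by
    intro m
    induction m with
    | zero =>
      intro t ht
      have h1 := hD t ht
      have h2 := one_le_weight hrhs.nonneg ht
      rw [Pi.sub_apply, norm_sub_rev] at h1
      simp only [picardIterate, pow_zero, mul_one]
      nlinarith
    | succ m ih =>
      intro t ht
      set p : ℝ → EuclideanSpace ℝ (Fin n) := fun s => picardIterate F x₀ T u m (s, θ) with hp
      have hpm : Measurable p := (measurable_picardIterate hF hx₀ hu m).comp measurable_prodMk_right
      set d := fun s => controlField F θ (p s) (u s) - controlField F θ (x s) (u s) with hd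
      have hdle : ∀ s ∈ Icc 0 T, ‖d s‖ ≤ β s * ‖p s - x s‖ := fun s hs =>
        hrhs.norm_sub_le s hs _ _
      have hvm : AEStronglyMeasurable (fun s => controlField F θ (p s) (u s))
          (volume.restrict (Icc 0 T)) :=
        (ContinuousLinearMap.id ℝ _).aestronglyMeasurable_comp₂
          (hθ.isRegularField.continuous.comp_aestronglyMeasurable hpm.aestronglyMeasurable)
          hu.aestronglyMeasurable
      have hdi : IntegrableOn d (Icc 0 T) := by
        refine Integrable.mono'
          ((integrableOn_mul_weight hT hrhs.integrableOn_const).const_mul (D * (1 / 2) ^ m))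
          (hvm.sub hx.2.1.aestronglyMeasurable) ?_
        filter_upwards [ae_restrict_mem measurableSet_Icc] with s hs
        refine (hdle s hs).trans ?_
        have := mul_le_mul_of_nonneg_left (ih s hs) (hrhs.nonneg s hs)
        linarith
      have hvi : IntegrableOn (fun s => controlField F θ (p s) (u s)) (Icc 0 T) := by
        have := hdi.add hx.2.1
        refine this.congr (Eventually.of_forall fun s => ?_)
        simp [hd]
      have hpx : ContinuousOn (weight β) (Icc 0 T) := continuousOn_weight hT hrhs.integrableOn_const
      rw [picardIterate_succ_apply ht, hx.2.2 t ht, add_sub_add_left_eq_sub,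
        ← intervalIntegral.integral_sub (intervalIntegrable_of_integrableOn_Icc hvi h0 ht)
        (intervalIntegrable_of_integrableOn_Icc hx.2.1 h0 ht)]
      have h1 : ‖∫ s in (0 : ℝ)..t, d s‖ ≤
          ∫ s in (0 : ℝ)..t, β s * (D * (1 / 2) ^ m * weight β s) := by
        refine intervalIntegral.norm_integral_le_of_norm_le ht.1
          (Eventually.of_forall fun s hs => ?_) (intervalIntegrable_of_integrableOn_Icc
            (hrhs.integrableOn_const.mul_continuousOn
              (continuousOn_const.mul hpx) isCompact_Icc) h0 ht)
        have hs' : s ∈ Icc 0 T := ⟨hs.1.le, hs.2.trans ht.2⟩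
        exact (hdle s hs').trans (mul_le_mul_of_nonneg_left (ih s hs') (hrhs.nonneg s hs'))
      have h2 := integral_mul_le_weight (M := D * (1 / 2) ^ m)
        (φ := fun s => D * (1 / 2) ^ m * weight β s) hrhs.integrableOn_const hrhs.nonneg
        (fun s _ => le_rfl)
        (fun s _ => mul_nonneg (by positivity) (weight_pos β s).le) ht
      refine (h1.trans h2).trans ?_
      have hpos : 0 ≤ D * (1 / 2) ^ m := by positivity
      rw [pow_succ]
      nlinarith
  rw [tendsto_iff_norm_sub_tendsto_zero]
  refine squeeze_zero (fun _ => norm_nonneg _) (fun m => hest m t ht) ?_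
  have := ((tendsto_pow_atTop_nhds_zero_of_lt_one (by norm_num : (0 : ℝ) ≤ 1 / 2)
    (by norm_num)).const_mul D).mul_const (weight β t)
  simpa using this

end Trajectories

end

/-! ### Dominated curves in `Lᵖ` -/

section

section Curves

variable {Θ I E : Type*} [MeasurableSpace Θ] {μ : Measure Θ} [TopologicalSpace I]
  [NormedAddCommGroup E] {P : ℝ≥0∞} {b : Θ → ℝ}

/-- A family of functions of the parameter, continuous in time for almost every parameter and
dominated by an `L^P` function. -/
structure IsDominatedCurve (μ : Measure Θ) (P : ℝ≥0∞) (b : Θ → ℝ) (φ : I → Θ → E) : Prop where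
  memLp : MemLp b P μ
  aestronglyMeasurable : ∀ t, AEStronglyMeasurable (φ t) μ
  continuous : ∀ᵐ θ ∂μ, Continuous fun t => φ t θ
  norm_le : ∀ᵐ θ ∂μ, ∀ t, ‖φ t θ‖ ≤ b θ

namespace IsDominatedCurve

variable {φ : I → Θ → E}

theorem memLp_apply (hφ : IsDominatedCurve μ P b φ) (t : I) : MemLp (φ t) P μ :=
  hφ.memLp.of_le (hφ.aestronglyMeasurable t) (by
    filter_upwards [hφ.norm_le] with θ hθ using (hθ t).trans (Real.le_norm_self _))

theorem continuous_toLp [FirstCountableTopology I] [Fact (1 ≤ P)] (hP : P ≠ ∞)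
    (hφ : IsDominatedCurve μ P b φ) : Continuous fun t => (hφ.memLp_apply t).toLp (φ t) := by
  rw [continuous_iff_continuousAt]
  intro t
  rw [ContinuousAt, Lp.tendsto_Lp_iff_tendsto_eLpNorm'']
  refine tendsto_eLpNorm_zero_of_dominated (b := fun θ => b θ + b θ)
    (zero_lt_one.trans_le Fact.out).ne' hP
    (fun s => (hφ.aestronglyMeasurable s).sub (hφ.aestronglyMeasurable t)) (hφ.memLp.add hφ.memLp)
    (fun s => ?_) ?_
  · filter_upwards [hφ.norm_le] with θ hθ
    exact (norm_sub_le _ _).trans (add_le_add (hθ s) (hθ t))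
  · filter_upwards [hφ.continuous] with θ hθ
    have hc : Continuous fun s => φ s θ - φ t θ := hθ.sub continuous_const
    simpa using hc.tendsto t

/-- The continuous curve in `L^P` defined by a dominated family. -/
noncomputable def toCurve [FirstCountableTopology I] [Fact (1 ≤ P)] (hP : P ≠ ∞)
    (hφ : IsDominatedCurve μ P b φ) : C(I, Lp E P μ) :=
  ⟨_, hφ.continuous_toLp hP⟩

theorem coeFn_toCurve [FirstCountableTopology I] [Fact (1 ≤ P)] (hP : P ≠ ∞)
    (hφ : IsDominatedCurve μ P b φ) (t : I) : hφ.toCurve hP t =ᵐ[μ] φ t :=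
  (hφ.memLp_apply t).coeFn_toLp

end IsDominatedCurve

theorem norm_curve_le [CompactSpace I] [Fact (1 ≤ P)] (hb : MemLp b P μ) {M : ℝ} (hM : 0 ≤ M)
    {Z : C(I, Lp E P μ)} (h : ∀ t, ∀ᵐ θ ∂μ, ‖Z t θ‖ ≤ M * b θ) : ‖Z‖ ≤ M * ‖hb.toLp b‖ := by
  rw [ContinuousMap.norm_le _ (by positivity)]
  intro t
  refine Lp.norm_le_mul_norm_of_ae_le_mul ?_
  filter_upwards [h t, hb.coeFn_toLp] with θ h1 h2
  rw [h2]
  exact h1.trans (mul_le_mul_of_nonneg_left (Real.le_norm_self _) hM)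

/-- Dominated convergence for curves: almost sure convergence to zero, uniformly in time, of a
dominated sequence of curves gives uniform convergence in `L^P`. -/
theorem tendsto_norm_curve_zero [CompactSpace I] [Nonempty I] [Fact (1 ≤ P)] (hP : P ≠ ∞)
    (hb : MemLp b P μ) {Z : ℕ → C(I, Lp E P μ)} {ζ : ℕ → I → Θ → E} (hZ : ∀ m t, Z m t =ᵐ[μ] ζ m t)
    (hζb : ∀ m t, ∀ᵐ θ ∂μ, ‖ζ m t θ‖ ≤ b θ)
    (hζ : ∀ᵐ θ ∂μ, ∀ ε > 0, ∀ᶠ m in atTop, ∀ t, ‖ζ m t θ‖ ≤ ε) :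
    Tendsto (fun m => ‖Z m‖) atTop (𝓝 0) := by
  -- evaluate at times where the norms are attained, so that no supremum has to be measurable
  have hmax : ∀ m, ∃ t, ‖Z m‖ ≤ ‖Z m t‖ := fun m => by
    obtain ⟨t, ht⟩ := (Z m).continuous.norm.exists_forall_ge_of_hasCompactSupport
      (HasCompactSupport.of_compactSpace _)
    exact ⟨t, (ContinuousMap.norm_le _ (norm_nonneg _)).2 ht⟩
  choose t ht using hmax
  have hlim : Tendsto (fun m => eLpNorm (ζ m (t m)) P μ) atTop (𝓝 0) := by
    refine tendsto_eLpNorm_zero_of_dominated (b := b) (zero_lt_one.trans_le Fact.out).ne' hP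
      (fun m => (Lp.aestronglyMeasurable (Z m (t m))).congr (hZ m (t m))) hb
      (fun m => hζb m (t m)) ?_
    filter_upwards [hζ] with θ hθ
    rw [tendsto_zero_iff_norm_tendsto_zero, Metric.tendsto_atTop']
    intro ε hε
    obtain ⟨N, hN⟩ := eventually_atTop.1 (hθ (ε / 2) (half_pos hε))
    refine ⟨N, fun m hm => ?_⟩
    rw [dist_zero_right, norm_norm]
    exact (hN m hm.le (t m)).trans_lt (half_lt_self hε)
  refine squeeze_zero (fun _ => norm_nonneg _) ht ?_
  have e : ∀ m, ‖Z m (t m)‖ = (eLpNorm (ζ m (t m)) P μ).toReal := fun m => by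
    rw [Lp.norm_def, eLpNorm_congr_ae (hZ m (t m))]
  simp only [e]
  simpa [Function.comp_def] using (ENNReal.tendsto_toReal ENNReal.zero_ne_top).comp hlim

end Curves

/-! ### Trajectories driven by controls in `L^q` -/

variable {Θ : Type*} {n k : ℕ} {T K : ℝ} {q : ℝ≥0∞}
  {F : Fin k → EuclideanSpace ℝ (Fin n) → Θ → EuclideanSpace ℝ (Fin n)}
  {x₀ : Θ → EuclideanSpace ℝ (Fin n)} {θ : Θ}

/-- An upper bound for the Grönwall factor of controls of `L^q` norm at most `ρ`. -/
noncomputable def controlGrowth (K T : ℝ) (q : ℝ≥0∞) (ρ : ℝ) : ℝ :=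
  growth K (T ^ holderExponent q * ρ)

/-- The constant in the quadratic remainder estimate for the input-to-state map. -/
noncomputable def remainderConst (K T : ℝ) (q : ℝ≥0∞) (ρ : ℝ) : ℝ :=
  (K ^ 3 * controlGrowth K T q ρ ^ 4 * (T ^ holderExponent q * ρ) +
    K ^ 2 * controlGrowth K T q ρ ^ 2) * controlGrowth K T q ρ * (T ^ holderExponent q) ^ 2

theorem integral_norm_control_le_of_norm_le [Fact (1 ≤ q)] (hT : 0 ≤ T) {ρ : ℝ} {u : Control k q T}
    (hu : ‖u‖ ≤ ρ) : ∫ s in (0 : ℝ)..T, ‖u s‖ ≤ T ^ holderExponent q * ρ :=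
  (integral_norm_control_le hT u).trans (mul_le_mul_of_nonneg_left hu (Real.rpow_nonneg hT _))

theorem controlGrowth_pos (K T : ℝ) (q : ℝ≥0∞) (ρ : ℝ) : 0 < controlGrowth K T q ρ :=
  growth_pos _ _

theorem remainderConst_nonneg (hK : 0 ≤ K) (hT : 0 ≤ T) {ρ : ℝ} (hρ : 0 ≤ ρ) :
    0 ≤ remainderConst K T q ρ := by
  have := controlGrowth_pos K T q ρ
  unfold remainderConst
  positivity

variable [Fact (1 ≤ q)]

namespace IsRegularParameter

/-- The bound is in fact linear in `1 + |x₀|`; the square serves to have the same majorant as for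
the remainder of the linearization. -/
theorem norm_trajectory_le (hθ : IsRegularParameter F K θ) (hT : 0 ≤ T) {ρ : ℝ}
    {u : Control k q T} (hu : ‖u‖ ≤ ρ) {t : ℝ} (ht : t ∈ Icc 0 T) :
    ‖trajectory F x₀ T u θ t‖ ≤ controlGrowth K T q ρ * (1 + ‖x₀ θ‖) ^ 2 := by
  have h := hθ.isRegularField.norm_state_le (integrableOn_control u)
    (integral_norm_control_le_of_norm_le hT hu)
    (hθ.isStateSolution (x₀ := x₀) hT (integrableOn_control u)) ht
  have hG := controlGrowth_pos K T q ρ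
  have h1 : 1 + ‖x₀ θ‖ ≤ (1 + ‖x₀ θ‖) ^ 2 := by nlinarith [norm_nonneg (x₀ θ)]
  have h2 : (1 + ‖x₀ θ‖) * controlGrowth K T q ρ ≤ (1 + ‖x₀ θ‖) ^ 2 * controlGrowth K T q ρ := by
    gcongr
  have h3 : 1 + ‖trajectory F x₀ T u θ t‖ ≤ (1 + ‖x₀ θ‖) * controlGrowth K T q ρ := h
  linarith

theorem norm_linTrajectory_le (hθ : IsRegularParameter F K θ) (hT : 0 ≤ T) {ρ : ℝ}
    {u : Control k q T} (hu : ‖u‖ ≤ ρ) (v : Control k q T) {t : ℝ} (ht : t ∈ Icc 0 T) :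
    ‖linTrajectory F x₀ T u v θ t‖ ≤
      (K * controlGrowth K T q ρ ^ 2 * T ^ holderExponent q * ‖v‖) * (1 + ‖x₀ θ‖) ^ 2 := by
  have h := hθ.isRegularField.norm_lin_le (integrableOn_control u) (integrableOn_control v)
    (integral_norm_control_le_of_norm_le hT hu) (integral_norm_control_le hT v)
    (hθ.isStateSolution (x₀ := x₀) hT (integrableOn_control u))
    (hθ.isLinSolution hT (integrableOn_control u) (integrableOn_control v)) ht
  have hG := controlGrowth_pos K T q ρ
  have hK := hθ.isRegularField.nonneg
  have h1 : 1 + ‖x₀ θ‖ ≤ (1 + ‖x₀ θ‖) ^ 2 := by nlinarith [norm_nonneg (x₀ θ)]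
  refine h.trans ?_
  calc K * ((1 + ‖x₀ θ‖) * controlGrowth K T q ρ) * (T ^ holderExponent q * ‖v‖) *
        controlGrowth K T q ρ
      = (K * controlGrowth K T q ρ ^ 2 * T ^ holderExponent q * ‖v‖) * (1 + ‖x₀ θ‖) := by ring
    _ ≤ _ := by
      have := Real.rpow_nonneg hT (holderExponent q)
      gcongr

theorem norm_trajectory_add_sub_sub_le (hθ : IsRegularParameter F K θ) (hT : 0 ≤ T) {ρ : ℝ}
    {u v : Control k q T} (hu : ‖u‖ ≤ ρ) (huv : ‖u + v‖ ≤ ρ) {t : ℝ} (ht : t ∈ Icc 0 T) :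
    ‖trajectory F x₀ T (u + v : Control k q T) θ t - trajectory F x₀ T u θ t -
      linTrajectory F x₀ T u v θ t‖ ≤
      (remainderConst K T q ρ * ‖v‖ ^ 2) * (1 + ‖x₀ θ‖) ^ 2 := by
  have hui := integrableOn_control u
  have hvi := integrableOn_control v
  have huvi := integrableOn_control (u + v)
  have hae : v =ᵐ[volume.restrict (Icc (0 : ℝ) T)] fun s => (u + v : Control k q T) s - u s := by
    filter_upwards [Lp.coeFn_add u v] with s hs
    rw [hs, Pi.add_apply, add_sub_cancel_left]
  have hV : ∫ s in (0 : ℝ)..T, ‖(u + v : Control k q T) s - u s‖ ≤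
      T ^ holderExponent q * ‖v‖ := by
    refine le_trans (le_of_eq ?_) (integral_norm_control_le hT v)
    refine intervalIntegral.integral_congr_ae ?_
    filter_upwards [ae_interval_of_ae_Icc hae ⟨le_rfl, hT⟩ ⟨hT, le_rfl⟩] with s hs hs'
    rw [hs hs']
  have h := hθ.isRegularField.norm_state_sub_state_sub_lin_le hui huvi
    (integral_norm_control_le_of_norm_le hT hu) (integral_norm_control_le_of_norm_le hT huv) hV
    (hθ.isStateSolution (x₀ := x₀) hT hui) (hθ.isStateSolution (x₀ := x₀) hT huvi)
    ((hθ.isLinSolution hT hui hvi).lin_congr hae) ht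
  refine h.trans (le_of_eq ?_)
  unfold remainderConst controlGrowth
  ring

theorem linTrajectory_add (hθ : IsRegularParameter F K θ) (hT : 0 ≤ T) (u v v' : Control k q T)
    {t : ℝ} (ht : t ∈ Icc 0 T) : linTrajectory F x₀ T u (v + v' : Control k q T) θ t =
      linTrajectory F x₀ T u v θ t + linTrajectory F x₀ T u v' θ t := by
  have hui := integrableOn_control u
  have h1 := (hθ.isLinSolution (x₀ := x₀) hT hui (integrableOn_control v)).lin_add
    (hθ.isLinSolution (x₀ := x₀) hT hui (integrableOn_control v'))
  refine (hθ.eqOn_linTrajectory hT hui (integrableOn_control (v + v')) (h1.lin_congr ?_) ht).symm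
  filter_upwards [Lp.coeFn_add v v'] with s hs
  rw [hs, Pi.add_apply]

theorem linTrajectory_smul (hθ : IsRegularParameter F K θ) (hT : 0 ≤ T) (u : Control k q T)
    (c : ℝ) (v : Control k q T) {t : ℝ} (ht : t ∈ Icc 0 T) :
    linTrajectory F x₀ T u (c • v : Control k q T) θ t = c • linTrajectory F x₀ T u v θ t := by
  have hui := integrableOn_control u
  have h1 := (hθ.isLinSolution (x₀ := x₀) hT hui (integrableOn_control v)).lin_smul c
  refine (hθ.eqOn_linTrajectory hT hui (integrableOn_control (c • v)) (h1.lin_congr ?_) ht).symm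
  filter_upwards [Lp.coeFn_smul c v] with s hs
  rw [hs, Pi.smul_apply]

section Weak

variable {u : ℕ → Control k q T} {uInf : Control k q T}

/-- Trajectories depend on the control continuously from the weak topology to the uniform one. -/
theorem eventually_norm_trajectory_sub_le (hθ : IsRegularParameter F K θ) (hT : 0 ≤ T)
    (hq : 1 < q) (hq_top : q < ∞)
    (h : Tendsto (fun m => toWeakSpace ℝ (Control k q T) (u m)) atTop
      (𝓝 (toWeakSpace ℝ (Control k q T) uInf))) {ε : ℝ} (hε : 0 < ε) :
    ∀ᶠ m in atTop, ∀ t ∈ Icc 0 T,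
      ‖trajectory F x₀ T (u m) θ t - trajectory F x₀ T uInf θ t‖ ≤ ε := by
  obtain ⟨ρ, hρ⟩ := exists_norm_le_of_tendsto_weak h
  have hx := hθ.isStateSolution (x₀ := x₀) hT (integrableOn_control uInf)
  have hG := controlGrowth_pos K T q ρ
  have hA : ContinuousOn (fun s => controlField F θ (trajectory F x₀ T uInf θ s)) (Icc 0 T) :=
    hθ.isRegularField.continuous.comp_continuousOn hx.1
  filter_upwards [eventually_norm_integral_sub_le_of_weak hq hq_top h hA
    (div_pos hε hG)] with m hm t ht
  have := hθ.isRegularField.norm_state_sub_state_le (integrableOn_control (u m))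
    (integral_norm_control_le_of_norm_le hT (hρ m)) hx
    (hθ.isStateSolution (x₀ := x₀) hT (integrableOn_control (u m))) hm ht
  rwa [show growth K (T ^ holderExponent q * ρ) = controlGrowth K T q ρ from rfl,
    div_mul_cancel₀ _ hG.ne'] at this

/-- Along a weakly convergent sequence of controls the linearized trajectories converge uniformly
in time and in the direction `v` of the unit ball. -/
theorem eventually_norm_linTrajectory_sub_le (hθ : IsRegularParameter F K θ) (hT : 0 ≤ T)
    (hq : 1 < q) (hq_top : q < ∞)
    (h : Tendsto (fun m => toWeakSpace ℝ (Control k q T) (u m)) atTop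
      (𝓝 (toWeakSpace ℝ (Control k q T) uInf))) {ε : ℝ} (hε : 0 < ε) :
    ∀ᶠ m in atTop, ∀ v : Control k q T, ‖v‖ ≤ 1 → ∀ t ∈ Icc 0 T,
      ‖linTrajectory F x₀ T (u m) v θ t - linTrajectory F x₀ T uInf v θ t‖ ≤ ε := by
  obtain ⟨ρ', hρ'⟩ := exists_norm_le_of_tendsto_weak h
  set ρ := max ρ' ‖uInf‖ with hρ_def
  have hρ : ∀ m, ‖u m‖ ≤ ρ := fun m => (hρ' m).trans (le_max_left _ _)
  have hρI : ‖uInf‖ ≤ ρ := le_max_right _ _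
  have hρ0 : 0 ≤ ρ := (norm_nonneg _).trans hρI
  have hK := hθ.isRegularField.nonneg
  have hx := hθ.isStateSolution (x₀ := x₀) hT (integrableOn_control uInf)
  set c := T ^ holderExponent q with hc
  have hc0 : 0 ≤ c := Real.rpow_nonneg hT _
  set Γ := growth K (c * ρ) with hΓ
  have hG : 0 < Γ := growth_pos _ _
  set a₁ := K * ((1 + ‖x₀ θ‖) * Γ) * (c * 1) * (K * (c * ρ) * Γ + 1) with ha₁
  set a₂ := K * (K * ((1 + ‖x₀ θ‖) * Γ) * (c * ρ) * Γ + 1) * (c * 1) with ha₂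
  have ha₁0 : 0 ≤ a₁ := by positivity
  have ha₂0 : 0 ≤ a₂ := by positivity
  set δ := ε / ((2 * a₁ + a₂) * Γ + 1) with hδ_def
  have hδ : 0 < δ := by positivity
  have hA : ContinuousOn
      (fun s => (fderiv ℝ (controlField F θ) (trajectory F x₀ T uInf θ s)).flip) (Icc 0 T) :=
    (ContinuousLinearMap.flipₗᵢ ℝ _ _ _).continuous.comp_continuousOn
      (hθ.isRegularField.continuous_fderiv.comp_continuousOn hx.1)
  filter_upwards [eventually_norm_integral_sub_le_of_weak hq hq_top h hA hδ,
    hθ.eventually_norm_trajectory_sub_le (x₀ := x₀) hT hq hq_top h hδ] with m hm hm' v hv t ht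
  have hum := integrableOn_control (u m)
  have hui := integrableOn_control uInf
  have hvi := integrableOn_control v
  have := hθ.isRegularField.norm_lin_sub_lin_le hui hum hvi
    (integral_norm_control_le_of_norm_le hT hρI) (integral_norm_control_le_of_norm_le hT (hρ m))
    (integral_norm_control_le_of_norm_le hT hv) hx
    (hθ.isStateSolution (x₀ := x₀) hT hum)
    (hθ.isLinSolution hT hui hvi) (hθ.isLinSolution hT hum hvi) hm' hm ht
  refine this.trans ?_
  calc (2 * δ * a₁ + K * δ * (c * 1) * (K * ((1 + ‖x₀ θ‖) * Γ) * (c * ρ) * Γ + 1)) * Γ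
      = δ * ((2 * a₁ + a₂) * Γ) := by rw [ha₂]; ring
    _ ≤ δ * ((2 * a₁ + a₂) * Γ + 1) := by
        refine mul_le_mul_of_nonneg_left ?_ hδ.le
        linarith
    _ = ε := by
        rw [hδ_def]
        have : (2 * a₁ + a₂) * Γ + 1 ≠ 0 := by positivity
        field_simp

end Weak

end IsRegularParameter

end

/-! ### The input-to-state map of the ensemble -/

section

variable {Θ : Type*} [MeasurableSpace Θ] {μ : Measure Θ} {n k : ℕ} {T K : ℝ} {q P : ℝ≥0∞}
  {F : Fin k → EuclideanSpace ℝ (Fin n) → Θ → EuclideanSpace ℝ (Fin n)}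
  {x₀ : Θ → EuclideanSpace ℝ (Fin n)}

/-- Standing properties of an ensemble of control systems: almost every parameter is regular with
the same constant, and `(1 + |x₀|)²`, which dominates all trajectories and remainders, belongs to
`L^P`. -/
structure IsRegularEnsemble (μ : Measure Θ) (T K : ℝ) (P : ℝ≥0∞)
    (F : Fin k → EuclideanSpace ℝ (Fin n) → Θ → EuclideanSpace ℝ (Fin n))
    (x₀ : Θ → EuclideanSpace ℝ (Fin n)) : Prop where
  nonneg_time : 0 ≤ T
  nonneg_const : 0 ≤ K
  ne_top : P ≠ ∞
  measurable : ∀ i, Measurable fun p : EuclideanSpace ℝ (Fin n) × Θ => F i p.1 p.2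
  ae_regular : ∀ᵐ θ ∂μ, IsRegularParameter F K θ
  aestronglyMeasurable : AEStronglyMeasurable x₀ μ
  memLp : MemLp (fun θ => (1 + ‖x₀ θ‖) ^ 2) P μ

namespace IsRegularEnsemble

variable [Fact (1 ≤ q)]

theorem aestronglyMeasurable_trajectory (h : IsRegularEnsemble μ T K P F x₀) (u : Control k q T)
    {t : ℝ} (ht : t ∈ Icc 0 T) :
    AEStronglyMeasurable (fun θ => trajectory F x₀ T u θ t) μ := by
  set x₀' := h.aestronglyMeasurable.mk x₀ with hx₀'
  have hm : Measurable x₀' := h.aestronglyMeasurable.stronglyMeasurable_mk.measurable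
  have hu : Measurable u := (Lp.stronglyMeasurable u).measurable
  refine aestronglyMeasurable_of_tendsto_ae atTop
    (f := fun m θ => picardIterate F x₀' T u m (t, θ)) (fun m => ?_) ?_
  · exact ((measurable_picardIterate h.measurable hm hu m).comp
      measurable_prodMk_left).aestronglyMeasurable
  · filter_upwards [h.ae_regular, h.aestronglyMeasurable.ae_eq_mk] with θ hθ hθ'
    refine hθ.tendsto_picardIterate h.measurable hm hu (integrableOn_control u) ?_ ht
    have := hθ.isStateSolution (x₀ := x₀) h.nonneg_time (integrableOn_control u)
    rwa [hθ'] at this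

/-- Linearized trajectories are pointwise limits of difference quotients of trajectories, hence
measurable in the parameter. -/
theorem aestronglyMeasurable_linTrajectory (h : IsRegularEnsemble μ T K P F x₀)
    (u v : Control k q T) {t : ℝ} (ht : t ∈ Icc 0 T) :
    AEStronglyMeasurable (fun θ => linTrajectory F x₀ T u v θ t) μ := by
  have hT := h.nonneg_time
  set ε : ℕ → ℝ := fun m => 1 / ((m : ℝ) + 1) with hε
  have hε0 : ∀ m, 0 < ε m := fun m => by positivity
  refine aestronglyMeasurable_of_tendsto_ae atTop (f := fun m θ => (ε m)⁻¹ •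
    (trajectory F x₀ T (u + ε m • v : Control k q T) θ t - trajectory F x₀ T u θ t))
    (fun m => ?_) ?_
  · exact ((h.aestronglyMeasurable_trajectory (u + ε m • v : Control k q T) ht).sub
      (h.aestronglyMeasurable_trajectory u ht)).const_smul (ε m)⁻¹
  · filter_upwards [h.ae_regular] with θ hθ
    set ρ := ‖u‖ + ‖v‖ with hρ
    rw [tendsto_iff_norm_sub_tendsto_zero]
    have hlim : Tendsto (fun m => ε m * (remainderConst K T q ρ * ‖v‖ ^ 2 * (1 + ‖x₀ θ‖) ^ 2)) atTop
        (𝓝 0) := by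
      have := (tendsto_one_div_add_atTop_nhds_zero_nat (𝕜 := ℝ)).mul_const
        (remainderConst K T q ρ * ‖v‖ ^ 2 * (1 + ‖x₀ θ‖) ^ 2)
      rwa [zero_mul] at this
    refine squeeze_zero (fun _ => norm_nonneg _) (fun m => ?_) hlim
    have hε1 : ε m ≤ 1 := by
      simp only [hε]
      rw [div_le_one (by positivity)]
      simp
    have hn : ‖u + ε m • v‖ ≤ ρ := by
      refine (norm_add_le _ _).trans ?_
      rw [norm_smul, Real.norm_of_nonneg (hε0 m).le]
      have := mul_le_mul_of_nonneg_right hε1 (norm_nonneg v)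
      linarith
    have h1 := hθ.norm_trajectory_add_sub_sub_le (x₀ := x₀) hT (u := u) (v := ε m • v)
      (show ‖u‖ ≤ ρ by simp [hρ]) hn ht
    rw [hθ.linTrajectory_smul hT u (ε m) v ht, norm_smul, Real.norm_of_nonneg (hε0 m).le] at h1
    have e : (ε m)⁻¹ • (trajectory F x₀ T (u + ε m • v : Control k q T) θ t -
        trajectory F x₀ T u θ t) - linTrajectory F x₀ T u v θ t =
        (ε m)⁻¹ • (trajectory F x₀ T (u + ε m • v : Control k q T) θ t -
        trajectory F x₀ T u θ t - ε m • linTrajectory F x₀ T u v θ t) := by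
      rw [smul_sub _ _ (ε m • _), inv_smul_smul₀ (hε0 m).ne']
    rw [e, norm_smul, norm_inv, Real.norm_of_nonneg (hε0 m).le, inv_mul_le_iff₀ (hε0 m)]
    refine h1.trans (le_of_eq ?_)
    ring

theorem isDominatedCurve_trajectory (h : IsRegularEnsemble μ T K P F x₀) (u : Control k q T) :
    IsDominatedCurve μ P (fun θ => controlGrowth K T q ‖u‖ * (1 + ‖x₀ θ‖) ^ 2)
      (fun (t : Icc (0 : ℝ) T) θ => trajectory F x₀ T u θ t) where
  memLp := h.memLp.const_mul _
  aestronglyMeasurable t := h.aestronglyMeasurable_trajectory u t.2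
  continuous := by
    filter_upwards [h.ae_regular] with θ hθ
    exact continuousOn_iff_continuous_domRestrict.1
      (hθ.isStateSolution (x₀ := x₀) h.nonneg_time (integrableOn_control u)).1
  norm_le := by
    filter_upwards [h.ae_regular] with θ hθ t
    exact hθ.norm_trajectory_le h.nonneg_time le_rfl t.2

theorem isDominatedCurve_linTrajectory (h : IsRegularEnsemble μ T K P F x₀)
    (u v : Control k q T) :
    IsDominatedCurve μ P (fun θ => (K * controlGrowth K T q ‖u‖ ^ 2 * T ^ holderExponent q * ‖v‖) *
      (1 + ‖x₀ θ‖) ^ 2) (fun (t : Icc (0 : ℝ) T) θ => linTrajectory F x₀ T u v θ t) where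
  memLp := h.memLp.const_mul _
  aestronglyMeasurable t := h.aestronglyMeasurable_linTrajectory u v t.2
  continuous := by
    filter_upwards [h.ae_regular] with θ hθ
    exact continuousOn_iff_continuous_domRestrict.1
      (hθ.isLinSolution (x₀ := x₀) h.nonneg_time (integrableOn_control u)
        (integrableOn_control v)).1
  norm_le := by
    filter_upwards [h.ae_regular] with θ hθ t
    exact hθ.norm_linTrajectory_le h.nonneg_time le_rfl v t.2

variable [Fact (1 ≤ P)]

/-- The input-to-state map `u ↦ X^u`. -/
noncomputable def inputState (h : IsRegularEnsemble μ T K P F x₀) (u : Control k q T) :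
    C(Icc (0 : ℝ) T, Lp (EuclideanSpace ℝ (Fin n)) P μ) :=
  (h.isDominatedCurve_trajectory u).toCurve h.ne_top

theorem coeFn_inputState (h : IsRegularEnsemble μ T K P F x₀) (u : Control k q T)
    (t : Icc (0 : ℝ) T) : h.inputState u t =ᵐ[μ] fun θ => trajectory F x₀ T u θ t :=
  (h.isDominatedCurve_trajectory u).coeFn_toCurve h.ne_top t

/-- The curve in `L^P` of linearized trajectories. -/
noncomputable def linCurve (h : IsRegularEnsemble μ T K P F x₀) (u v : Control k q T) :
    C(Icc (0 : ℝ) T, Lp (EuclideanSpace ℝ (Fin n)) P μ) :=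
  (h.isDominatedCurve_linTrajectory u v).toCurve h.ne_top

theorem coeFn_linCurve (h : IsRegularEnsemble μ T K P F x₀) (u v : Control k q T)
    (t : Icc (0 : ℝ) T) : h.linCurve u v t =ᵐ[μ] fun θ => linTrajectory F x₀ T u v θ t :=
  (h.isDominatedCurve_linTrajectory u v).coeFn_toCurve h.ne_top t

/-- The derivative `v ↦ y_{u,v}` of the input-to-state map. -/
noncomputable def inputStateDeriv (h : IsRegularEnsemble μ T K P F x₀) (u : Control k q T) :
    Control k q T →L[ℝ] C(Icc (0 : ℝ) T, Lp (EuclideanSpace ℝ (Fin n)) P μ) :=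
  LinearMap.mkContinuous
    { toFun := h.linCurve u
      map_add' := fun v v' => by
        ext1 t
        rw [ContinuousMap.add_apply]
        apply Lp.ext
        filter_upwards [h.ae_regular, h.coeFn_linCurve u (v + v') t, h.coeFn_linCurve u v t,
          h.coeFn_linCurve u v' t, Lp.coeFn_add (h.linCurve u v t) (h.linCurve u v' t)] with
          θ hθ h1 h2 h3 h4
        rw [h1, h4, Pi.add_apply, h2, h3, hθ.linTrajectory_add h.nonneg_time u v v' t.2]
      map_smul' := fun c v => by
        ext1 t
        rw [ContinuousMap.smul_apply, RingHom.id_apply]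
        apply Lp.ext
        filter_upwards [h.ae_regular, h.coeFn_linCurve u (c • v) t, h.coeFn_linCurve u v t,
          Lp.coeFn_smul c (h.linCurve u v t)] with θ hθ h1 h2 h3
        rw [h1, h3, Pi.smul_apply, h2, hθ.linTrajectory_smul h.nonneg_time u c v t.2] }
    (K * controlGrowth K T q ‖u‖ ^ 2 * T ^ holderExponent q * ‖h.memLp.toLp _‖) fun v => by
      have hK := h.nonneg_const
      have hc := Real.rpow_nonneg h.nonneg_time (holderExponent q)
      have hb : ∀ t, ∀ᵐ θ ∂μ, ‖h.linCurve u v t θ‖ ≤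
          (K * controlGrowth K T q ‖u‖ ^ 2 * T ^ holderExponent q * ‖v‖) * (1 + ‖x₀ θ‖) ^ 2 := by
        intro t
        filter_upwards [h.ae_regular, h.coeFn_linCurve u v t] with θ hθ h1
        rw [h1]
        exact hθ.norm_linTrajectory_le h.nonneg_time le_rfl v t.2
      refine (norm_curve_le h.memLp (by positivity) hb).trans (le_of_eq ?_)
      ring

theorem coeFn_inputStateDeriv (h : IsRegularEnsemble μ T K P F x₀) (u v : Control k q T)
    (t : Icc (0 : ℝ) T) :
    h.inputStateDeriv u v t =ᵐ[μ] fun θ => linTrajectory F x₀ T u v θ t :=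
  h.coeFn_linCurve u v t

theorem hasFDerivAt_inputState (h : IsRegularEnsemble μ T K P F x₀) (u : Control k q T) :
    HasFDerivAt h.inputState (h.inputStateDeriv u) u := by
  set ρ := ‖u‖ + 1 with hρ
  refine hasFDerivAt_of_norm_sub_le_sq
    (K := remainderConst K T q ρ * ‖h.memLp.toLp _‖) fun v hv => ?_
  have hC : 0 ≤ remainderConst K T q ρ :=
    remainderConst_nonneg h.nonneg_const h.nonneg_time (by positivity)
  have huv : ‖u + v‖ ≤ ρ := (norm_add_le _ _).trans (by rw [hρ]; gcongr)
  have hb : ∀ t, ∀ᵐ θ ∂μ, ‖(h.inputState (u + v) - h.inputState u - h.inputStateDeriv u v) t θ‖ ≤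
      (remainderConst K T q ρ * ‖v‖ ^ 2) * (1 + ‖x₀ θ‖) ^ 2 := by
    intro t
    rw [ContinuousMap.sub_apply, ContinuousMap.sub_apply]
    filter_upwards [h.ae_regular, h.coeFn_inputState (u + v) t, h.coeFn_inputState u t,
      h.coeFn_inputStateDeriv u v t,
      Lp.coeFn_sub (h.inputState (u + v) t - h.inputState u t) (h.inputStateDeriv u v t),
      Lp.coeFn_sub (h.inputState (u + v) t) (h.inputState u t)] with θ hθ h1 h2 h3 h4 h5
    rw [h4, Pi.sub_apply, h5, Pi.sub_apply, h1, h2, h3]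
    exact hθ.norm_trajectory_add_sub_sub_le h.nonneg_time (by simp [hρ]) huv t.2
  refine (norm_curve_le h.memLp (by positivity) hb).trans (le_of_eq ?_)
  ring

section Weak

variable {u : ℕ → Control k q T} {uInf : Control k q T}

theorem tendsto_inputState_of_weak (h : IsRegularEnsemble μ T K P F x₀) (hq : 1 < q)
    (hq_top : q < ∞) (hu : Tendsto (fun m => toWeakSpace ℝ (Control k q T) (u m)) atTop
      (𝓝 (toWeakSpace ℝ (Control k q T) uInf))) :
    Tendsto (fun m => h.inputState (u m)) atTop (𝓝 (h.inputState uInf)) := by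
  have hT := h.nonneg_time
  have : Nonempty (Icc (0 : ℝ) T) := ⟨⟨0, le_rfl, hT⟩⟩
  obtain ⟨ρ', hρ'⟩ := exists_norm_le_of_tendsto_weak hu
  set ρ := max ρ' ‖uInf‖ with hρ_def
  have hρ : ∀ m, ‖u m‖ ≤ ρ := fun m => (hρ' m).trans (le_max_left _ _)
  have hρI : ‖uInf‖ ≤ ρ := le_max_right _ _
  rw [tendsto_iff_norm_sub_tendsto_zero]
  refine tendsto_norm_curve_zero (b := fun θ => (controlGrowth K T q ρ + controlGrowth K T q ρ) *
    (1 + ‖x₀ θ‖) ^ 2) (ζ := fun m t θ => trajectory F x₀ T (u m) θ t - trajectory F x₀ T uInf θ t)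
    h.ne_top (h.memLp.const_mul _) (fun m t => ?_) (fun m t => ?_) ?_
  · rw [ContinuousMap.sub_apply]
    filter_upwards [h.coeFn_inputState (u m) t, h.coeFn_inputState uInf t,
      Lp.coeFn_sub (h.inputState (u m) t) (h.inputState uInf t)] with θ h1 h2 h3
    rw [h3, Pi.sub_apply, h1, h2]
  · filter_upwards [h.ae_regular] with θ hθ
    rw [add_mul]
    exact (norm_sub_le _ _).trans (add_le_add (hθ.norm_trajectory_le hT (hρ m) t.2)
      (hθ.norm_trajectory_le hT hρI t.2))
  · filter_upwards [h.ae_regular] with θ hθ ε hε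
    filter_upwards [hθ.eventually_norm_trajectory_sub_le (x₀ := x₀) hT hq hq_top hu hε] with m hm t
    exact hm t t.2

/-- The derivative of the input-to-state map is continuous from the weak topology of the controls
to the operator norm. -/
theorem tendsto_inputStateDeriv_of_weak (h : IsRegularEnsemble μ T K P F x₀) (hq : 1 < q)
    (hq_top : q < ∞) (hu : Tendsto (fun m => toWeakSpace ℝ (Control k q T) (u m)) atTop
      (𝓝 (toWeakSpace ℝ (Control k q T) uInf))) :
    Tendsto (fun m => h.inputStateDeriv (u m)) atTop (𝓝 (h.inputStateDeriv uInf)) := by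
  have hT := h.nonneg_time
  have hK := h.nonneg_const
  have hc := Real.rpow_nonneg h.nonneg_time (holderExponent q)
  have : Nonempty (Icc (0 : ℝ) T) := ⟨⟨0, le_rfl, hT⟩⟩
  obtain ⟨ρ', hρ'⟩ := exists_norm_le_of_tendsto_weak hu
  set ρ := max ρ' ‖uInf‖ with hρ_def
  have hρ : ∀ m, ‖u m‖ ≤ ρ := fun m => (hρ' m).trans (le_max_left _ _)
  have hρI : ‖uInf‖ ≤ ρ := le_max_right _ _
  -- test the operators on directions that nearly realize their norms
  have hv : ∀ m, ∃ v : Control k q T, ‖v‖ ≤ 1 ∧ ‖h.inputStateDeriv (u m) - h.inputStateDeriv uInf‖ ≤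
      2 * ‖(h.inputStateDeriv (u m) - h.inputStateDeriv uInf) v‖ := by
    intro m
    rcases eq_or_lt_of_le (norm_nonneg (h.inputStateDeriv (u m) - h.inputStateDeriv uInf)) with
      h0 | hpos
    · exact ⟨0, by simp, by rw [← h0]; positivity⟩
    · obtain ⟨v, hv1, hv2⟩ := ContinuousLinearMap.exists_lt_apply_of_lt_opNorm
        (h.inputStateDeriv (u m) - h.inputStateDeriv uInf) (half_lt_self hpos)
      exact ⟨v, hv1.le, by linarith⟩
  choose v hv1 hv2 using hv
  refine (tendsto_iff_norm_sub_tendsto_zero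
    (E := Control k q T →L[ℝ] C(Icc (0 : ℝ) T, Lp (EuclideanSpace ℝ (Fin n)) P μ))).2 ?_
  have hlim : Tendsto (fun m => ‖(h.inputStateDeriv (u m) - h.inputStateDeriv uInf) (v m)‖) atTop
      (𝓝 0) := by
    set M := K * controlGrowth K T q ρ ^ 2 * T ^ holderExponent q with hM
    have hM0 : 0 ≤ M := by positivity
    refine tendsto_norm_curve_zero (b := fun θ => (M + M) * (1 + ‖x₀ θ‖) ^ 2)
      (ζ := fun m t θ => linTrajectory F x₀ T (u m) (v m) θ t - linTrajectory F x₀ T uInf (v m) θ t)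
      h.ne_top (h.memLp.const_mul _) (fun m t => ?_) (fun m t => ?_) ?_
    · rw [sub_apply, ContinuousMap.sub_apply]
      filter_upwards [h.coeFn_inputStateDeriv (u m) (v m) t, h.coeFn_inputStateDeriv uInf (v m) t,
        Lp.coeFn_sub (h.inputStateDeriv (u m) (v m) t) (h.inputStateDeriv uInf (v m) t)] with
        θ h1 h2 h3
      rw [h3, Pi.sub_apply, h1, h2]
    · filter_upwards [h.ae_regular] with θ hθ
      have hle : M * ‖v m‖ ≤ M := by
        simpa using mul_le_mul_of_nonneg_left (hv1 m) hM0
      rw [add_mul]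
      refine (norm_sub_le _ _).trans (add_le_add ?_ ?_)
      · refine (hθ.norm_linTrajectory_le hT (hρ m) (v m) t.2).trans ?_
        gcongr
      · refine (hθ.norm_linTrajectory_le hT hρI (v m) t.2).trans ?_
        gcongr
    · filter_upwards [h.ae_regular] with θ hθ ε hε
      filter_upwards [hθ.eventually_norm_linTrajectory_sub_le (x₀ := x₀) hT hq hq_top hu hε] with
        m hm t
      exact hm (v m) (hv1 m) t t.2
  refine squeeze_zero (fun _ => ContinuousLinearMap.opNorm_nonneg _) hv2 ?_
  simpa using hlim.const_mul 2

end Weak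

end IsRegularEnsemble

end

/-! ### The integral cost -/

section

theorem holderTriple_ofReal {a b c : ℝ} (ha : 0 < a) (hb : 0 < b) (hc : 0 < c)
    (h : a⁻¹ + b⁻¹ = c⁻¹) :
    ENNReal.HolderTriple (ENNReal.ofReal a) (ENNReal.ofReal b) (ENNReal.ofReal c) where
  inv_add_inv_eq_inv := by
    rw [← ENNReal.ofReal_inv_of_pos ha, ← ENNReal.ofReal_inv_of_pos hb,
      ← ENNReal.ofReal_inv_of_pos hc, ← h, ENNReal.ofReal_add] <;> positivity

section Hypotheses

variable {Θ : Type*} [MeasurableSpace Θ] {μ : Measure Θ} {n k : ℕ} {T p : ℝ}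

/-- The integrand acts from `L^p` to `L¹`. -/
theorem AdmissibleIntegrand.exists_isNemytskijKernel
    {a : Icc (0 : ℝ) T → EuclideanSpace ℝ (Fin n) → Θ → ℝ} (ha : AdmissibleIntegrand μ T p a)
    (hp : 2 < p) : ∃ C g, IsNemytskijKernel μ T (ENNReal.ofReal p)
      (ENNReal.ofReal (p / (p - 1))) 1 (p - 1) C g a := by
  obtain ⟨C, hC, g, -, hg, hlip⟩ := ha.lipschitz
  exact ⟨C, g,
    { one_le := by
        rw [ENNReal.one_le_ofReal, one_le_div (by linarith)]
        linarith
      mul_eq := by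
        rw [← ENNReal.ofReal_mul (div_nonneg (by linarith) (by linarith)),
          div_mul_cancel₀ _ (by linarith)]
      exponent_pos := by linarith
      nonneg := hC.le
      ne_top := ENNReal.one_ne_top
      memLp := hg
      continuous := ha.continuous
      aestronglyMeasurable := fun t x => (ha.measurable t x).aestronglyMeasurable
      norm_sub_le := hlip
      memLp_zero := ha.integrable_zero }⟩

/-- The derivative of the integrand acts from `L^p` to the dual exponent `L^{p/(p-1)}`. -/
theorem AdmissibleIntegrand.exists_isNemytskijKernel_fderiv
    {a : Icc (0 : ℝ) T → EuclideanSpace ℝ (Fin n) → Θ → ℝ} (ha : AdmissibleIntegrand μ T p a)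
    (hp : 2 < p) : ∃ C g, IsNemytskijKernel μ T (ENNReal.ofReal p)
      (ENNReal.ofReal (p / (p - 2))) (ENNReal.ofReal (p / (p - 1))) (p - 2) C g
      fun t x θ => fderiv ℝ (fun z => a t z θ) x := by
  obtain ⟨C, hC, g, -, hg, hlip⟩ := ha.lipschitz_Dx
  exact ⟨C, g,
    { one_le := by
        rw [ENNReal.one_le_ofReal, one_le_div (by linarith)]
        linarith
      mul_eq := by
        rw [← ENNReal.ofReal_mul (div_nonneg (by linarith) (by linarith)),
          div_mul_cancel₀ _ (by linarith)]
      exponent_pos := by linarith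
      nonneg := hC.le
      ne_top := ENNReal.ofReal_ne_top
      memLp := hg
      continuous := ha.continuous_Dx
      aestronglyMeasurable := fun t x => (ha.aemeasurable_Dx t x).aestronglyMeasurable
      norm_sub_le := hlip
      memLp_zero := ha.integrable_Dx_zero }⟩

/-- On a probability space `x₀ ∈ L^{p₀}` with `p ≤ p₀ / 2` gives `(1 + |x₀|)² ∈ L^p`. -/
theorem memLp_one_add_norm_sq [IsProbabilityMeasure μ] {E : Type*} [NormedAddCommGroup E]
    {x₀ : Θ → E} {p₀ : ℝ} (hx₀ : MemLp x₀ (ENNReal.ofReal p₀) μ) (hp : p ≤ p₀ / 2) :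
    MemLp (fun θ => (1 + ‖x₀ θ‖) ^ 2) (ENNReal.ofReal p) μ := by
  have h2 : (2 : ℝ≥0∞) = ENNReal.ofReal 2 := by simp
  have h0 : MemLp (fun θ => 1 + ‖x₀ θ‖) (ENNReal.ofReal p₀) μ := (memLp_const (1 : ℝ)).add hx₀.norm
  have h1 : MemLp (fun θ => 1 + ‖x₀ θ‖) (ENNReal.ofReal (2 * p)) μ :=
    h0.mono_exponent (ENNReal.ofReal_le_ofReal (by linarith))
  have h := h1.norm_rpow_div 2
  have e : ENNReal.ofReal (2 * p) / 2 = ENNReal.ofReal p := by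
    rw [h2, ← ENNReal.ofReal_div_of_pos two_pos, mul_div_cancel_left₀ _ two_ne_zero]
  rw [e] at h
  convert h using 2 with θ
  rw [Real.norm_of_nonneg (by positivity)]
  simp

theorem FieldsLipschitz.exists_isRegularEnsemble [IsProbabilityMeasure μ]
    {F : Fin k → EuclideanSpace ℝ (Fin n) → Θ → EuclideanSpace ℝ (Fin n)}
    {x₀ : Θ → EuclideanSpace ℝ (Fin n)} {p₀ : ℝ} (hF : FieldsLipschitz μ F) (hF' : FieldsC1 μ F)
    (hT : 0 ≤ T) (hx₀ : MemLp x₀ (ENNReal.ofReal p₀) μ) (hp : p ≤ p₀ / 2) :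
    ∃ K, IsRegularEnsemble μ T K (ENNReal.ofReal p) F x₀ := by
  obtain ⟨K, hK, hreg⟩ := exists_isRegularParameter hF hF'
  exact ⟨K, hT, hK, ENNReal.ofReal_ne_top, hF.measurable, hreg, hx₀.1,
    memLp_one_add_norm_sq hx₀ hp⟩

end Hypotheses

section Cost

theorem tendsto_const_comp_comp {ι V₁ V₂ V₃ V₄ : Type*} [NormedAddCommGroup V₁] [NormedSpace ℝ V₁]
    [NormedAddCommGroup V₂] [NormedSpace ℝ V₂] [NormedAddCommGroup V₃] [NormedSpace ℝ V₃]
    [NormedAddCommGroup V₄] [NormedSpace ℝ V₄] {l : Filter ι} (L : V₃ →L[ℝ] V₄)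
    {B : ι → V₂ →L[ℝ] V₃} {B' : V₂ →L[ℝ] V₃} {D : ι → V₁ →L[ℝ] V₂} {D' : V₁ →L[ℝ] V₂}
    (hB : Tendsto B l (𝓝 B')) (hD : Tendsto D l (𝓝 D')) :
    Tendsto (fun i => L ∘L (B i ∘L D i)) l (𝓝 (L ∘L (B' ∘L D'))) := by
  have hc : Continuous fun p : (V₂ →L[ℝ] V₃) × (V₁ →L[ℝ] V₂) => L ∘L (p.1 ∘L p.2) :=
    continuous_const.clm_comp (continuous_fst.clm_comp continuous_snd)
  exact (hc.tendsto (B', D')).comp (hB.prodMk_nhds hD)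

theorem continuous_comp_of_continuousOn {E G : Type*} [TopologicalSpace E] [TopologicalSpace G]
    {T : ℝ} {f : Icc (0 : ℝ) T → E → G} (hf : Continuous fun p : Icc (0 : ℝ) T × E => f p.1 p.2)
    {x : ℝ → E} (hx : ContinuousOn x (Icc 0 T)) : Continuous fun t : Icc (0 : ℝ) T => f t (x t) :=
  hf.comp (continuous_id.prodMk (continuousOn_iff_continuous_domRestrict.1 hx))

theorem integrable_of_continuous {I : Type*} [TopologicalSpace I] [CompactSpace I]
    [MeasurableSpace I] [OpensMeasurableSpace I] {ν : Measure I} [IsFiniteMeasure ν] {f : I → ℝ}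
    (hf : Continuous f) : Integrable f ν :=
  hf.integrable_of_hasCompactSupport (HasCompactSupport.of_compactSpace f)

variable {Θ : Type*} [MeasurableSpace Θ] {μ : Measure Θ} {n k : ℕ} {T K : ℝ} {q P S₀ S τ : ℝ≥0∞}
  {σ₀ C₀ σ C : ℝ} {g₀ g : Θ → ℝ}
  {F : Fin k → EuclideanSpace ℝ (Fin n) → Θ → EuclideanSpace ℝ (Fin n)}
  {x₀ : Θ → EuclideanSpace ℝ (Fin n)} {a : Icc (0 : ℝ) T → EuclideanSpace ℝ (Fin n) → Θ → ℝ}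
  [Fact (1 ≤ q)] [Fact (1 ≤ P)] [Fact (1 ≤ τ)]
  [ENNReal.HolderTriple S₀ P 1] [ENNReal.HolderTriple S P τ] [ENNReal.HolderTriple τ P 1]

namespace IsRegularEnsemble

/-- The integral cost `J_u = ∫ A(X^u)_t dν(t)`. -/
noncomputable def cost (h : IsRegularEnsemble μ T K P F x₀)
    (hφ : IsNemytskijKernel μ T P S₀ 1 σ₀ C₀ g₀ a) (ν : Measure (Icc (0 : ℝ) T)) [IsFiniteMeasure ν]
    (u : Control k q T) : Lp ℝ 1 μ :=
  integralCLM ν (hφ.operator (h.inputState u))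

/-- The derivative `v ↦ ∫ D_xA(X^u)_t [(D_uX^u[v])_t] dν(t)` of the integral cost. -/
noncomputable def costDeriv (h : IsRegularEnsemble μ T K P F x₀)
    (hD : IsNemytskijKernel μ T P S τ σ C g fun t x θ => fderiv ℝ (fun z => a t z θ) x)
    (ν : Measure (Icc (0 : ℝ) T)) [IsFiniteMeasure ν]
    (u : Control k q T) : Control k q T →L[ℝ] Lp ℝ 1 μ :=
  (integralCLM ν) ∘L ((applyCurve (hD.derivOperator (h.inputState u))) ∘L (h.inputStateDeriv u))

variable {ν : Measure (Icc (0 : ℝ) T)} [IsFiniteMeasure ν]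

theorem coeFn_cost (h : IsRegularEnsemble μ T K P F x₀)
    (hφ : IsNemytskijKernel μ T P S₀ 1 σ₀ C₀ g₀ a) (u : Control k q T) :
    h.cost hφ ν u =ᵐ[μ] fun θ => ∫ t, a t (trajectory F x₀ T u θ t) θ ∂ν := by
  rw [cost, integralCLM_apply]
  refine integral_curve_ae_eq ν (φ := fun t θ => a t (trajectory F x₀ T u θ t) θ) _ (fun t => ?_) ?_
  · filter_upwards [hφ.coeFn_operator (h.inputState u) t, h.coeFn_inputState u t] with θ h1 h2
    rw [h1, h2]
  · filter_upwards [h.ae_regular, hφ.continuous] with θ hθ hc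
    exact continuous_comp_of_continuousOn (f := fun t x => a t x θ) hc
      (hθ.isStateSolution h.nonneg_time (integrableOn_control u)).1

theorem coeFn_costDeriv (h : IsRegularEnsemble μ T K P F x₀)
    (hD : IsNemytskijKernel μ T P S τ σ C g fun t x θ => fderiv ℝ (fun z => a t z θ) x)
    (u v : Control k q T) :
    h.costDeriv hD ν u v =ᵐ[μ] fun θ => ∫ t, Dx a t (trajectory F x₀ T u θ t) θ
      (linTrajectory F x₀ T u v θ t) ∂ν := by
  refine integral_curve_ae_eq ν
    (φ := fun t θ => Dx a t (trajectory F x₀ T u θ t) θ (linTrajectory F x₀ T u v θ t))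
    (applyCurve (hD.derivOperator (h.inputState u)) (h.inputStateDeriv u v)) (fun t => ?_) ?_
  · rw [applyCurve_apply]
    filter_upwards [hD.coeFn_derivOperator (h.inputState u) t (h.inputStateDeriv u v t),
      h.coeFn_inputState u t, h.coeFn_inputStateDeriv u v t] with θ h1 h2 h3
    rw [h1, h2, h3, Dx]
  · filter_upwards [h.ae_regular, hD.continuous] with θ hθ hc
    refine (continuous_comp_of_continuousOn (f := fun t x => Dx a t x θ) hc
      (hθ.isStateSolution h.nonneg_time (integrableOn_control u)).1).clm_apply ?_
    exact continuousOn_iff_continuous_domRestrict.1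
      (hθ.isLinSolution h.nonneg_time (integrableOn_control u) (integrableOn_control v)).1

theorem hasFDerivAt_cost (h : IsRegularEnsemble μ T K P F x₀)
    (hφ : IsNemytskijKernel μ T P S₀ 1 σ₀ C₀ g₀ a)
    (hdiff : ∀ᵐ θ ∂μ, ∀ t, Differentiable ℝ fun x => a t x θ)
    (hD : IsNemytskijKernel μ T P S τ σ C g fun t x θ => fderiv ℝ (fun z => a t z θ) x)
    (u : Control k q T) : HasFDerivAt (h.cost hφ ν) (h.costDeriv hD ν u) u :=
  (integralCLM (I := Icc (0 : ℝ) T) (W := Lp ℝ 1 μ) ν).hasFDerivAt.comp u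
    ((hφ.hasFDerivAt_operator hdiff hD (h.inputState u)).comp u (h.hasFDerivAt_inputState u))

theorem tendsto_costDeriv_of_weak (h : IsRegularEnsemble μ T K P F x₀)
    (hD : IsNemytskijKernel μ T P S τ σ C g fun t x θ => fderiv ℝ (fun z => a t z θ) x)
    (hq : 1 < q) (hq_top : q < ∞) {u : ℕ → Control k q T} {uInf : Control k q T}
    (hu : Tendsto (fun m => toWeakSpace ℝ (Control k q T) (u m)) atTop
      (𝓝 (toWeakSpace ℝ (Control k q T) uInf))) :
    Tendsto (fun m => h.costDeriv hD ν (u m)) atTop (𝓝 (h.costDeriv hD ν uInf)) := by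
  have h1 : Tendsto (fun m => applyCurve (hD.derivOperator (h.inputState (u m)))) atTop
      (𝓝 (applyCurve (hD.derivOperator (h.inputState uInf)))) :=
    ((applyCurve.continuous.comp hD.continuous_derivOperator).tendsto _).comp
      (h.tendsto_inputState_of_weak hq hq_top hu)
  have h2 : Tendsto (fun m => h.inputStateDeriv (u m)) atTop (𝓝 (h.inputStateDeriv uInf)) :=
    h.tendsto_inputStateDeriv_of_weak hq hq_top hu
  unfold costDeriv
  exact tendsto_const_comp_comp _ h1 h2

/-- Strong convergence of the controls implies weak convergence. -/
theorem continuous_costDeriv (h : IsRegularEnsemble μ T K P F x₀)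
    (hD : IsNemytskijKernel μ T P S τ σ C g fun t x θ => fderiv ℝ (fun z => a t z θ) x)
    (hq : 1 < q) (hq_top : q < ∞) :
    Continuous (h.costDeriv hD ν : Control k q T → Control k q T →L[ℝ] Lp ℝ 1 μ) := by
  rw [continuous_iff_seqContinuous]
  intro u uInf hu
  exact h.tendsto_costDeriv_of_weak hD hq hq_top
    (((toWeakSpaceCLM ℝ (Control k q T)).continuous.tendsto uInf).comp hu)

end IsRegularEnsemble

end Cost

end

end EnsembleControl

theorem mainTheorem2 {Θ : Type*} [MetricSpace Θ] [MeasurableSpace Θ] [BorelSpace Θ]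
    (μ : Measure Θ) [IsProbabilityMeasure μ] {n k : ℕ} (T : ℝ) (hT : 0 < T)
    (q : ℝ≥0∞) [Fact (1 ≤ q)] (hq : 1 < q) (hq_top : q < ∞)
    (p₀ p₁ : ℝ) (hp₀ : 4 < p₀) (hp₁ : 2 < p₁) (hp₁_le : p₁ ≤ p₀ / 2)
    [Fact (1 ≤ ENNReal.ofReal p₁)]
    (F : Fin k → EuclideanSpace ℝ (Fin n) → Θ → EuclideanSpace ℝ (Fin n))
    (hF : EnsembleControl.FieldsLipschitz μ F) (hF' : EnsembleControl.FieldsC1 μ F)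
    (x₀ : Θ → EuclideanSpace ℝ (Fin n)) (hx₀ : MemLp x₀ (ENNReal.ofReal p₀) μ)
    (ν : Measure (Icc (0 : ℝ) T)) [IsFiniteMeasure ν]
    (a : Icc (0 : ℝ) T → EuclideanSpace ℝ (Fin n) → Θ → ℝ)
    (ha : EnsembleControl.AdmissibleIntegrand μ T p₁ a) :
    -- off one null set of parameters: trajectories and linearized trajectories exist and are
    -- unique, and the integrals over `[0,T]` below converge
    (∀ᵐ θ ∂μ, ∀ u : EnsembleControl.Control k q T,
      EnsembleControl.IsTrajectory F x₀ T u θ (EnsembleControl.trajectory F x₀ T u θ) ∧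
      (∀ x, EnsembleControl.IsTrajectory F x₀ T u θ x →
        EqOn x (EnsembleControl.trajectory F x₀ T u θ) (Icc 0 T)) ∧
      Integrable (fun t : Icc (0 : ℝ) T => a t (EnsembleControl.trajectory F x₀ T u θ t) θ) ν ∧
      ∀ v : EnsembleControl.Control k q T,
        EnsembleControl.IsLinTrajectory F x₀ T u v θ
          (EnsembleControl.linTrajectory F x₀ T u v θ) ∧
        (∀ y, EnsembleControl.IsLinTrajectory F x₀ T u v θ y →
          EqOn y (EnsembleControl.linTrajectory F x₀ T u v θ) (Icc 0 T)) ∧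
        Integrable (fun t : Icc (0 : ℝ) T =>
          EnsembleControl.Dx a t (EnsembleControl.trajectory F x₀ T u θ t) θ
            (EnsembleControl.linTrajectory F x₀ T u v θ t)) ν) ∧
    ∃ (X : EnsembleControl.Control k q T →
          C(Icc (0 : ℝ) T, Lp (EuclideanSpace ℝ (Fin n)) (ENNReal.ofReal p₁) μ))
      (DX : EnsembleControl.Control k q T → EnsembleControl.Control k q T →L[ℝ]
          C(Icc (0 : ℝ) T, Lp (EuclideanSpace ℝ (Fin n)) (ENNReal.ofReal p₁) μ))
      (A : C(Icc (0 : ℝ) T, Lp (EuclideanSpace ℝ (Fin n)) (ENNReal.ofReal p₁) μ) →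
          C(Icc (0 : ℝ) T, Lp ℝ 1 μ))
      (DxA : C(Icc (0 : ℝ) T, Lp (EuclideanSpace ℝ (Fin n)) (ENNReal.ofReal p₁) μ) →
          C(Icc (0 : ℝ) T, Lp (EuclideanSpace ℝ (Fin n)) (ENNReal.ofReal p₁) μ →L[ℝ] Lp ℝ 1 μ))
      (A' : C(Icc (0 : ℝ) T, Lp (EuclideanSpace ℝ (Fin n)) (ENNReal.ofReal p₁) μ) →
          C(Icc (0 : ℝ) T, Lp (EuclideanSpace ℝ (Fin n)) (ENNReal.ofReal p₁) μ) →L[ℝ]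
            C(Icc (0 : ℝ) T, Lp ℝ 1 μ))
      (J : EnsembleControl.Control k q T → Lp ℝ 1 μ)
      (DJ : EnsembleControl.Control k q T → EnsembleControl.Control k q T →L[ℝ] Lp ℝ 1 μ),
      -- the ensemble trajectory and its Fréchet derivative
      (∀ u t, X u t =ᵐ[μ] fun θ => EnsembleControl.trajectory F x₀ T u θ t) ∧
      (∀ u, HasFDerivAt X (DX u) u) ∧
      (∀ u v t, DX u v t =ᵐ[μ] fun θ => EnsembleControl.linTrajectory F x₀ T u v θ t) ∧
      -- the Nemytskij operators of `a` and `D_x a`, and the Fréchet derivative of the former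
      (∀ Z t, A Z t =ᵐ[μ] fun θ => a t (Z t θ) θ) ∧
      (∀ Z t ζ, DxA Z t ζ =ᵐ[μ] fun θ => EnsembleControl.Dx a t (Z t θ) θ (ζ θ)) ∧
      (∀ Z, HasFDerivAt A (A' Z) Z) ∧
      (∀ Z ζ t, A' Z ζ t = DxA Z t (ζ t)) ∧
      -- the cost, as a Bochner integral in `L¹` and pointwise
      (∀ u, J u = ∫ t, A (X u) t ∂ν) ∧
      (∀ u, J u =ᵐ[μ] fun θ => ∫ t, a t (EnsembleControl.trajectory F x₀ T u θ t) θ ∂ν) ∧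
      -- continuous Fréchet differentiability of `J`, and its derivative in both forms
      (∀ u, HasFDerivAt J (DJ u) u) ∧
      Continuous DJ ∧
      (∀ u v, DJ u v = ∫ t, A' (X u) (DX u v) t ∂ν) ∧
      (∀ u v, DJ u v =ᵐ[μ] fun θ =>
        ∫ t, EnsembleControl.Dx a t (EnsembleControl.trajectory F x₀ T u θ t) θ
          (EnsembleControl.linTrajectory F x₀ T u v θ t) ∂ν) ∧
      -- weak convergence of the controls gives convergence of the derivatives in operator norm
      (∀ (u : ℕ → EnsembleControl.Control k q T) (uInf : EnsembleControl.Control k q T),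
        Tendsto (fun m => toWeakSpace ℝ (EnsembleControl.Control k q T) (u m)) atTop
          (𝓝 (toWeakSpace ℝ (EnsembleControl.Control k q T) uInf)) →
        Tendsto (fun m => ‖DJ (u m) - DJ uInf‖) atTop (𝓝 0)) := by
  -- Hölder exponents: `(p₁-1)/p₁ + 1/p₁ = 1` and `(p₁-2)/p₁ + 1/p₁ = (p₁-1)/p₁`
  have hprod1 : ENNReal.HolderTriple (ENNReal.ofReal (p₁ / (p₁ - 1))) (ENNReal.ofReal p₁) 1 := by
    rw [← ENNReal.ofReal_one]
    refine EnsembleControl.holderTriple_ofReal (div_pos (by linarith) (by linarith))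
      (by linarith) one_pos ?_
    have : p₁ ≠ 0 := by linarith
    rw [inv_div]
    field_simp
    ring
  have hprod2 : ENNReal.HolderTriple (ENNReal.ofReal (p₁ / (p₁ - 2))) (ENNReal.ofReal p₁)
      (ENNReal.ofReal (p₁ / (p₁ - 1))) := by
    refine EnsembleControl.holderTriple_ofReal (div_pos (by linarith) (by linarith))
      (by linarith) (div_pos (by linarith) (by linarith)) ?_
    have : p₁ ≠ 0 := by linarith
    rw [inv_div, inv_div]
    field_simp
    ring
  have hone : Fact (1 ≤ ENNReal.ofReal (p₁ / (p₁ - 1))) := ⟨by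
    rw [ENNReal.one_le_ofReal, one_le_div (by linarith)]
    linarith⟩
  obtain ⟨K, h⟩ := hF.exists_isRegularEnsemble hF' hT.le hx₀ hp₁_le
  obtain ⟨C₀, g₀, hφ⟩ := ha.exists_isNemytskijKernel hp₁
  obtain ⟨C, g, hD⟩ := ha.exists_isNemytskijKernel_fderiv hp₁
  refine ⟨?_, h.inputState, h.inputStateDeriv, hφ.operator, hD.derivOperator,
    fun Z => EnsembleControl.applyCurve (hD.derivOperator Z), h.cost hφ ν, h.costDeriv hD ν,
    h.coeFn_inputState, h.hasFDerivAt_inputState, h.coeFn_inputStateDeriv, hφ.coeFn_operator,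
    hD.coeFn_derivOperator, hφ.hasFDerivAt_operator ha.differentiable hD, fun _ _ _ => rfl,
    fun _ => rfl, h.coeFn_cost hφ, h.hasFDerivAt_cost hφ ha.differentiable hD,
    h.continuous_costDeriv hD hq hq_top, fun _ _ => rfl, h.coeFn_costDeriv hD,
    fun u uInf hu => tendsto_iff_norm_sub_tendsto_zero.1
      (h.tendsto_costDeriv_of_weak hD hq hq_top hu)⟩
  filter_upwards [h.ae_regular, ha.continuous, ha.continuous_Dx] with θ hθ hc hcD u
  have hu := EnsembleControl.integrableOn_control u
  have hx := hθ.isStateSolution (x₀ := x₀) hT.le hu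
  refine ⟨EnsembleControl.isTrajectory_iff.2 hx,
    fun x hx' => hθ.eqOn_trajectory hT.le hu (EnsembleControl.isTrajectory_iff.1 hx'),
    EnsembleControl.integrable_of_continuous
      (EnsembleControl.continuous_comp_of_continuousOn (f := fun t x => a t x θ) hc hx.1),
    fun v => ?_⟩
  have hv := EnsembleControl.integrableOn_control v
  have hy := hθ.isLinSolution (x₀ := x₀) hT.le hu hv
  refine ⟨(EnsembleControl.isLinTrajectory_iff hθ).2 hy, fun y hy' => hθ.eqOn_linTrajectory hT.le
    hu hv ((EnsembleControl.isLinTrajectory_iff hθ).1 hy'),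
    EnsembleControl.integrable_of_continuous ?_⟩
  exact (EnsembleControl.continuous_comp_of_continuousOn
    (f := fun t x => EnsembleControl.Dx a t x θ) hcD hx.1).clm_apply
    (continuousOn_iff_continuous_domRestrict.1 hy.1)
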